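/- Let $1\le m\le n$ and let $M$ be a nonempty compact smooth $m$-dimensional manifold, possibly with boundary. Let $\Omega^1(M,\mathbb R^n)$ be the space of smooth $\mathbb R^n$-valued one-forms on $M$, and let $\Omega^1_+(M,\mathbb R^n)$ be the open subset of those $\alpha$ for which $\alpha(x):T_xM\to\mathbb R^n$ is injective for every $x\in M$. On $\Omega^1_+(M,\mathbb R^n)$ consider the generalized Ebin metric, given in local coordinates (in which $\alpha_x,\zeta_x,\eta_x$ are $n\times m$ matrices) by $$G_\alpha(\zeta,\eta)=\int_M \operatorname{tr}\big(\zeta_x(\alpha_x^T\alpha_x)^{-1}\eta_x^T\big)\sqrt{\det(\alpha_x^T\alpha_x)}\,dx ,$$ and on the set $M_+(n,m)$ of real $n\times m$ matrices of rank $m$ consider the metric $\langle u,v\rangle_a=\operatorname{tr}(u(a^Ta)^{-1}v^T)\sqrt{\det(a^Ta)}$. Write $a^+=(a^Ta)^{-1}a^T$. For either metric let $\Gamma$ be the Christoffel symbol of the Levi-Civita connection, determined by the Koszul formula, in the sign convention in which geodesics satisfy $a_{tt}=\Gamma_a(a_t,a_t)$, and put $$R_a(u,v)w=-d\Gamma_a(u)(v,w)+d\Gamma_a(v)(u,w)+\Gamma_a(u,\Gamma_a(v,w))-\Gamma_a(v,\Gamma_a(u,w)).$$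 Let $\mathcal K_a(u,v)$ be the inner product at $a$ of $R_a(u,v)v$ with $u$; for orthonormal $u,v$ this is the sectional curvature. A path of one-forms is called smooth if it is smooth jointly in $(t,x)$. A smooth path in $\Omega^1_+$ on an open set $J$ of times is a geodesic if on every $[t_0,t_1]\subset J$ it is a critical point of the energy $\int_{t_0}^{t_1} G_\alpha(\alpha_t,\alpha_t)\,dt$ with respect to smooth variations vanishing at $t_0$ and $t_1$. **Connection.** $\Gamma$ exists and is unique on $M_+(n,m)$, where it is differentiable in the foot point, and on $\Omega^1_+(M,\mathbb R^n)$, where it maps smooth paths to smooth paths. It is pointwise: in any basis of $T_xM$, the matrix of $\Gamma_\alpha(\zeta,\eta)(x)$ is the Christoffel symbol of $M_+(n,m)$ at $\alpha_x$ applied to $\zeta_x,\eta_x$. **Geodesic equation.** A smooth path $\alpha$ in $\Omega^1_+(M,\mathbb R^n)$ on an open set $J$ is a geodesic if and only if $\alpha_{tt}=\Gamma_\alpha(\alpha_t,\alpha_t)$ on $J$, and if and only if for every $x\in M$ the matrix $a(t)$ of $\alpha(t,x)$ in any basis of $T_xM$ solves on $J$ the ordinary differential equation $$a_{tt}=a_t(a^Ta)^{-1}a_t^Ta+a_t(a^Ta)^{-1}a^Ta_t-a(a^Ta)^{-1}a_t^Ta_t+\tfrac12\operatorname{tr}\big(a_t(a^Ta)^{-1}a_t^T\big)a-\operatorname{tr}\big(a_t(a^Ta)^{-1}a^T\big)a_t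 .$$ **Explicit solution.** Let $\alpha_0\in\Omega^1_+(M,\mathbb R^n)$ and $\zeta_0\in\Omega^1(M,\mathbb R^n)$. For $x\in M$ and a basis of $T_xM$, let $a_0,v_0$ be the matrices of $\alpha_0(x),\zeta_0(x)$ and put $L=v_0a_0^+$, $\tau=\operatorname{tr}L$, $\delta=\operatorname{tr}(L^TL)$, and $$f(t)=\tfrac{m\delta}{4}t^2+\tau t+1,\quad s(t)=\int_0^t\frac{d\sigma}{f(\sigma)},\quad \omega_0=L^T-L,\quad P_0=(a_0^Ta_0)^{-1}v_0^Ta_0-\tfrac{\tau}{m}I .$$ There is $\varepsilon>0$ such that $f>0$ on $(-\varepsilon,\varepsilon)$ for all $x\in M$. For every open interval $J\ni0$, a geodesic $\alpha$ on $J$ with $\alpha(0)=\alpha_0$, $\alpha_t(0)=\zeta_0$ exists if and only if $f>0$ on $J$ for every $x\in M$, and it is then given at every $x$ by $$a(t)=f(t)^{1/m}\,e^{-s(t)\omega_0}\,a_0\,e^{s(t)P_0},\qquad t\in J.$$ **Curvature.** Let $\alpha\in\Omega^1_+(M,\mathbb R^n)$ and $\zeta,\eta\in\Omega^1(M,\mathbb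 R^n)$. In local coordinates $$\mathcal K^{G}_\alpha(\zeta,\eta)=\int_M\mathcal K_{\alpha_x}(\zeta_x,\eta_x)\,dx ,$$ where on the right $\mathcal K$ is that of $M_+(n,m)$ and the integrand is an integrable density on $M$. Moreover: 1. If $\zeta$ or $\eta$ is a pure trace direction, i.e. $\lambda\alpha$ for a function $\lambda$ on $M$, then $\mathcal K^G_\alpha(\zeta,\eta)=0$. 2. Let $m\ge2$. If $\zeta$ and $\eta$ are horizontal, i.e. $\zeta_x\alpha_x^+$ and $\eta_x\alpha_x^+$ are symmetric for all $x$, then $\mathcal K^G_\alpha(\zeta,\eta)\le0$, with strict inequality if at some $x\in M$ the traceless parts $\zeta_x-\frac1m\operatorname{tr}(\zeta_x\alpha_x^+)\alpha_x$ and $\eta_x-\frac1m\operatorname{tr}(\eta_x\alpha_x^+)\alpha_x$ are linearly independent. For every $\alpha$ there are $G_\alpha$-orthonormal horizontal $\zeta,\eta$ with $\mathcal K^G_\alpha(\zeta,\eta)<0$. 3. If $m=1$, then $\mathcal K^G_\alpha(\zeta,\eta)\ge0$; if moreover $n=2$, then $\mathcal K^G_\alpha(\zeta,\eta)=0$. 4.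 If $m\in\{2,3\}$ and $n\ge m+2$, then for every $\alpha$ there are $G_\alpha$-orthonormal pairs $(\zeta,\eta)$ with $\mathcal K^G_\alpha(\zeta,\eta)>0$ and others with $\mathcal K^G_\alpha(\zeta,\eta)<0$. -/

import Mathlib

open Set Manifold ContDiff Matrix MeasureTheory Bundle

noncomputable section

namespace GenEbin

/-! ### Riemannian metrics on an open part of a vector space

`V` is the ambient vector space, `T ⊆ V` the linear space of admissible tangent vectors and
`g a u v` the inner product of `u` and `v` at the foot point `a`.  The same definitions are used
for the space of matrices and for the space of one-forms. -/

section Abstract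

variable {V : Type*} [AddCommGroup V] [Module ℝ V]

/-- `c` is the value `Γ_a(u, v)` of the Christoffel symbol of the Levi-Civita connection, in the
sign convention `∇_X Y = dY(X) - Γ(X, Y)`: for every tangent vector `w`, the Koszul formula
`2 g_a(c, w) = D_w g(u, v) - D_u g(v, w) - D_v g(u, w)` holds
(the directional derivatives being required to exist). -/
def IsChristoffelAt (T : Set V) (g : V → V → V → ℝ) (a u v c : V) : Prop :=
  c ∈ T ∧ ∀ w ∈ T,
    DifferentiableAt ℝ (fun t : ℝ => g (a + t • w) u v) 0 ∧
    DifferentiableAt ℝ (fun t : ℝ => g (a + t • u) v w) 0 ∧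
    DifferentiableAt ℝ (fun t : ℝ => g (a + t • v) u w) 0 ∧
    2 * g a c w = deriv (fun t : ℝ => g (a + t • w) u v) 0
      - deriv (fun t : ℝ => g (a + t • u) v w) 0
      - deriv (fun t : ℝ => g (a + t • v) u w) 0

/-- The Christoffel symbol `Γ_a(u, v)` (a junk value if it does not exist). -/
def christoffel (T : Set V) (g : V → V → V → ℝ) (a u v : V) : V :=
  Classical.epsilon (IsChristoffelAt T g a u v)

variable [TopologicalSpace V] [ContinuousSMul ℝ V]

/-- The directional derivative `dΓ_a(z)(u, v)`. -/
def christoffelDeriv (T : Set V) (g : V → V → V → ℝ) (a z u v : V) : V :=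
  deriv (fun t : ℝ => christoffel T g (a + t • z) u v) 0

/-- The Riemann curvature tensor `R_a(u, v) w`. -/
def riemann (T : Set V) (g : V → V → V → ℝ) (a u v w : V) : V :=
  - christoffelDeriv T g a u v w + christoffelDeriv T g a v u w
    + christoffel T g a u (christoffel T g a v w)
    - christoffel T g a v (christoffel T g a u w)

/-- `g_a(R_a(u, v) v, u)`; for `g_a`-orthonormal `u`, `v` this is the sectional curvature of the
plane spanned by `u` and `v`. -/
def sectional (T : Set V) (g : V → V → V → ℝ) (a u v : V) : ℝ :=
  g a (riemann T g a u v v) u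

/-- The energy of the path `γ` on `[t₀, t₁]`. -/
def energy (g : V → V → V → ℝ) (γ : ℝ → V) (t₀ t₁ : ℝ) : ℝ :=
  ∫ t in t₀..t₁, g (γ t) (deriv γ t) (deriv γ t)

end Abstract

/-- `u` and `v` are orthonormal at the foot point `a`. -/
def Orthonormal₂ {V : Type*} (g : V → V → V → ℝ) (a u v : V) : Prop :=
  g a u u = 1 ∧ g a v v = 1 ∧ g a u v = 0

/-! ### The space of full rank `n × m` matrices -/

section Matrices

variable {m n : ℕ}

/-- `⟨u, v⟩_a = tr(u (aᵀa)⁻¹ vᵀ) √det(aᵀa)`. -/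
def matMetric (a u v : Matrix (Fin n) (Fin m) ℝ) : ℝ :=
  (u * (aᵀ * a)⁻¹ * vᵀ).trace * √((aᵀ * a).det)

/-- The Moore-Penrose inverse `a⁺ = (aᵀa)⁻¹ aᵀ` of a matrix of rank `m`. -/
def pinv (a : Matrix (Fin n) (Fin m) ℝ) : Matrix (Fin m) (Fin n) ℝ :=
  (aᵀ * a)⁻¹ * aᵀ

/-- The right-hand side of the geodesic equation `a_tt = F(a, a_t)`. -/
def geodesicRHS (a v : Matrix (Fin n) (Fin m) ℝ) : Matrix (Fin n) (Fin m) ℝ :=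
  v * (aᵀ * a)⁻¹ * vᵀ * a + v * (aᵀ * a)⁻¹ * aᵀ * v - a * (aᵀ * a)⁻¹ * vᵀ * v
    + ((1 / 2 : ℝ) * (v * (aᵀ * a)⁻¹ * vᵀ).trace) • a
    - (v * (aᵀ * a)⁻¹ * aᵀ).trace • v

/-- `f(t) = (m δ / 4) t² + τ t + 1` with `L = v a⁺`, `δ = tr(LᵀL)`, `τ = tr L`, where `a` is the
initial position and `v` the initial velocity. -/
def solF (a v : Matrix (Fin n) (Fin m) ℝ) (t : ℝ) : ℝ :=
  (m : ℝ) * ((v * pinv a)ᵀ * (v * pinv a)).trace / 4 * t ^ 2 + (v * pinv a).trace * t + 1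

/-- `s(t) = ∫₀ᵗ dσ / f(σ)`. -/
def solS (a v : Matrix (Fin n) (Fin m) ℝ) (t : ℝ) : ℝ :=
  ∫ σ in (0 : ℝ)..t, 1 / solF a v σ

/-- `ω₀ = Lᵀ - L`. -/
def solOmega (a v : Matrix (Fin n) (Fin m) ℝ) : Matrix (Fin n) (Fin n) ℝ :=
  (v * pinv a)ᵀ - v * pinv a

/-- `P₀ = (aᵀa)⁻¹ vᵀ a - (τ / m) I`. -/
def solP (a v : Matrix (Fin n) (Fin m) ℝ) : Matrix (Fin m) (Fin m) ℝ :=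
  (aᵀ * a)⁻¹ * (vᵀ * a) - ((v * pinv a).trace / (m : ℝ)) • (1 : Matrix (Fin m) (Fin m) ℝ)

/-- `f(t)^{1/m} e^{-s(t) ω₀} a e^{s(t) P₀}`. -/
def explicitSol (a v : Matrix (Fin n) (Fin m) ℝ) (t : ℝ) : Matrix (Fin n) (Fin m) ℝ :=
  (solF a v t) ^ (1 / (m : ℝ)) •
    (NormedSpace.exp (-(solS a v t) • solOmega a v) * a *
      NormedSpace.exp (solS a v t • solP a v))

/-- The traceless part `u - (tr(u a⁺) / m) a` of `u`. -/
def tracelessPart (a u : Matrix (Fin n) (Fin m) ℝ) : Matrix (Fin n) (Fin m) ℝ :=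
  u - ((u * pinv a).trace / (m : ℝ)) • a

end Matrices

/-! ### One-forms with values in `ℝⁿ` on an `m`-dimensional manifold -/

section Forms

variable {m : ℕ} {H : Type*} [TopologicalSpace H]
  (I : ModelWithCorners ℝ (EuclideanSpace ℝ (Fin m)) H)
  (M : Type*) [TopologicalSpace M] [ChartedSpace H M] [IsManifold I ∞ M]
  (n : ℕ)

/-- `ℝⁿ`-valued one-forms without any regularity, with the topology of pointwise convergence. -/
abbrev RawForm : Type _ :=
  (x : M) → (TangentSpace I x →L[ℝ] EuclideanSpace ℝ (Fin n))

variable {M n}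

/-- The path `α` of one-forms is smooth on `J`, i.e. smooth in `(t, x) ∈ J × M` jointly. -/
def IsSmoothPathOn (J : Set ℝ) (α : ℝ → RawForm I M n) : Prop :=
  ContMDiffOn (𝓘(ℝ, ℝ).prod I)
    (I.prod 𝓘(ℝ, EuclideanSpace ℝ (Fin m) →L[ℝ] EuclideanSpace ℝ (Fin n))) ∞
    (fun p : ℝ × M => TotalSpace.mk' (EuclideanSpace ℝ (Fin m) →L[ℝ] EuclideanSpace ℝ (Fin n))
      (E := fun x : M => TangentSpace I x →L[ℝ] Bundle.Trivial M (EuclideanSpace ℝ (Fin n)) x)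
      p.2 (α p.1 p.2)) (J ×ˢ (univ : Set M))

variable (M n)

/-- `Ω¹(M, ℝⁿ)`: smooth one-forms. -/
def Omega : Set (RawForm I M n) :=
  {α | ContMDiff I (I.prod 𝓘(ℝ, EuclideanSpace ℝ (Fin m) →L[ℝ] EuclideanSpace ℝ (Fin n))) ∞
    (fun x : M => TotalSpace.mk' (EuclideanSpace ℝ (Fin m) →L[ℝ] EuclideanSpace ℝ (Fin n))
      (E := fun x : M => TangentSpace I x →L[ℝ] Bundle.Trivial M (EuclideanSpace ℝ (Fin n)) x)
      x (α x))}

/-- `Ω¹₊(M, ℝⁿ)`: smooth one-forms that are injective at every point. -/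
def OmegaPlus : Set (RawForm I M n) :=
  {α | α ∈ Omega I M n ∧ ∀ x, Function.Injective (α x)}

variable {M n}

/-- The `n × m` matrix of a linear map `L : T_xM → ℝⁿ` with respect to a frame `b` of `T_xM` and
the standard basis of `ℝⁿ`. -/
def frameMatrix {x : M} (b : Fin m → TangentSpace I x)
    (L : TangentSpace I x →L[ℝ] EuclideanSpace ℝ (Fin n)) : Matrix (Fin n) (Fin m) ℝ :=
  Matrix.of fun i j => L (b j) i

/-- The coordinate frame `∂/∂x¹, …, ∂/∂xᵐ` at `x`, for `x` in the domain of the chart `chartAt H c`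
(the inverse of the tangent bundle trivialization at `c` is the derivative of the inverse
chart). -/
def chartFrame (c x : M) : Fin m → TangentSpace I x :=
  fun j => (trivializationAt (EuclideanSpace ℝ (Fin m)) (TangentSpace I : M → Type _) c).symmL ℝ x
    (EuclideanSpace.single j (1 : ℝ))

/-- The matrix of `L : T_xM → ℝⁿ` in the coordinates of `chartAt H c`. -/
def chartMatrix (c x : M) (L : TangentSpace I x →L[ℝ] EuclideanSpace ℝ (Fin n)) :
    Matrix (Fin n) (Fin m) ℝ :=
  frameMatrix I (chartFrame I c x) L

variable (M) in
/-- A smooth partition of unity subordinate to the domains of the charts `chartAt H c`. -/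
def chartPartition [CompactSpace M] [T2Space M] : SmoothPartitionOfUnity M I M univ :=
  Classical.choose (SmoothPartitionOfUnity.exists_isSubordinate_chartAt_source I M)

/-- The summand, in the coordinates of `chartAt H c`, of the integral of a density. -/
def densityIntegrand [CompactSpace M] [T2Space M] (D : M → M → ℝ) (c : M)
    (y : EuclideanSpace ℝ (Fin m)) : ℝ :=
  chartPartition I M c ((extChartAt I c).symm y) * D c ((extChartAt I c).symm y)

/-- The integral over `M` of a density, `D c x` being its coefficient at `x` in the coordinates of
`chartAt H c` (coefficients in two charts differ by the absolute value of the Jacobian). -/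
def densityIntegral [CompactSpace M] [T2Space M] (D : M → M → ℝ) : ℝ :=
  ∑ᶠ c : M, ∫ y in (extChartAt I c).target, densityIntegrand I D c y

/-- All the integrals in `densityIntegral` converge. -/
def DensityIntegrable [CompactSpace M] [T2Space M] (D : M → M → ℝ) : Prop :=
  ∀ c : M, IntegrableOn (densityIntegrand I D c) (extChartAt I c).target

/-- The generalized Ebin metric `G_α(ζ, η) = ∫_M tr(ζ (αᵀα)⁻¹ ηᵀ) √det(αᵀα) dx`. -/
def formMetric [CompactSpace M] [T2Space M] (α ζ η : RawForm I M n) : ℝ :=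
  densityIntegral I fun c x =>
    matMetric (chartMatrix I c x (α x)) (chartMatrix I c x (ζ x)) (chartMatrix I c x (η x))

/-- The path `α` is a geodesic on the open set `J` of times: on every `[t₀, t₁] ⊆ J` it is a
critical point of the energy for smooth variations that vanish at the end points. -/
def IsGeodesicOn [CompactSpace M] [T2Space M] (J : Set ℝ) (α : ℝ → RawForm I M n) : Prop :=
  ∀ t₀ t₁ : ℝ, t₀ < t₁ → Icc t₀ t₁ ⊆ J → ∀ δ : ℝ → RawForm I M n,
    IsSmoothPathOn I univ δ → δ t₀ = 0 → δ t₁ = 0 →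
      HasDerivAt (fun s : ℝ => energy (formMetric I) (fun t => α t + s • δ t) t₀ t₁) 0 0

/-- `α` is a smooth path in `Ω¹₊` on `J`. -/
def IsOmegaPlusPathOn (J : Set ℝ) (α : ℝ → RawForm I M n) : Prop :=
  IsSmoothPathOn I J α ∧ ∀ t ∈ J, α t ∈ OmegaPlus I M n

/-- `α` is a geodesic on `J` in `Ω¹₊` with initial position `α₀` and initial velocity `ζ₀`. -/
def IsGeodesicFrom [CompactSpace M] [T2Space M] (J : Set ℝ) (α₀ ζ₀ : RawForm I M n)
    (α : ℝ → RawForm I M n) : Prop :=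
  IsOmegaPlusPathOn I J α ∧ IsGeodesicOn I J α ∧ α 0 = α₀ ∧ deriv α 0 = ζ₀

/-- `ζ` is a pure trace direction at `α`: `ζ = λ α` for a function `λ` on `M`. -/
def IsPureTrace (α ζ : RawForm I M n) : Prop :=
  ∃ l : M → ℝ, ∀ x, ζ x = l x • α x

/-- `ζ` is horizontal at `α`: `ζ α⁺` is symmetric at every point. -/
def IsHorizontal (α ζ : RawForm I M n) : Prop :=
  ∀ (x : M) (b : Module.Basis (Fin m) ℝ (TangentSpace I x)),
    (frameMatrix I b (ζ x) * pinv (frameMatrix I b (α x))).IsSymm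

end Forms

end GenEbin

end

/-! The metric contains no derivative in `x`, so the problem is decided in one tangent space at a
time. With `U = u a⁺`, `V = v a⁺` and the orthogonal projection `P = a a⁺` onto the column space,
the matrix metric is `tr(U Vᵀ)` times the volume `√det(aᵀa)`. A change of basis multiplies `a`, `u`,
`v` by the same invertible `q` on the right; this leaves `U`, `V`, `P` alone (`mul_mul_pinv_mul`)
and multiplies the volume by `|det q|`. Hence the Christoffel symbol and the explicit solution
transform like one-forms and the curvature like a density, and all are smooth in the foot point. The
Koszul formula for `G` is the integral of the pointwise one (`Full.koszul`, `isChristoffelAt_form`),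
and positivity of `G` on smooth forms gives uniqueness.

For geodesics, the Koszul formula and an integration by parts in `t` turn the first variation of the
energy into `-2 ∫ G(α_tt - Γ(α_t, α_t), δ) dt`. Taking for `δ` a cutoff of the defect itself gives
the geodesic equation (`isGeodesicOn_iff_defect`), which in frames is the matrix equation.

The matrix equation is solved by symmetry. Left multiplication by rotations is an isometry, and
right multiplication by invertible matrices and scaling change the metric only by constants. The
ansatz `k O a Q` therefore reduces the equation to one algebraic identity at the initial point
(`Full.geodesicRHS_add_smul`). Geometrically the full rank matrices form a metric cone with radial
field `a` and squared radius proportional to the volume. So the volume along every geodesic is a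
quadratic polynomial in time, namely the initial volume times `f` (`IsMatSolution.volume_eq`). This
makes `f > 0` necessary; where `f > 0` the explicit formula is a smooth solution, and it is the only
one by uniqueness for ordinary differential equations.

The curvature of `G` is the integral of the matrix curvature, a trace of words in `P`, `U`, `V`
(`curvOp`). Four evaluations carry the sign statements. It vanishes in radial directions. For
symmetric `U`, `V` it is `7/4 tr [U,V]²` minus `m/4` times the Gram determinant of the traceless
parts. For `m = 1` it is `3/4` times a Gram determinant. For two orthonormal normal directions
paired with one tangent direction it is `1 - m/4`. Since no derivative in `x` enters, bump functions
spread values prescribed at one point to smooth forms without spoiling the signs. -/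

noncomputable section

namespace GenEbin

/-! ### Calculus of matrix-valued functions -/

section MatrixCalculus

attribute [local instance] Matrix.normedAddCommGroup Matrix.normedSpace

variable {p q r : ℕ}

theorem hasDerivAt_matrix {A : ℝ → Matrix (Fin p) (Fin q) ℝ} {A' : Matrix (Fin p) (Fin q) ℝ}
    {t : ℝ} : HasDerivAt A A' t ↔ ∀ i j, HasDerivAt (fun s => A s i j) (A' i j) t :=
  hasDerivAt_pi.trans (forall_congr' fun _ => hasDerivAt_pi)

theorem _root_.HasDerivAt.matrix_mul {A : ℝ → Matrix (Fin p) (Fin q) ℝ}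
    {B : ℝ → Matrix (Fin q) (Fin r) ℝ} {A' : Matrix (Fin p) (Fin q) ℝ}
    {B' : Matrix (Fin q) (Fin r) ℝ} {t : ℝ} (hA : HasDerivAt A A' t) (hB : HasDerivAt B B' t) :
    HasDerivAt (fun s => A s * B s) (A' * B t + A t * B') t := by
  rw [hasDerivAt_matrix] at *
  intro i j
  simp only [Matrix.mul_apply, Matrix.add_apply, ← Finset.sum_add_distrib]
  exact HasDerivAt.fun_sum fun k _ => (hA i k).mul (hB k j)

theorem _root_.HasDerivAt.matrix_transpose {A : ℝ → Matrix (Fin p) (Fin q) ℝ}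
    {A' : Matrix (Fin p) (Fin q) ℝ} {t : ℝ} (hA : HasDerivAt A A' t) :
    HasDerivAt (fun s => (A s)ᵀ) A'ᵀ t := by
  rw [hasDerivAt_matrix] at *
  exact fun i j => hA j i

theorem _root_.HasDerivAt.matrix_trace {A : ℝ → Matrix (Fin p) (Fin p) ℝ}
    {A' : Matrix (Fin p) (Fin p) ℝ} {t : ℝ} (hA : HasDerivAt A A' t) :
    HasDerivAt (fun s => (A s).trace) A'.trace t := by
  rw [hasDerivAt_matrix] at hA
  exact HasDerivAt.fun_sum fun k _ => hA k k

variable {E : Type*} [NormedAddCommGroup E] [NormedSpace ℝ E] {x : E} {k : WithTop ℕ∞}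

theorem contDiffAt_matrix {A : E → Matrix (Fin p) (Fin q) ℝ} :
    ContDiffAt ℝ k A x ↔ ∀ i j, ContDiffAt ℝ k (fun y => A y i j) x :=
  contDiffAt_pi.trans (forall_congr' fun _ => contDiffAt_pi)

theorem _root_.ContDiffAt.matrix_mul {A : E → Matrix (Fin p) (Fin q) ℝ}
    {B : E → Matrix (Fin q) (Fin r) ℝ} (hA : ContDiffAt ℝ k A x) (hB : ContDiffAt ℝ k B x) :
    ContDiffAt ℝ k (fun y => A y * B y) x := by
  rw [contDiffAt_matrix] at *
  intro i j
  simp only [Matrix.mul_apply]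
  exact ContDiffAt.sum fun l _ => (hA i l).mul (hB l j)

theorem _root_.ContDiffAt.matrix_transpose {A : E → Matrix (Fin p) (Fin q) ℝ}
    (hA : ContDiffAt ℝ k A x) : ContDiffAt ℝ k (fun y => (A y)ᵀ) x := by
  rw [contDiffAt_matrix] at *
  exact fun i j => hA j i

theorem _root_.ContDiffAt.matrix_trace {A : E → Matrix (Fin p) (Fin p) ℝ}
    (hA : ContDiffAt ℝ k A x) : ContDiffAt ℝ k (fun y => (A y).trace) x := by
  rw [contDiffAt_matrix] at hA
  exact ContDiffAt.sum fun l _ => hA l l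

theorem _root_.ContDiffAt.matrix_det {A : E → Matrix (Fin p) (Fin p) ℝ}
    (hA : ContDiffAt ℝ k A x) : ContDiffAt ℝ k (fun y => (A y).det) x := by
  rw [contDiffAt_matrix] at hA
  simp only [Matrix.det_apply]
  exact ContDiffAt.sum fun σ _ => ContDiffAt.const_smul _ (contDiffAt_prod fun i _ => hA _ _)

/-- Cramer's rule: the inverse is the adjugate over the determinant, and each entry of the adjugate
is the determinant of `A` with one row replaced by a constant unit vector. -/
theorem _root_.ContDiffAt.matrix_inv {A : E → Matrix (Fin p) (Fin p) ℝ}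
    (hA : ContDiffAt ℝ k A x) (h : (A x).det ≠ 0) : ContDiffAt ℝ k (fun y => (A y)⁻¹) x := by
  simp only [Matrix.inv_def, Ring.inverse_eq_inv]
  refine ContDiffAt.smul (hA.matrix_det.inv h) ?_
  rw [contDiffAt_matrix]
  intro i j
  simp only [Matrix.adjugate_apply]
  refine ContDiffAt.matrix_det ?_
  rw [contDiffAt_matrix]
  intro i' j'
  by_cases hi : i' = j
  · subst hi
    simpa using contDiffAt_const
  · simpa [Matrix.updateRow_ne hi] using contDiffAt_matrix.1 hA i' j'

/-- Jacobi's formula. By the chain rule it is enough to differentiate along the line `A t + s • A'`,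
where `det (A t) * det (1 + s • (A t)⁻¹ * A')` is a polynomial in `s` whose linear coefficient is
read off from `Matrix.det_one_add_smul`. -/
theorem _root_.HasDerivAt.matrix_det {A : ℝ → Matrix (Fin p) (Fin p) ℝ}
    {A' : Matrix (Fin p) (Fin p) ℝ} {t : ℝ} (hA : HasDerivAt A A' t) (h : (A t).det ≠ 0) :
    HasDerivAt (fun s => (A s).det) ((A t).det * ((A t)⁻¹ * A').trace) t := by
  have hd : DifferentiableAt ℝ (fun B : Matrix (Fin p) (Fin p) ℝ => B.det) (A t) :=
    (ContDiffAt.matrix_det (k := 1) (A := fun B : Matrix (Fin p) (Fin p) ℝ => B)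
      contDiffAt_id).differentiableAt one_ne_zero
  have h1 := hd.hasFDerivAt.comp_hasDerivAt t hA
  convert! h1 using 1
  have hl : HasDerivAt (fun s : ℝ => A t + s • A') A' 0 := by
    have h0 := ((hasDerivAt_id (0 : ℝ)).smul_const A').const_add (A t)
    rwa [one_smul] at h0
  have hd' : DifferentiableAt ℝ (fun B : Matrix (Fin p) (Fin p) ℝ => B.det)
      (A t + (0 : ℝ) • A') := by simpa using hd
  have h2 := hd'.hasFDerivAt.comp_hasDerivAt (0 : ℝ) hl
  simp only [zero_smul, add_zero] at h2
  refine HasDerivAt.unique ?_ h2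
  have h3 : ((fun B : Matrix (Fin p) (Fin p) ℝ => B.det) ∘ fun s : ℝ => A t + s • A') =
      fun s : ℝ => (A t).det * (1 + ((A t)⁻¹ * A').trace * s +
        (Polynomial.eval s ((1 + (Polynomial.X : Polynomial ℝ) •
          ((A t)⁻¹ * A').map Polynomial.C).det.divX.divX)) * s ^ 2) := by
    funext s
    rw [← Matrix.det_one_add_smul, ← Matrix.det_mul, Matrix.mul_add, Matrix.mul_one,
      Matrix.mul_smul, ← Matrix.mul_assoc, Matrix.mul_nonsing_inv _ (isUnit_iff_ne_zero.2 h),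
      Matrix.one_mul]
    rfl
  rw [h3]
  have h4 := (((hasDerivAt_id (0 : ℝ)).const_mul (((A t)⁻¹ * A').trace)).const_add 1).add
    ((Polynomial.hasDerivAt ((1 + (Polynomial.X : Polynomial ℝ) •
          ((A t)⁻¹ * A').map Polynomial.C).det.divX.divX) (0 : ℝ)).mul (hasDerivAt_pow 2 (0 : ℝ)))
  simpa using h4.const_mul (A t).det

/-- Differentiability comes from Cramer's rule; the value of the derivative is then forced by
differentiating `A * A⁻¹ = 1`. -/
theorem _root_.HasDerivAt.matrix_inv {A : ℝ → Matrix (Fin p) (Fin p) ℝ}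
    {A' : Matrix (Fin p) (Fin p) ℝ} {t : ℝ} (hA : HasDerivAt A A' t) (h : (A t).det ≠ 0) :
    HasDerivAt (fun s => (A s)⁻¹) (-((A t)⁻¹ * A' * (A t)⁻¹)) t := by
  have hd : DifferentiableAt ℝ (fun B : Matrix (Fin p) (Fin p) ℝ => B⁻¹) (A t) :=
    (ContDiffAt.matrix_inv (k := 1) (A := fun B : Matrix (Fin p) (Fin p) ℝ => B)
      contDiffAt_id h).differentiableAt one_ne_zero
  have h1 := hd.hasFDerivAt.comp_hasDerivAt t hA
  set X := fderiv ℝ (fun B : Matrix (Fin p) (Fin p) ℝ => B⁻¹) (A t) A'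
  have h2 := hA.matrix_mul h1
  have h3 : HasDerivAt (fun s => A s * (A s)⁻¹) 0 t := by
    refine (hasDerivAt_const t (1 : Matrix (Fin p) (Fin p) ℝ)).congr_of_eventuallyEq ?_
    filter_upwards [(hA.matrix_det h).continuousAt.eventually_ne h] with s hs
    exact Matrix.mul_nonsing_inv _ (isUnit_iff_ne_zero.2 hs)
  have h4 : A' * (A t)⁻¹ + A t * X = 0 := h2.unique h3
  have h5 : X = -((A t)⁻¹ * A' * (A t)⁻¹) := by
    have := congrArg (fun Y => (A t)⁻¹ * Y) h4
    simp only [Matrix.mul_add, ← Matrix.mul_assoc,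
      Matrix.nonsing_inv_mul _ (isUnit_iff_ne_zero.2 h), Matrix.one_mul, Matrix.mul_zero] at this
    exact eq_neg_of_add_eq_zero_right this
  rw [← h5]
  exact h1

end MatrixCalculus

/-! ### Matrices of full rank -/

section FullRank

variable {m n : ℕ}

/-- `a` has linearly independent columns. -/
def Full (a : Matrix (Fin n) (Fin m) ℝ) : Prop := 0 < (aᵀ * a).det

/-- The Gram matrix is positive semidefinite and has the same kernel as `a`, because `v ⬝ᵥ (aᵀ * a)
*ᵥ v` is the squared length of `a *ᵥ v`. Its determinant is thus positive exactly when this kernel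
is trivial. -/
theorem full_iff_injective {a : Matrix (Fin n) (Fin m) ℝ} :
    Full a ↔ Function.Injective a.mulVec := by
  have hp : (aᵀ * a).PosSemidef := by
    simpa [Matrix.conjTranspose_eq_transpose_of_trivial] using
      Matrix.posSemidef_conjTranspose_mul_self a
  constructor
  · intro h
    have hu : Function.Injective (aᵀ * a).mulVec :=
      Matrix.mulVec_injective_iff_isUnit.2 ((Matrix.isUnit_iff_isUnit_det _).2
        (isUnit_iff_ne_zero.2 h.ne'))
    intro v w hvw
    apply hu
    rw [← Matrix.mulVec_mulVec, ← Matrix.mulVec_mulVec, hvw]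
  · intro h
    refine lt_of_le_of_ne hp.det_nonneg (Ne.symm ?_)
    refine isUnit_iff_ne_zero.1 ((Matrix.isUnit_iff_isUnit_det _).1
      (Matrix.mulVec_injective_iff_isUnit.1 ?_))
    rw [← Matrix.coe_mulVecLin, ← LinearMap.ker_eq_bot, LinearMap.ker_eq_bot']
    intro v hv
    have h0 : a *ᵥ v = 0 := by
      rw [← dotProduct_self_eq_zero]
      have : (aᵀ * a) *ᵥ v = 0 := hv
      rw [← Matrix.mulVec_mulVec] at this
      have h1 := congrArg (fun w => v ⬝ᵥ w) this
      simp only [dotProduct_zero] at h1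
      rw [Matrix.dotProduct_mulVec, Matrix.vecMul_transpose] at h1
      exact h1
    exact h (by rw [h0, Matrix.mulVec_zero])

theorem full_iff_rank {a : Matrix (Fin n) (Fin m) ℝ} : Full a ↔ a.rank = m := by
  rw [full_iff_injective, ← Matrix.coe_mulVecLin]
  constructor
  · intro h
    have := LinearMap.finrank_range_of_inj h
    simpa [Matrix.rank] using this
  · intro h
    rw [← LinearMap.ker_eq_bot, ← Submodule.finrank_eq_zero]
    have := LinearMap.finrank_range_add_finrank_ker a.mulVecLin
    simp only [Module.finrank_fintype_fun_eq_card, Fintype.card_fin] at this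
    have h' : Module.finrank ℝ (LinearMap.range a.mulVecLin) = m := h
    omega

theorem Full.mul_right {a : Matrix (Fin n) (Fin m) ℝ} (ha : Full a)
    {q : Matrix (Fin m) (Fin m) ℝ} (hq : q.det ≠ 0) : Full (a * q) := by
  have : ((a * q)ᵀ * (a * q)).det = q.det ^ 2 * (aᵀ * a).det := by
    rw [Matrix.transpose_mul, Matrix.mul_assoc, ← Matrix.mul_assoc aᵀ]
    simp only [Matrix.det_mul, Matrix.det_transpose]
    ring
  rw [Full, this]
  exact mul_pos (by positivity) ha

variable {a : Matrix (Fin n) (Fin m) ℝ}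

theorem Full.isUnit (ha : Full a) : IsUnit (aᵀ * a).det := isUnit_iff_ne_zero.2 ha.ne'

theorem Full.gram_inv_mul (ha : Full a) : (aᵀ * a)⁻¹ * (aᵀ * a) = 1 :=
  Matrix.nonsing_inv_mul _ ha.isUnit

theorem Full.gram_mul_inv (ha : Full a) : (aᵀ * a) * (aᵀ * a)⁻¹ = 1 :=
  Matrix.mul_nonsing_inv _ ha.isUnit

theorem Full.pinv_mul (ha : Full a) : pinv a * a = 1 := by
  rw [pinv, Matrix.mul_assoc, ha.gram_inv_mul]

theorem gram_inv_transpose (a : Matrix (Fin n) (Fin m) ℝ) : ((aᵀ * a)⁻¹)ᵀ = (aᵀ * a)⁻¹ := by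
  rw [Matrix.transpose_nonsing_inv, Matrix.transpose_mul, Matrix.transpose_transpose]

theorem pinv_transpose (a : Matrix (Fin n) (Fin m) ℝ) : (pinv a)ᵀ = a * (aᵀ * a)⁻¹ := by
  rw [pinv, Matrix.transpose_mul, Matrix.transpose_transpose, gram_inv_transpose]

theorem Full.pinv_mul_transpose (ha : Full a) : pinv a * (pinv a)ᵀ = (aᵀ * a)⁻¹ := by
  rw [pinv_transpose, ← Matrix.mul_assoc, ha.pinv_mul, Matrix.one_mul]

/-- Up to the volume factor the metric is the Frobenius product of the square matrices `u a⁺` and `v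
a⁺`; all later computations take place with these. -/
theorem Full.matMetric_eq (ha : Full a) (u v : Matrix (Fin n) (Fin m) ℝ) :
    matMetric a u v = ((u * pinv a) * (v * pinv a)ᵀ).trace * √((aᵀ * a).det) := by
  rw [matMetric, Matrix.transpose_mul, ← Matrix.mul_assoc, Matrix.mul_assoc u (pinv a),
    ha.pinv_mul_transpose]

theorem Full.mul_pinv_mul (ha : Full a) (u : Matrix (Fin n) (Fin m) ℝ) :
    u * pinv a * a = u := by
  rw [Matrix.mul_assoc, ha.pinv_mul, Matrix.mul_one]

theorem matMetric_add_left (a u u' v : Matrix (Fin n) (Fin m) ℝ) :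
    matMetric a (u + u') v = matMetric a u v + matMetric a u' v := by
  simp only [matMetric, Matrix.add_mul, Matrix.trace_add, add_mul]

theorem matMetric_smul_left (a u v : Matrix (Fin n) (Fin m) ℝ) (c : ℝ) :
    matMetric a (c • u) v = c * matMetric a u v := by
  simp only [matMetric, Matrix.smul_mul, Matrix.trace_smul, smul_eq_mul, mul_assoc]

theorem matMetric_comm (a u v : Matrix (Fin n) (Fin m) ℝ) : matMetric a u v = matMetric a v u := by
  rw [matMetric, matMetric, ← Matrix.trace_transpose]
  simp only [Matrix.transpose_mul, Matrix.transpose_transpose, gram_inv_transpose,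
    Matrix.mul_assoc]

theorem Full.matMetric_self_nonneg (ha : Full a) (u : Matrix (Fin n) (Fin m) ℝ) :
    0 ≤ matMetric a u u := by
  rw [ha.matMetric_eq, ← Matrix.conjTranspose_eq_transpose_of_trivial (u * pinv a)]
  exact mul_nonneg (Matrix.posSemidef_self_mul_conjTranspose _).trace_nonneg (Real.sqrt_nonneg _)

theorem Full.matMetric_self_eq_zero (ha : Full a) {u : Matrix (Fin n) (Fin m) ℝ} :
    matMetric a u u = 0 ↔ u = 0 := by
  constructor
  · intro h
    rw [ha.matMetric_eq, mul_eq_zero, or_iff_left (Real.sqrt_pos.2 ha).ne',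
      ← Matrix.conjTranspose_eq_transpose_of_trivial,
      Matrix.trace_mul_conjTranspose_self_eq_zero_iff] at h
    rw [← ha.mul_pinv_mul u, h, Matrix.zero_mul]
  · rintro rfl
    simp [matMetric]

end FullRank

/-! ### The Christoffel symbol of the matrix metric -/

section MatrixConnection

attribute [local instance] Matrix.normedAddCommGroup Matrix.normedSpace

variable {m n : ℕ}

/-- The Christoffel symbol in terms of `U = u a⁺` and `V = v a⁺`. -/
def christoffelBil (U V : Matrix (Fin n) (Fin n) ℝ) : Matrix (Fin n) (Fin n) ℝ :=
  (1 / 2 : ℝ) • (U * Vᵀ + V * Uᵀ + U * V + V * U - Uᵀ * V - Vᵀ * U)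
    + (1 / 2 * (U * Vᵀ).trace) • (1 : Matrix (Fin n) (Fin n) ℝ)
    - (1 / 2 * U.trace) • V - (1 / 2 * V.trace) • U

/-- An explicit formula for the Christoffel symbol of the matrix metric. -/
def matChristoffel (a u v : Matrix (Fin n) (Fin m) ℝ) : Matrix (Fin n) (Fin m) ℝ :=
  christoffelBil (u * pinv a) (v * pinv a) * a

/-- The derivative of `matMetric a u v` with respect to `a` in the direction `w`. -/
def metricDeriv (a w u v : Matrix (Fin n) (Fin m) ℝ) : ℝ :=
  (((u * pinv a) * (v * pinv a)ᵀ).trace * (w * pinv a).trace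
    - ((u * pinv a) * (w * pinv a + (w * pinv a)ᵀ) * (v * pinv a)ᵀ).trace) * √((aᵀ * a).det)

variable {a : Matrix (Fin n) (Fin m) ℝ}

/-- `a * pinv a` is the orthogonal projection onto the column space of `a`, and `(pinv a)ᵀ = a
(aᵀa)⁻¹` has its columns there. -/
theorem Full.proj_mul_transpose (ha : Full a) (u : Matrix (Fin n) (Fin m) ℝ) :
    a * pinv a * (u * pinv a)ᵀ = (u * pinv a)ᵀ := by
  rw [Matrix.transpose_mul, Matrix.mul_assoc, ← Matrix.mul_assoc (pinv a), ha.pinv_mul_transpose,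
    ← Matrix.mul_assoc, pinv_transpose]

theorem Full.mul_proj (ha : Full a) (u : Matrix (Fin n) (Fin m) ℝ) :
    u * pinv a * (a * pinv a) = u * pinv a := by
  rw [← Matrix.mul_assoc, ha.mul_pinv_mul]

theorem proj_transpose (a : Matrix (Fin n) (Fin m) ℝ) : (a * pinv a)ᵀ = a * pinv a := by
  rw [Matrix.transpose_mul, pinv_transpose, pinv, Matrix.mul_assoc]

theorem Full.trace_proj (ha : Full a) : (a * pinv a).trace = m := by
  rw [Matrix.trace_mul_comm, ha.pinv_mul]
  simp

/-- The projection that appears in `X * a * pinv a` is absorbed by `(w * pinv a)ᵀ`. Christoffel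
symbols and curvatures have the form `X * a`, so their inner products become traces of `X`. -/
theorem Full.matMetric_mul_left (ha : Full a) (X : Matrix (Fin n) (Fin n) ℝ)
    (w : Matrix (Fin n) (Fin m) ℝ) :
    matMetric a (X * a) w = (X * (w * pinv a)ᵀ).trace * √((aᵀ * a).det) := by
  rw [ha.matMetric_eq, Matrix.mul_assoc X, Matrix.mul_assoc X, ha.proj_mul_transpose]

/-- Product rule in all three arguments. In `metricDeriv` the term with `tr(w a⁺)` comes from the
volume, the other from the derivative of `(aᵀa)⁻¹`. -/
theorem Full.hasDerivAt_matMetric {A X Y : ℝ → Matrix (Fin n) (Fin m) ℝ}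
    {A' X' Y' : Matrix (Fin n) (Fin m) ℝ} {t : ℝ} (ha : Full (A t)) (hA : HasDerivAt A A' t)
    (hX : HasDerivAt X X' t) (hY : HasDerivAt Y Y' t) :
    HasDerivAt (fun s => matMetric (A s) (X s) (Y s))
      (metricDeriv (A t) A' (X t) (Y t) + matMetric (A t) X' (Y t) + matMetric (A t) (X t) Y')
      t := by
  have hg := hA.matrix_transpose.matrix_mul hA
  have h1 := ((hX.matrix_mul (hg.matrix_inv ha.ne')).matrix_mul hY.matrix_transpose).matrix_trace
  have h2 := (hg.matrix_det ha.ne').sqrt ha.ne'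
  convert! h1.mul h2 using 1
  have hpos : 0 < √(((A t)ᵀ * A t).det) := Real.sqrt_pos.2 ha
  have hs : ((A t)ᵀ * A t).det = √(((A t)ᵀ * A t).det) * √(((A t)ᵀ * A t).det) :=
    (Real.mul_self_sqrt ha.le).symm
  set a := A t
  set h := (aᵀ * a)⁻¹ with hh
  set d := √((aᵀ * a).det)
  -- Logarithmic derivative of `det(aᵀa)`: the two halves of the derivative of `aᵀa` have equal
  -- trace against the symmetric `h`, and the resulting 2 cancels against the square root.
  have e1 : (h * (A'ᵀ * a + aᵀ * A')).trace = 2 * (A' * pinv a).trace := by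
    have : (h * (A'ᵀ * a)).trace = (h * (aᵀ * A')).trace := by
      rw [← Matrix.trace_transpose]
      simp only [Matrix.transpose_mul, Matrix.transpose_transpose, hh, gram_inv_transpose]
      rw [Matrix.trace_mul_comm]
    rw [Matrix.mul_add, Matrix.trace_add, this, pinv, Matrix.trace_mul_comm A', ← hh,
      Matrix.mul_assoc]
    ring
  have e2 : (aᵀ * a).det * (h * (A'ᵀ * a + aᵀ * A')).trace / (2 * d) =
      (A' * pinv a).trace * d := by
    rw [e1, hs]
    field_simp
  rw [e2]
  have e3 : ((X t * pinv a) * (A' * pinv a + (A' * pinv a)ᵀ) * (Y t * pinv a)ᵀ).trace =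
      (X t * (h * (A'ᵀ * a + aᵀ * A') * h) * (Y t)ᵀ).trace := by
    simp only [Matrix.transpose_mul, pinv_transpose]
    simp only [pinv, ← hh]
    simp only [Matrix.mul_add, Matrix.add_mul, Matrix.trace_add, Matrix.mul_assoc]
    have k1 : ∀ Z : Matrix (Fin m) (Fin n) ℝ, h * (aᵀ * (a * Z)) = Z := by
      intro Z
      rw [← Matrix.mul_assoc aᵀ, ← Matrix.mul_assoc, ha.gram_inv_mul, Matrix.one_mul]
    simp only [k1]
    ring
  have e4 : (((X t) * pinv a) * (Y t * pinv a)ᵀ).trace = (X t * h * (Y t)ᵀ).trace := by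
    rw [Matrix.transpose_mul, ← Matrix.mul_assoc, Matrix.mul_assoc (X t) (pinv a),
      ha.pinv_mul_transpose]
  simp only [metricDeriv, matMetric, e3, e4, ← hh, Matrix.add_mul, Matrix.mul_neg, Matrix.neg_mul,
    Matrix.trace_add, Matrix.trace_neg]
  ring

theorem hasDerivAt_line {V : Type*} [NormedAddCommGroup V] [NormedSpace ℝ V] (a w : V) (t : ℝ) :
    HasDerivAt (fun s : ℝ => a + s • w) w t := by
  have h0 := ((hasDerivAt_id t).smul_const w).const_add a
  rwa [one_smul] at h0

theorem Full.hasDerivAt_matMetric_line (ha : Full a) (w u v : Matrix (Fin n) (Fin m) ℝ) :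
    HasDerivAt (fun t : ℝ => matMetric (a + t • w) u v) (metricDeriv a w u v) 0 := by
  have h := Full.hasDerivAt_matMetric (A := fun t : ℝ => a + t • w) (t := 0) (by simpa using ha)
    (hasDerivAt_line a w 0) (hasDerivAt_const 0 u) (hasDerivAt_const 0 v)
  simpa [matMetric] using h

/-- In terms of `U`, `V`, `W`, every term on the right is a trace against `Wᵀ`, after transposing
and cycling two of them; `christoffelBil` is the matrix paired with `Wᵀ`. -/
theorem Full.koszul (ha : Full a) (u v w : Matrix (Fin n) (Fin m) ℝ) :
    2 * matMetric a (matChristoffel a u v) w =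
      metricDeriv a w u v - metricDeriv a u v w - metricDeriv a v u w := by
  rw [matChristoffel, ha.matMetric_mul_left]
  simp only [metricDeriv]
  generalize u * pinv a = U
  generalize v * pinv a = V
  generalize w * pinv a = W
  have h1 : (Uᵀ * V * Wᵀ).trace = (U * W * Vᵀ).trace := by
    rw [← Matrix.trace_transpose]
    simp only [Matrix.transpose_mul, Matrix.transpose_transpose]
    rw [← Matrix.mul_assoc, Matrix.trace_mul_comm, Matrix.mul_assoc]
  have h2 : (Vᵀ * U * Wᵀ).trace = (U * Wᵀ * Vᵀ).trace := by
    rw [Matrix.mul_assoc, Matrix.trace_mul_comm]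
  simp only [christoffelBil, Matrix.add_mul, Matrix.sub_mul, Matrix.smul_mul, Matrix.mul_add,
    Matrix.trace_add, Matrix.trace_sub, Matrix.trace_smul, smul_eq_mul, Matrix.one_mul, h1, h2,
    Matrix.trace_transpose]
  ring

theorem Full.isChristoffelAt (ha : Full a) (u v : Matrix (Fin n) (Fin m) ℝ) :
    IsChristoffelAt univ matMetric a u v (matChristoffel a u v) := by
  refine ⟨mem_univ _, fun w _ => ?_⟩
  have h1 := ha.hasDerivAt_matMetric_line w u v
  have h2 := ha.hasDerivAt_matMetric_line u v w
  have h3 := ha.hasDerivAt_matMetric_line v u w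
  exact ⟨h1.differentiableAt, h2.differentiableAt, h3.differentiableAt, by
    rw [h1.deriv, h2.deriv, h3.deriv, ha.koszul]⟩

/-- The Koszul formula fixes all inner products of the symbol, and the metric is positive definite.
-/
theorem Full.isChristoffelAt_unique (ha : Full a) {u v c c' : Matrix (Fin n) (Fin m) ℝ}
    (hc : IsChristoffelAt univ matMetric a u v c) (hc' : IsChristoffelAt univ matMetric a u v c') :
    c = c' := by
  have h : ∀ w, matMetric a c w = matMetric a c' w := fun w => by
    have h1 := (hc.2 w (mem_univ _)).2.2.2
    rw [← (hc'.2 w (mem_univ _)).2.2.2] at h1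
    linarith
  have h2 : matMetric a (c + (-1 : ℝ) • c') (c + (-1 : ℝ) • c') = 0 := by
    rw [matMetric_add_left, matMetric_smul_left, h]
    ring
  rw [ha.matMetric_self_eq_zero] at h2
  rw [← sub_eq_zero, ← h2]
  module

theorem Full.christoffel_eq (ha : Full a) (u v : Matrix (Fin n) (Fin m) ℝ) :
    christoffel univ matMetric a u v = matChristoffel a u v :=
  ha.isChristoffelAt_unique (Classical.epsilon_spec ⟨_, ha.isChristoffelAt u v⟩)
    (ha.isChristoffelAt u v)

theorem Full.geodesicRHS_eq (ha : Full a) (v : Matrix (Fin n) (Fin m) ℝ) :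
    geodesicRHS a v = matChristoffel a v v := by
  have e5 : ∀ X : Matrix (Fin n) (Fin n) ℝ, X * (v * pinv a) * a = X * v := fun X => by
    rw [Matrix.mul_assoc, ha.mul_pinv_mul]
  have e6 : (v * pinv a) * (v * pinv a)ᵀ = v * (aᵀ * a)⁻¹ * vᵀ := by
    rw [Matrix.transpose_mul, ← Matrix.mul_assoc, Matrix.mul_assoc v (pinv a),
      ha.pinv_mul_transpose]
  have e7 : (v * pinv a)ᵀ * v = a * (aᵀ * a)⁻¹ * vᵀ * v := by
    rw [Matrix.transpose_mul, pinv_transpose]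
  have e8 : (v * pinv a) * v = v * (aᵀ * a)⁻¹ * aᵀ * v := by
    rw [pinv, ← Matrix.mul_assoc]
  simp only [matChristoffel, christoffelBil, geodesicRHS, Matrix.add_mul, Matrix.sub_mul,
    Matrix.smul_mul, e5, ha.mul_pinv_mul, e6, e7, e8, Matrix.one_mul]
  rw [pinv, ← Matrix.mul_assoc]
  module

theorem _root_.HasDerivAt.christoffelBil {U V : ℝ → Matrix (Fin n) (Fin n) ℝ}
    {U' V' : Matrix (Fin n) (Fin n) ℝ} {t : ℝ} (hU : HasDerivAt U U' t) (hV : HasDerivAt V V' t) :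
    HasDerivAt (fun s => christoffelBil (U s) (V s))
      (christoffelBil U' (V t) + christoffelBil (U t) V') t := by
  have h := (((((((hU.matrix_mul hV.matrix_transpose).add (hV.matrix_mul hU.matrix_transpose)).add
    (hU.matrix_mul hV)).add (hV.matrix_mul hU)).sub (hU.matrix_transpose.matrix_mul hV)).sub
    (hV.matrix_transpose.matrix_mul hU)).const_smul (1 / 2 : ℝ)).add
    ((((hU.matrix_mul hV.matrix_transpose).matrix_trace.const_mul (1 / 2 : ℝ))).smul_const
      (1 : Matrix (Fin n) (Fin n) ℝ)) |>.sub ((hU.matrix_trace.const_mul (1 / 2 : ℝ)).smul hV)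
    |>.sub ((hV.matrix_trace.const_mul (1 / 2 : ℝ)).smul hU)
  convert! h using 1
  simp only [GenEbin.christoffelBil, Matrix.trace_add]
  module

/-- The derivative of `V = v a⁺` with respect to `a` in the direction `z`, where `Z = z a⁺` and
`P = a a⁺`. -/
def leftDeriv (P V Z : Matrix (Fin n) (Fin n) ℝ) : Matrix (Fin n) (Fin n) ℝ :=
  V * Zᵀ * (1 - P) - V * Z

/-- Differentiating `(aᵀa)⁻¹ aᵀ` gives `-V Z` from the motion inside the column space, and `V Zᵀ (1
- P)` from the tilting of the column space itself. -/
theorem Full.hasDerivAt_mul_pinv (ha : Full a) (v z : Matrix (Fin n) (Fin m) ℝ) :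
    HasDerivAt (fun t : ℝ => v * pinv (a + t • z))
      (leftDeriv (a * pinv a) (v * pinv a) (z * pinv a)) 0 := by
  have hA := hasDerivAt_line a z 0
  have hg := hA.matrix_transpose.matrix_mul hA
  have hi := hg.matrix_inv (by simpa using ha.ne')
  have h := (hasDerivAt_const (0 : ℝ) v).matrix_mul (hi.matrix_mul hA.matrix_transpose)
  simp only [zero_smul, add_zero, Matrix.zero_mul, zero_add] at h
  convert! h using 1
  have e6 : (v * pinv a) * (z * pinv a)ᵀ = v * (aᵀ * a)⁻¹ * zᵀ := by
    rw [Matrix.transpose_mul, ← Matrix.mul_assoc, Matrix.mul_assoc v (pinv a),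
      ha.pinv_mul_transpose]
  rw [leftDeriv, e6]
  simp only [pinv, Matrix.mul_sub, Matrix.mul_add, Matrix.add_mul, Matrix.mul_neg, Matrix.neg_mul,
    Matrix.mul_one, Matrix.mul_assoc]
  abel

/-- `R_a(u, v) v = curvOp P U V * a` with `P = a a⁺`, `U = u a⁺` and `V = v a⁺`. -/
def curvOp (P U V : Matrix (Fin n) (Fin n) ℝ) : Matrix (Fin n) (Fin n) ℝ :=
  -(christoffelBil (leftDeriv P V U) V + christoffelBil V (leftDeriv P V U)
      + christoffelBil V V * U)
    + (christoffelBil (leftDeriv P U V) V + christoffelBil U (leftDeriv P V V)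
      + christoffelBil U V * V)
    + christoffelBil U (christoffelBil V V * P) - christoffelBil V (christoffelBil U V * P)

theorem Full.eventually_line (ha : Full a) (z : Matrix (Fin n) (Fin m) ℝ) :
    ∀ᶠ t in nhds (0 : ℝ), Full (a + t • z) := by
  have hA := hasDerivAt_line a z 0
  have hg := (hA.matrix_transpose.matrix_mul hA).matrix_det (by simpa using ha.ne')
  exact hg.continuousAt.eventually (lt_mem_nhds (by simpa [Full] using ha))

theorem Full.hasDerivAt_matChristoffel (ha : Full a) (z u v : Matrix (Fin n) (Fin m) ℝ) :
    HasDerivAt (fun t : ℝ => matChristoffel (a + t • z) u v)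
      ((christoffelBil (leftDeriv (a * pinv a) (u * pinv a) (z * pinv a)) (v * pinv a)
        + christoffelBil (u * pinv a) (leftDeriv (a * pinv a) (v * pinv a) (z * pinv a))
        + christoffelBil (u * pinv a) (v * pinv a) * (z * pinv a)) * a) 0 := by
  have h := ((ha.hasDerivAt_mul_pinv u z).christoffelBil (ha.hasDerivAt_mul_pinv v z)).matrix_mul
    (hasDerivAt_line a z 0)
  simp only [zero_smul, add_zero] at h
  convert! h using 1
  rw [Matrix.add_mul, Matrix.mul_assoc (christoffelBil _ _) (z * pinv a), ha.mul_pinv_mul]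

theorem Full.hasDerivAt_christoffel (ha : Full a) (z u v : Matrix (Fin n) (Fin m) ℝ) :
    HasDerivAt (fun t : ℝ => christoffel univ matMetric (a + t • z) u v)
      ((christoffelBil (leftDeriv (a * pinv a) (u * pinv a) (z * pinv a)) (v * pinv a)
        + christoffelBil (u * pinv a) (leftDeriv (a * pinv a) (v * pinv a) (z * pinv a))
        + christoffelBil (u * pinv a) (v * pinv a) * (z * pinv a)) * a) 0 :=
  (ha.hasDerivAt_matChristoffel z u v).congr_of_eventuallyEq <|
    (ha.eventually_line z).mono fun _ ht => ht.christoffel_eq u v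

theorem Full.christoffelDeriv_eq (ha : Full a) (z u v : Matrix (Fin n) (Fin m) ℝ) :
    christoffelDeriv univ matMetric a z u v =
      (christoffelBil (leftDeriv (a * pinv a) (u * pinv a) (z * pinv a)) (v * pinv a)
        + christoffelBil (u * pinv a) (leftDeriv (a * pinv a) (v * pinv a) (z * pinv a))
        + christoffelBil (u * pinv a) (v * pinv a) * (z * pinv a)) * a :=
  (ha.hasDerivAt_christoffel z u v).deriv

theorem Full.riemann_eq (ha : Full a) (u v : Matrix (Fin n) (Fin m) ℝ) :
    riemann univ matMetric a u v v = curvOp (a * pinv a) (u * pinv a) (v * pinv a) * a := by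
  simp only [riemann, ha.christoffelDeriv_eq,
    ha.christoffel_eq, curvOp, matChristoffel]
  simp only [Matrix.add_mul, Matrix.sub_mul, Matrix.neg_mul, ← Matrix.mul_assoc]

theorem Full.sectional_eq (ha : Full a) (u v : Matrix (Fin n) (Fin m) ℝ) :
    sectional univ matMetric a u v =
      (curvOp (a * pinv a) (u * pinv a) (v * pinv a) * (u * pinv a)ᵀ).trace
        * √((aᵀ * a).det) := by
  rw [sectional, ha.riemann_eq, ha.matMetric_mul_left]

end MatrixConnection

/-! ### The curvature of the matrix metric -/

section MatrixCurvature

set_option linter.unusedSimpArgs false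

variable {m n : ℕ}

/-- The radial direction `l • a` corresponds to `l • P`. The matrix metric is a cone with radial
field `a`, so these directions are flat; algebraically, absorbing `P` into `V` and `Vᵀ` makes all
words cancel. -/
theorem curvOp_proj_left {P V : Matrix (Fin n) (Fin n) ℝ} (hPt : Pᵀ = P) (hP : P * P = P)
    (hV : V * P = V) (l : ℝ) : curvOp P (l • P) V * P = 0 := by
  have hV' : P * Vᵀ = Vᵀ := by simpa [Matrix.transpose_mul, hPt] using congrArg transpose hV
  have r1 : ∀ X, P * (P * X) = P * X := fun X => by rw [← Matrix.mul_assoc, hP]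
  have r2 : ∀ X, V * (P * X) = V * X := fun X => by rw [← Matrix.mul_assoc, hV]
  have r3 : ∀ X, P * (Vᵀ * X) = Vᵀ * X := fun X => by rw [← Matrix.mul_assoc, hV']
  have t1 : (P * V).trace = V.trace := by rw [Matrix.trace_mul_comm, hV]
  have t2 : (Vᵀ * P).trace = V.trace := by
    rw [Matrix.trace_mul_comm, hV', Matrix.trace_transpose]
  simp only [curvOp, leftDeriv, christoffelBil, Matrix.mul_add, Matrix.add_mul, Matrix.mul_sub,
    Matrix.sub_mul, Matrix.neg_mul, Matrix.mul_neg, Matrix.mul_one, Matrix.one_mul,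
    Matrix.smul_mul, Matrix.mul_smul, Matrix.mul_assoc, Matrix.transpose_add,
    Matrix.transpose_sub, Matrix.transpose_neg, Matrix.transpose_mul, Matrix.transpose_smul,
    Matrix.transpose_transpose, Matrix.transpose_one, Matrix.trace_add, Matrix.trace_sub,
    Matrix.trace_neg, Matrix.trace_smul, Matrix.trace_transpose, smul_eq_mul, Matrix.zero_mul,
    Matrix.mul_zero, smul_zero, Matrix.trace_zero, Matrix.transpose_zero,
    hPt, hP, hV, hV', r1, r2, r3, t1, t2]
  module

theorem curvOp_proj_right {P U : Matrix (Fin n) (Fin n) ℝ} (hPt : Pᵀ = P) (hP : P * P = P)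
    (hU : U * P = U) (l : ℝ) : curvOp P U (l • P) * P = 0 := by
  have hU' : P * Uᵀ = Uᵀ := by simpa [Matrix.transpose_mul, hPt] using congrArg transpose hU
  have r1 : ∀ X, P * (P * X) = P * X := fun X => by rw [← Matrix.mul_assoc, hP]
  have r2 : ∀ X, U * (P * X) = U * X := fun X => by rw [← Matrix.mul_assoc, hU]
  have r3 : ∀ X, P * (Uᵀ * X) = Uᵀ * X := fun X => by rw [← Matrix.mul_assoc, hU']
  have t1 : (P * U).trace = U.trace := by rw [Matrix.trace_mul_comm, hU]
  have t2 : (Uᵀ * P).trace = U.trace := by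
    rw [Matrix.trace_mul_comm, hU', Matrix.trace_transpose]
  simp only [curvOp, leftDeriv, christoffelBil, Matrix.mul_add, Matrix.add_mul, Matrix.mul_sub,
    Matrix.sub_mul, Matrix.neg_mul, Matrix.mul_neg, Matrix.mul_one, Matrix.one_mul,
    Matrix.smul_mul, Matrix.mul_smul, Matrix.mul_assoc, Matrix.transpose_add,
    Matrix.transpose_sub, Matrix.transpose_neg, Matrix.transpose_mul, Matrix.transpose_smul,
    Matrix.transpose_transpose, Matrix.transpose_one, Matrix.trace_add, Matrix.trace_sub,
    Matrix.trace_neg, Matrix.trace_smul, Matrix.trace_transpose, smul_eq_mul, Matrix.zero_mul,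
    Matrix.mul_zero, smul_zero, Matrix.trace_zero, Matrix.transpose_zero,
    hPt, hP, hU, hU', r1, r2, r3, t1, t2]
  module

/-- For symmetric `U`, `V` the projection is absorbed on both sides, so only traces of words in `U`
and `V` remain, and `t1` to `t9` bring these to normal form up to cyclic rotation and reversal. With
`P.trace = m`, the bracket is `m` times the Gram determinant of the traceless parts. -/
theorem curvOp_symm {P U V : Matrix (Fin n) (Fin n) ℝ} (hPt : Pᵀ = P)
    (hU : U * P = U) (hUt : Uᵀ = U) (hV : V * P = V) (hVt : Vᵀ = V) :
    (curvOp P U V * Uᵀ).trace =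
      7 / 4 * ((U * V - V * U) * (U * V - V * U)).trace
      - 1 / 4 * (P.trace * ((U * U).trace * (V * V).trace - (U * V).trace ^ 2)
          - U.trace ^ 2 * (V * V).trace - V.trace ^ 2 * (U * U).trace
          + 2 * U.trace * V.trace * (U * V).trace) := by
  have hU' : P * U = U := by simpa [Matrix.transpose_mul, hPt, hUt] using congrArg transpose hU
  have hV' : P * V = V := by simpa [Matrix.transpose_mul, hPt, hVt] using congrArg transpose hV
  have r2 : ∀ X, U * (P * X) = U * X := fun X => by rw [← Matrix.mul_assoc, hU]
  have r3 : ∀ X, P * (U * X) = U * X := fun X => by rw [← Matrix.mul_assoc, hU']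
  have r4 : ∀ X, V * (P * X) = V * X := fun X => by rw [← Matrix.mul_assoc, hV]
  have r5 : ∀ X, P * (V * X) = V * X := fun X => by rw [← Matrix.mul_assoc, hV']
  have t1 : (V * U).trace = (U * V).trace := Matrix.trace_mul_comm _ _
  have t2 : (V * (V * (U * U))).trace = (U * (V * (V * U))).trace := by
    rw [Matrix.trace_mul_comm U]; simp only [Matrix.mul_assoc]
  have t3 : (U * (U * (V * V))).trace = (U * (V * (V * U))).trace := by
    rw [Matrix.trace_mul_comm U]; simp only [Matrix.mul_assoc]
  have t4 : (V * (U * (U * V))).trace = (U * (V * (V * U))).trace := by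
    rw [Matrix.trace_mul_comm V, ← t3]; simp only [Matrix.mul_assoc]
  have t5 : (V * (U * (V * U))).trace = (U * (V * (U * V))).trace := by
    rw [Matrix.trace_mul_comm V]; simp only [Matrix.mul_assoc]
  have t6 : (V * (U * V)).trace = (V * (V * U)).trace := by
    rw [Matrix.trace_mul_comm V]; simp only [Matrix.mul_assoc]; rw [Matrix.trace_mul_comm U]; simp only [Matrix.mul_assoc]
  have t7 : (U * (V * V)).trace = (V * (V * U)).trace := by
    rw [Matrix.trace_mul_comm U]; simp only [Matrix.mul_assoc]
  have t8 : (V * (U * U)).trace = (U * (U * V)).trace := by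
    rw [Matrix.trace_mul_comm V]; simp only [Matrix.mul_assoc]
  have t9 : (U * (V * U)).trace = (U * (U * V)).trace := by
    rw [Matrix.trace_mul_comm U]; simp only [Matrix.mul_assoc]; rw [t8]
  simp only [curvOp, leftDeriv, christoffelBil, Matrix.mul_add, Matrix.add_mul, Matrix.mul_sub,
    Matrix.sub_mul, Matrix.neg_mul, Matrix.mul_neg, Matrix.mul_one, Matrix.one_mul,
    Matrix.smul_mul, Matrix.mul_smul, Matrix.mul_assoc, Matrix.transpose_add,
    Matrix.transpose_sub, Matrix.transpose_neg, Matrix.transpose_mul, Matrix.transpose_smul,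
    Matrix.transpose_transpose, Matrix.transpose_one, Matrix.trace_add, Matrix.trace_sub,
    Matrix.trace_neg, Matrix.trace_smul, Matrix.trace_transpose, smul_eq_mul, Matrix.zero_mul,
    Matrix.mul_zero, smul_zero, Matrix.trace_zero, Matrix.transpose_zero,
    hPt, hU, hUt, hVt, hV, hU', hV', r2, r3, r4, r5, t1, t2, t3, t4, t5, t6, t7, t8, t9]
  ring

/-- The model is `U = p eᵀ`, `V = q eᵀ`, `E = e eᵀ` with a unit vector `e` in the range of `P` and
`p`, `q` orthonormal in its kernel. The hypotheses form a multiplication table that reduces every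
word. -/
theorem curvOp_normal {P U V E : Matrix (Fin n) (Fin n) ℝ} (hPt : Pᵀ = P)
    (hPU : P * U = 0) (hPV : P * V = 0) (hU : U * P = U) (hV : V * P = V)
    (hUV : Uᵀ * V = 0) (hUU : Uᵀ * U = E) (hVV : Vᵀ * V = E) (hUE : U * E = U) (hVE : V * E = V)
    (hE : E.trace = 1) :
    (curvOp P U V * Uᵀ).trace = 1 - P.trace / 4 := by
  have hVU : Vᵀ * U = 0 := by simpa [Matrix.transpose_mul] using congrArg transpose hUV
  have hPUt : Uᵀ * P = 0 := by simpa [Matrix.transpose_mul, hPt] using congrArg transpose hPU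
  have hPVt : Vᵀ * P = 0 := by simpa [Matrix.transpose_mul, hPt] using congrArg transpose hPV
  have hUt : P * Uᵀ = Uᵀ := by simpa [Matrix.transpose_mul, hPt] using congrArg transpose hU
  have hVt : P * Vᵀ = Vᵀ := by simpa [Matrix.transpose_mul, hPt] using congrArg transpose hV
  -- Because `U = U * P` while `P` kills `U` and `V` from the left, all products of two of `U`, `V`
  -- vanish.
  have z1 : U * U = 0 := by rw [← hU, Matrix.mul_assoc, hU, hPU, Matrix.mul_zero]
  have z2 : U * V = 0 := by rw [← hU, Matrix.mul_assoc, hPV, Matrix.mul_zero]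
  have z3 : V * U = 0 := by rw [← hV, Matrix.mul_assoc, hPU, Matrix.mul_zero]
  have z4 : V * V = 0 := by rw [← hV, Matrix.mul_assoc, hV, hPV, Matrix.mul_zero]
  have z1' : Uᵀ * Uᵀ = 0 := by simpa [Matrix.transpose_mul] using congrArg transpose z1
  have z2' : Vᵀ * Uᵀ = 0 := by simpa [Matrix.transpose_mul] using congrArg transpose z2
  have z3' : Uᵀ * Vᵀ = 0 := by simpa [Matrix.transpose_mul] using congrArg transpose z3
  have z4' : Vᵀ * Vᵀ = 0 := by simpa [Matrix.transpose_mul] using congrArg transpose z4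
  have hEt : Eᵀ = E := by rw [← hUU]; simp [Matrix.transpose_mul]
  have hEU : E * Uᵀ = Uᵀ := by simpa [Matrix.transpose_mul, hEt] using congrArg transpose hUE
  have hEV : E * Vᵀ = Vᵀ := by simpa [Matrix.transpose_mul, hEt] using congrArg transpose hVE
  have hEU0 : E * U = 0 := by rw [← hUU, Matrix.mul_assoc, z1, Matrix.mul_zero]
  have hEV0 : E * V = 0 := by rw [← hVV, Matrix.mul_assoc, z4, Matrix.mul_zero]
  have hEP : E * P = E := by rw [← hUU, Matrix.mul_assoc, hU]
  have tU : U.trace = 0 := by rw [← hU, Matrix.trace_mul_comm, hPU, Matrix.trace_zero]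
  have tV : V.trace = 0 := by rw [← hV, Matrix.trace_mul_comm, hPV, Matrix.trace_zero]
  have tUU : (U * Uᵀ).trace = 1 := by rw [Matrix.trace_mul_comm, hUU, hE]
  have tVV : (V * Vᵀ).trace = 1 := by rw [Matrix.trace_mul_comm, hVV, hE]
  have tUV : (U * Vᵀ).trace = 0 := by rw [Matrix.trace_mul_comm, hVU, Matrix.trace_zero]
  have tVU : (V * Uᵀ).trace = 0 := by rw [Matrix.trace_mul_comm, hUV, Matrix.trace_zero]
  have a1 : ∀ X, U * (U * X) = 0 := fun X => by rw [← Matrix.mul_assoc, z1, Matrix.zero_mul]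
  have a2 : ∀ X, U * (V * X) = 0 := fun X => by rw [← Matrix.mul_assoc, z2, Matrix.zero_mul]
  have a3 : ∀ X, V * (U * X) = 0 := fun X => by rw [← Matrix.mul_assoc, z3, Matrix.zero_mul]
  have a4 : ∀ X, V * (V * X) = 0 := fun X => by rw [← Matrix.mul_assoc, z4, Matrix.zero_mul]
  have b1 : ∀ X, Uᵀ * (Uᵀ * X) = 0 := fun X => by rw [← Matrix.mul_assoc, z1', Matrix.zero_mul]
  have b2 : ∀ X, Vᵀ * (Uᵀ * X) = 0 := fun X => by rw [← Matrix.mul_assoc, z2', Matrix.zero_mul]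
  have b3 : ∀ X, Uᵀ * (Vᵀ * X) = 0 := fun X => by rw [← Matrix.mul_assoc, z3', Matrix.zero_mul]
  have b4 : ∀ X, Vᵀ * (Vᵀ * X) = 0 := fun X => by rw [← Matrix.mul_assoc, z4', Matrix.zero_mul]
  have c1 : ∀ X, Uᵀ * (U * X) = E * X := fun X => by rw [← Matrix.mul_assoc, hUU]
  have c2 : ∀ X, Vᵀ * (V * X) = E * X := fun X => by rw [← Matrix.mul_assoc, hVV]
  have c3 : ∀ X, Uᵀ * (V * X) = 0 := fun X => by rw [← Matrix.mul_assoc, hUV, Matrix.zero_mul]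
  have c4 : ∀ X, Vᵀ * (U * X) = 0 := fun X => by rw [← Matrix.mul_assoc, hVU, Matrix.zero_mul]
  have d1 : ∀ X, U * (E * X) = U * X := fun X => by rw [← Matrix.mul_assoc, hUE]
  have d2 : ∀ X, V * (E * X) = V * X := fun X => by rw [← Matrix.mul_assoc, hVE]
  have d3 : ∀ X, U * (P * X) = U * X := fun X => by rw [← Matrix.mul_assoc, hU]
  have d4 : ∀ X, V * (P * X) = V * X := fun X => by rw [← Matrix.mul_assoc, hV]
  have f1 : ∀ X, E * (U * X) = 0 := fun X => by rw [← Matrix.mul_assoc, hEU0, Matrix.zero_mul]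
  have f2 : ∀ X, E * (V * X) = 0 := fun X => by rw [← Matrix.mul_assoc, hEV0, Matrix.zero_mul]
  have f3 : ∀ X, E * (P * X) = E * X := fun X => by rw [← Matrix.mul_assoc, hEP]
  have e1 : ∀ X, P * (U * X) = 0 := fun X => by rw [← Matrix.mul_assoc, hPU, Matrix.zero_mul]
  have e2 : ∀ X, P * (V * X) = 0 := fun X => by rw [← Matrix.mul_assoc, hPV, Matrix.zero_mul]
  have e3 : ∀ X, Uᵀ * (P * X) = 0 := fun X => by rw [← Matrix.mul_assoc, hPUt, Matrix.zero_mul]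
  have e4 : ∀ X, Vᵀ * (P * X) = 0 := fun X => by rw [← Matrix.mul_assoc, hPVt, Matrix.zero_mul]
  have e5 : ∀ X, P * (Uᵀ * X) = Uᵀ * X := fun X => by rw [← Matrix.mul_assoc, hUt]
  have e6 : ∀ X, P * (Vᵀ * X) = Vᵀ * X := fun X => by rw [← Matrix.mul_assoc, hVt]
  simp only [curvOp, leftDeriv, christoffelBil, Matrix.mul_add, Matrix.add_mul, Matrix.mul_sub,
    Matrix.sub_mul, Matrix.neg_mul, Matrix.mul_neg, Matrix.mul_one, Matrix.one_mul,
    Matrix.smul_mul, Matrix.mul_smul, Matrix.mul_assoc, Matrix.transpose_add,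
    Matrix.transpose_sub, Matrix.transpose_neg, Matrix.transpose_mul, Matrix.transpose_smul,
    Matrix.transpose_transpose, Matrix.transpose_one, Matrix.trace_add, Matrix.trace_sub,
    Matrix.trace_neg, Matrix.trace_smul, Matrix.trace_transpose, smul_eq_mul, Matrix.zero_mul,
    Matrix.mul_zero, smul_zero, Matrix.trace_zero, Matrix.transpose_zero,
    hPt, hPU, hPV, hU, hV, hUV, hUU, hVV, hUE, hVE, hE, hVU, hPUt, hPVt, hUt, hVt,
    z1, z2, z3, z4, z1', z2', z3', z4', hEU, hEV, tU, tV, tUU, tVV, tUV, tVU, a1, a2, a3, a4, b1,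
    b2, b3, b4, c1, c2, c3, c4, d1, d2, d3, d4, e1, e2, e3, e4, e5, e6, hEt, f1, f2, f3, hEP, add_zero, sub_zero]
  ring

/-- The case of a single column `w`, where `P = c w wᵀ` with `c = 1 / |w|²`. The last factor is the
Gram determinant of the components of `x` and `y` orthogonal to `w`. -/
theorem curvOp_vecMulVec {w x y : Fin n → ℝ} {c : ℝ} (hc : c * (w ⬝ᵥ w) = 1) :
    (curvOp (c • vecMulVec w w) (c • vecMulVec x w) (c • vecMulVec y w)
        * (c • vecMulVec x w)ᵀ).trace =
      3 / 4 * c ^ 2 * ((x ⬝ᵥ x - c * (w ⬝ᵥ x) ^ 2) * (y ⬝ᵥ y - c * (w ⬝ᵥ y) ^ 2)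
        - (x ⬝ᵥ y - c * (w ⬝ᵥ x) * (w ⬝ᵥ y)) ^ 2) := by
  have hw : w ⬝ᵥ w ≠ 0 := fun h => by simp [h] at hc
  obtain rfl : c = (w ⬝ᵥ w)⁻¹ := eq_inv_of_mul_eq_one_left hc
  simp only [curvOp, leftDeriv, christoffelBil, Matrix.mul_add, Matrix.add_mul, Matrix.mul_sub,
    Matrix.sub_mul, Matrix.neg_mul, Matrix.mul_neg, Matrix.mul_one, Matrix.one_mul,
    Matrix.smul_mul, Matrix.mul_smul, Matrix.mul_assoc, Matrix.transpose_add,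
    Matrix.transpose_sub, Matrix.transpose_neg, Matrix.transpose_mul, Matrix.transpose_smul,
    Matrix.transpose_transpose, Matrix.transpose_one, Matrix.trace_add, Matrix.trace_sub,
    Matrix.trace_neg, Matrix.trace_smul, Matrix.trace_transpose, smul_eq_mul, Matrix.zero_mul,
    Matrix.mul_zero, smul_zero, Matrix.trace_zero, Matrix.transpose_zero,
    Matrix.transpose_vecMulVec, Matrix.vecMulVec_mul_vecMulVec, Matrix.vecMulVec_smul,
    Matrix.trace_vecMulVec, dotProduct_smul, dotProduct_comm x w, dotProduct_comm y w,
    dotProduct_comm y x]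
  field_simp
  ring

end MatrixCurvature

/-! ### Signs of the curvature of the matrix metric. -/

section MatrixSectional

variable {m n : ℕ} {a : Matrix (Fin n) (Fin m) ℝ}

theorem matMetric_add_right (a u v v' : Matrix (Fin n) (Fin m) ℝ) :
    matMetric a u (v + v') = matMetric a u v + matMetric a u v' := by
  rw [matMetric_comm, matMetric_add_left, matMetric_comm a v, matMetric_comm a v']

theorem matMetric_smul_right (a u v : Matrix (Fin n) (Fin m) ℝ) (c : ℝ) :
    matMetric a u (c • v) = c * matMetric a u v := by
  rw [matMetric_comm, matMetric_smul_left, matMetric_comm a v]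

/-- The vector is `|u|²` times the component of `v` orthogonal to `u`. Its nonnegative norm gives
the Cauchy–Schwarz inequality, with equality only for dependent vectors. -/
theorem Full.gram_identity (u v : Matrix (Fin n) (Fin m) ℝ) :
    matMetric a (matMetric a u u • v + (-matMetric a u v) • u)
        (matMetric a u u • v + (-matMetric a u v) • u) =
      matMetric a u u * (matMetric a u u * matMetric a v v - matMetric a u v ^ 2) := by
  simp only [matMetric_add_left, matMetric_add_right, matMetric_smul_left, matMetric_smul_right,
    matMetric_comm a v u]
  ring

theorem Full.gram_nonneg (ha : Full a) (u v : Matrix (Fin n) (Fin m) ℝ) :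
    0 ≤ matMetric a u u * matMetric a v v - matMetric a u v ^ 2 := by
  rcases (ha.matMetric_self_nonneg u).eq_or_lt with h | h
  · have hu : u = 0 := ha.matMetric_self_eq_zero.1 h.symm
    simp [hu, matMetric]
  · have h1 := ha.matMetric_self_nonneg (matMetric a u u • v + (-matMetric a u v) • u)
    rw [Full.gram_identity] at h1
    exact nonneg_of_mul_nonneg_right h1 h

theorem Full.gram_pos (ha : Full a) {u v : Matrix (Fin n) (Fin m) ℝ}
    (hi : LinearIndependent ℝ ![u, v]) :
    0 < matMetric a u u * matMetric a v v - matMetric a u v ^ 2 := by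
  refine (ha.gram_nonneg u v).lt_of_ne fun h => ?_
  have h1 : matMetric a (matMetric a u u • v + (-matMetric a u v) • u)
      (matMetric a u u • v + (-matMetric a u v) • u) = 0 := by
    rw [Full.gram_identity, ← h, mul_zero]
  rw [ha.matMetric_self_eq_zero, add_comm] at h1
  have h2 := (LinearIndependent.pair_iff.1 hi _ _ h1).2
  rw [ha.matMetric_self_eq_zero] at h2
  subst h2
  exact one_ne_zero (LinearIndependent.pair_iff.1 hi 1 0 (by simp)).1

theorem Full.sectional_smul_self_left (ha : Full a) (l : ℝ) (v : Matrix (Fin n) (Fin m) ℝ) :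
    sectional univ matMetric a (l • a) v = 0 := by
  rw [ha.sectional_eq, Matrix.smul_mul, Matrix.transpose_smul, proj_transpose, Matrix.mul_smul,
    curvOp_proj_left (proj_transpose a) (ha.mul_proj a) (ha.mul_proj v)]
  simp

theorem Full.sectional_smul_self_right (ha : Full a) (l : ℝ) (u : Matrix (Fin n) (Fin m) ℝ) :
    sectional univ matMetric a u (l • a) = 0 := by
  -- The projection needed on the right of `curvOp` is borrowed from `(u * pinv a)ᵀ`.
  rw [ha.sectional_eq, Matrix.smul_mul, ← ha.proj_mul_transpose u, ← Matrix.mul_assoc,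
    curvOp_proj_right (proj_transpose a) (ha.mul_proj a) (ha.mul_proj u)]
  simp

theorem curvOp_smul (P U V : Matrix (Fin n) (Fin n) ℝ) (c d : ℝ) :
    curvOp P (c • U) (d • V) = (c * d ^ 2) • curvOp P U V := by
  simp only [curvOp, leftDeriv, christoffelBil, Matrix.smul_mul, Matrix.mul_smul,
    Matrix.transpose_sub, Matrix.transpose_add, Matrix.transpose_smul, Matrix.trace_smul,
    Matrix.trace_sub, Matrix.trace_add, smul_eq_mul, Matrix.add_mul, Matrix.sub_mul,
    Matrix.mul_add, Matrix.mul_sub, Matrix.mul_one, Matrix.one_mul]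
  module

theorem Full.sectional_smul (ha : Full a) (c d : ℝ) (u v : Matrix (Fin n) (Fin m) ℝ) :
    sectional univ matMetric a (c • u) (d • v) =
      c ^ 2 * d ^ 2 * sectional univ matMetric a u v := by
  rw [ha.sectional_eq, ha.sectional_eq, Matrix.smul_mul, Matrix.smul_mul, curvOp_smul]
  simp only [Matrix.transpose_smul, Matrix.mul_smul, Matrix.smul_mul, Matrix.trace_smul,
    smul_eq_mul]
  ring

theorem Full.matMetric_self_left (ha : Full a) (u : Matrix (Fin n) (Fin m) ℝ) :
    matMetric a a u = (u * pinv a).trace * √((aᵀ * a).det) := by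
  have := ha.matMetric_mul_left 1 u
  rwa [Matrix.one_mul, Matrix.one_mul, Matrix.trace_transpose] at this

theorem Full.matMetric_self_self (ha : Full a) :
    matMetric a a a = m * √((aᵀ * a).det) := by
  rw [ha.matMetric_self_left, ha.trace_proj]

/-- The traceless part is the component orthogonal to `a`: the inner product of `a` with `u` is
`tr(u a⁺)` times the volume, and that of `a` with itself is `m` times the volume. -/
theorem Full.matMetric_tracelessPart (ha : Full a) (hm : 1 ≤ m)
    (u v : Matrix (Fin n) (Fin m) ℝ) :
    matMetric a (tracelessPart a u) (tracelessPart a v) =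
      (((u * pinv a) * (v * pinv a)ᵀ).trace - (u * pinv a).trace * (v * pinv a).trace / m)
        * √((aᵀ * a).det) := by
  have hm' : (m : ℝ) ≠ 0 := by positivity
  have e : ∀ u, tracelessPart a u = u + (-((u * pinv a).trace / (m : ℝ))) • a := fun u => by
    rw [tracelessPart]; module
  rw [e, e]
  simp only [matMetric_add_left, matMetric_add_right, matMetric_smul_left, matMetric_smul_right,
    ha.matMetric_self_self, matMetric_comm a u a, ha.matMetric_self_left]
  rw [ha.matMetric_eq u v]
  field_simp
  ring

/-- The commutator of two symmetric matrices is antisymmetric, so its square has nonpositive trace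
and the `7/4` term can be dropped. The extra volume factor on the left matches the two volume
factors in the Gram determinant. -/
theorem Full.sectional_horizontal (ha : Full a) (hm : 1 ≤ m) {u v : Matrix (Fin n) (Fin m) ℝ}
    (hu : (u * pinv a).IsSymm) (hv : (v * pinv a).IsSymm) :
    sectional univ matMetric a u v * √((aᵀ * a).det) ≤
      -(m / 4 * (matMetric a (tracelessPart a u) (tracelessPart a u)
          * matMetric a (tracelessPart a v) (tracelessPart a v)
          - matMetric a (tracelessPart a u) (tracelessPart a v) ^ 2)) := by
  have hm' : (m : ℝ) ≠ 0 := by positivity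
  rw [ha.sectional_eq, curvOp_symm (proj_transpose a) (ha.mul_proj u) hu (ha.mul_proj v) hv,
    ha.matMetric_tracelessPart hm, ha.matMetric_tracelessPart hm, ha.matMetric_tracelessPart hm,
    hu.eq, hv.eq, ha.trace_proj]
  set U := u * pinv a
  set V := v * pinv a
  have hK : ((U * V - V * U) * (U * V - V * U)).trace ≤ 0 := by
    have h1 : (U * V - V * U)ᴴ = -(U * V - V * U) := by
      rw [Matrix.conjTranspose_eq_transpose_of_trivial, Matrix.transpose_sub,
        Matrix.transpose_mul U, Matrix.transpose_mul V, hu.eq, hv.eq]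
      abel
    have h2 := (Matrix.posSemidef_self_mul_conjTranspose (U * V - V * U)).trace_nonneg
    rw [h1, Matrix.mul_neg, Matrix.trace_neg] at h2
    linarith
  set d := √((aᵀ * a).det)
  have h3 : 7 / 4 * ((U * V - V * U) * (U * V - V * U)).trace * d ^ 2 ≤ 0 :=
    mul_nonpos_of_nonpos_of_nonneg (by linarith) (sq_nonneg d)
  refine le_of_sub_nonneg (le_trans (neg_nonneg.2 h3) (le_of_eq ?_))
  field_simp
  ring

theorem Full.sectional_horizontal_nonpos (ha : Full a) (hm : 1 ≤ m)
    {u v : Matrix (Fin n) (Fin m) ℝ} (hu : (u * pinv a).IsSymm) (hv : (v * pinv a).IsSymm) :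
    sectional univ matMetric a u v ≤ 0 := by
  have h := ha.sectional_horizontal hm hu hv
  have h1 := ha.gram_nonneg (tracelessPart a u) (tracelessPart a v)
  refine nonpos_of_mul_nonpos_left (h.trans ?_) (Real.sqrt_pos.2 ha)
  exact neg_nonpos.2 (mul_nonneg (by positivity) h1)

theorem Full.sectional_horizontal_neg (ha : Full a) (hm : 1 ≤ m)
    {u v : Matrix (Fin n) (Fin m) ℝ} (hu : (u * pinv a).IsSymm) (hv : (v * pinv a).IsSymm)
    (hi : LinearIndependent ℝ ![tracelessPart a u, tracelessPart a v]) :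
    sectional univ matMetric a u v < 0 := by
  have h := ha.sectional_horizontal hm hu hv
  have h1 := ha.gram_pos hi
  have h2 : sectional univ matMetric a u v * √((aᵀ * a).det) < 0 :=
    h.trans_lt (neg_neg_of_pos (mul_pos (by positivity) h1))
  exact neg_of_mul_neg_left h2 (Real.sqrt_nonneg _)

/-- Here `u * pinv a` is just `p eᵀ`, because `e` is tangent, and `curvOp_normal` applies with `E =
e eᵀ`. The value is positive precisely for `m < 4`. -/
theorem Full.sectional_normal (ha : Full a) {e p q : Fin n → ℝ} (he : (a * pinv a) *ᵥ e = e)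
    (hp : (a * pinv a) *ᵥ p = 0) (hq : (a * pinv a) *ᵥ q = 0) (hee : e ⬝ᵥ e = 1)
    (hpp : p ⬝ᵥ p = 1) (hqq : q ⬝ᵥ q = 1) (hpq : p ⬝ᵥ q = 0) :
    sectional univ matMetric a (vecMulVec p e * a) (vecMulVec q e * a) =
      (1 - m / 4) * √((aᵀ * a).det) := by
  have hU : ∀ z : Fin n → ℝ, vecMulVec z e * (a * pinv a) = vecMulVec z e := fun z => by
    rw [Matrix.vecMulVec_mul, ← Matrix.mulVec_transpose, proj_transpose, he]
  rw [ha.sectional_eq, Matrix.mul_assoc, Matrix.mul_assoc, hU, hU,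
    curvOp_normal (E := vecMulVec e e) (proj_transpose a), ha.trace_proj]
  · rw [Matrix.mul_vecMulVec, hp, Matrix.zero_vecMulVec]
  · rw [Matrix.mul_vecMulVec, hq, Matrix.zero_vecMulVec]
  · exact hU p
  · exact hU q
  · simp [Matrix.transpose_vecMulVec, Matrix.vecMulVec_mul_vecMulVec, hpq]
  · simp [Matrix.transpose_vecMulVec, Matrix.vecMulVec_mul_vecMulVec, hpp]
  · simp [Matrix.transpose_vecMulVec, Matrix.vecMulVec_mul_vecMulVec, hqq]
  · simp [Matrix.vecMulVec_mul_vecMulVec, hee]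
  · simp [Matrix.vecMulVec_mul_vecMulVec, hee]
  · simp [Matrix.trace_vecMulVec, hee]

theorem mul_pinv_column {a : Matrix (Fin n) (Fin 1) ℝ} (ha : Full a)
    (u : Matrix (Fin n) (Fin 1) ℝ) :
    u * pinv a = ((fun i => a i 0) ⬝ᵥ fun i => a i 0)⁻¹ •
      vecMulVec (fun i => u i 0) fun i => a i 0 := by
  have h1 : aᵀ * a = ((fun i => a i 0) ⬝ᵥ fun i => a i 0) • (1 : Matrix (Fin 1) (Fin 1) ℝ) := by
    ext i j
    rw [Subsingleton.elim i 0, Subsingleton.elim j 0]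
    simp [Matrix.mul_apply, dotProduct]
  have h0 : ((fun i => a i 0) ⬝ᵥ fun i => a i 0) ≠ 0 := fun h => by
    rw [Full, h1, h] at ha
    simp at ha
  have h2 : (aᵀ * a)⁻¹ =
      ((fun i => a i 0) ⬝ᵥ fun i => a i 0)⁻¹ • (1 : Matrix (Fin 1) (Fin 1) ℝ) := by
    refine Matrix.inv_eq_right_inv ?_
    rw [h1, Matrix.smul_mul, Matrix.mul_smul, smul_smul, mul_inv_cancel₀ h0, one_smul,
      Matrix.one_mul]
  ext i j
  simp [pinv, h2, Matrix.mul_apply, vecMulVec_apply, mul_left_comm]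

theorem Full.sectional_column {a : Matrix (Fin n) (Fin 1) ℝ} (ha : Full a)
    (u v : Matrix (Fin n) (Fin 1) ℝ) :
    ∃ (c : ℝ) (w x y : Fin n → ℝ), c * (w ⬝ᵥ w) = 1 ∧ sectional univ matMetric a u v =
      3 / 4 * c ^ 2 * ((x ⬝ᵥ x - c * (w ⬝ᵥ x) ^ 2) * (y ⬝ᵥ y - c * (w ⬝ᵥ y) ^ 2)
        - (x ⬝ᵥ y - c * (w ⬝ᵥ x) * (w ⬝ᵥ y)) ^ 2) * √((aᵀ * a).det) := by
  have hc : ((fun i => a i 0) ⬝ᵥ fun i => a i 0)⁻¹ * ((fun i => a i 0) ⬝ᵥ fun i => a i 0) = 1 := by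
    refine inv_mul_cancel₀ fun h => ?_
    have h1 := ha.trace_proj
    rw [mul_pinv_column ha, h] at h1
    simp at h1
  refine ⟨_, fun i => a i 0, fun i => u i 0, fun i => v i 0, hc, ?_⟩
  rw [ha.sectional_eq, mul_pinv_column ha, mul_pinv_column ha, mul_pinv_column ha,
    curvOp_vecMulVec hc]

theorem dotProduct_gram_nonneg (x y : Fin n → ℝ) :
    0 ≤ (x ⬝ᵥ x) * (y ⬝ᵥ y) - (x ⬝ᵥ y) ^ 2 := by
  have := Finset.sum_mul_sq_le_sq_mul_sq Finset.univ x y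
  simp only [dotProduct, sub_nonneg]
  simpa only [pow_two] using this

/-- The bracket is the Gram determinant of the projections of `x` and `y` off `w`, hence nonnegative
by Cauchy–Schwarz. -/
theorem Full.sectional_column_nonneg {a : Matrix (Fin n) (Fin 1) ℝ} (ha : Full a)
    (u v : Matrix (Fin n) (Fin 1) ℝ) : 0 ≤ sectional univ matMetric a u v := by
  obtain ⟨c, w, x, y, hc, h⟩ := ha.sectional_column u v
  rw [h]
  have h1 := dotProduct_gram_nonneg (x - (c * (w ⬝ᵥ x)) • w) (y - (c * (w ⬝ᵥ y)) • w)
  have h2 : ∀ x y, (x - (c * (w ⬝ᵥ x)) • w) ⬝ᵥ (y - (c * (w ⬝ᵥ y)) • w) =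
      x ⬝ᵥ y - c * (w ⬝ᵥ x) * (w ⬝ᵥ y) := fun x y => by
    simp only [sub_dotProduct, dotProduct_sub, smul_dotProduct, dotProduct_smul, smul_eq_mul,
      dotProduct_comm x w]
    linear_combination c * (w ⬝ᵥ x) * (w ⬝ᵥ y) * hc
  rw [h2, h2, h2] at h1
  refine mul_nonneg (mul_nonneg (by positivity) (le_of_le_of_eq h1 ?_)) (Real.sqrt_nonneg _)
  ring

/-- In the plane the orthogonal complement of `w` is a line, so two vectors in it have zero Gram
determinant. -/
theorem Full.sectional_column_two {a : Matrix (Fin 2) (Fin 1) ℝ} (ha : Full a)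
    (u v : Matrix (Fin 2) (Fin 1) ℝ) : sectional univ matMetric a u v = 0 := by
  obtain ⟨c, w, x, y, hc, h⟩ := ha.sectional_column u v
  rw [h]
  have h3 : (x ⬝ᵥ x - c * (w ⬝ᵥ x) ^ 2) * (y ⬝ᵥ y - c * (w ⬝ᵥ y) ^ 2)
        - (x ⬝ᵥ y - c * (w ⬝ᵥ x) * (w ⬝ᵥ y)) ^ 2 = 0 := by
    have hc0 : w ⬝ᵥ w ≠ 0 := fun h => by simp [h] at hc
    obtain rfl : c = (w ⬝ᵥ w)⁻¹ := eq_inv_of_mul_eq_one_left hc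
    field_simp
    simp only [dotProduct, Fin.sum_univ_two]
    ring
  rw [h3]
  ring

end MatrixSectional

/-! ### Behaviour under a change of basis of the tangent space. -/

section Equivariance

variable {m n : ℕ} {a : Matrix (Fin n) (Fin m) ℝ} {q : Matrix (Fin m) (Fin m) ℝ}

theorem pinv_mul_right (a : Matrix (Fin n) (Fin m) ℝ) (hq : q.det ≠ 0) :
    pinv (a * q) = q⁻¹ * pinv a := by
  have hu : IsUnit q.det := isUnit_iff_ne_zero.2 hq
  have hu' : IsUnit qᵀ.det := by rwa [Matrix.det_transpose]
  rw [pinv, pinv, Matrix.transpose_mul, Matrix.mul_assoc, ← Matrix.mul_assoc aᵀ,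
    Matrix.mul_inv_rev, Matrix.mul_inv_rev, Matrix.mul_assoc, Matrix.nonsing_inv_mul_cancel_left
      _ _ hu', Matrix.mul_assoc]

/-- This cancellation is the source of all basis independence: whatever is built from `u a⁺` and `a
a⁺` does not see the frame. -/
theorem mul_mul_pinv_mul (a u : Matrix (Fin n) (Fin m) ℝ) (hq : q.det ≠ 0) :
    u * q * pinv (a * q) = u * pinv a := by
  rw [pinv_mul_right a hq, Matrix.mul_assoc,
    Matrix.mul_nonsing_inv_cancel_left _ _ (isUnit_iff_ne_zero.2 hq)]

theorem sqrt_det_gram_mul (a : Matrix (Fin n) (Fin m) ℝ) (q : Matrix (Fin m) (Fin m) ℝ) :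
    √(((a * q)ᵀ * (a * q)).det) = |q.det| * √((aᵀ * a).det) := by
  have : ((a * q)ᵀ * (a * q)).det = q.det ^ 2 * (aᵀ * a).det := by
    rw [Matrix.transpose_mul, Matrix.mul_assoc, ← Matrix.mul_assoc aᵀ]
    simp only [Matrix.det_mul, Matrix.det_transpose]
    ring
  rw [this, Real.sqrt_mul (sq_nonneg _), Real.sqrt_sq_eq_abs]

/-- Only the volume depends on the basis, so the curvature transforms like a density and its sign is
intrinsic. -/
theorem Full.sectional_mul (ha : Full a) (hq : q.det ≠ 0) (u v : Matrix (Fin n) (Fin m) ℝ) :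
    sectional univ matMetric (a * q) (u * q) (v * q) =
      |q.det| * sectional univ matMetric a u v := by
  rw [(ha.mul_right hq).sectional_eq, ha.sectional_eq, mul_mul_pinv_mul _ _ hq,
    mul_mul_pinv_mul _ _ hq, mul_mul_pinv_mul _ _ hq, sqrt_det_gram_mul]
  ring

theorem matChristoffel_mul (a u v : Matrix (Fin n) (Fin m) ℝ) (hq : q.det ≠ 0) :
    matChristoffel (a * q) (u * q) (v * q) = matChristoffel a u v * q := by
  rw [matChristoffel, mul_mul_pinv_mul _ _ hq, mul_mul_pinv_mul _ _ hq, ← Matrix.mul_assoc,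
    matChristoffel]

theorem solF_mul (a v : Matrix (Fin n) (Fin m) ℝ) (hq : q.det ≠ 0) :
    solF (a * q) (v * q) = solF a v := by
  funext t
  rw [solF, mul_mul_pinv_mul _ _ hq, solF]

theorem solS_mul (a v : Matrix (Fin n) (Fin m) ℝ) (hq : q.det ≠ 0) :
    solS (a * q) (v * q) = solS a v := by
  funext t
  rw [solS, solF_mul _ _ hq, solS]

theorem solOmega_mul (a v : Matrix (Fin n) (Fin m) ℝ) (hq : q.det ≠ 0) :
    solOmega (a * q) (v * q) = solOmega a v := by
  rw [solOmega, mul_mul_pinv_mul _ _ hq, solOmega]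

/-- Unlike `solOmega`, the matrix `solP` acts on the tangent space, so it is conjugated; its
exponential is conjugated too, which makes the explicit solution transform like a one-form. -/
theorem solP_mul (a v : Matrix (Fin n) (Fin m) ℝ) (hq : q.det ≠ 0) :
    solP (a * q) (v * q) = q⁻¹ * solP a v * q := by
  have hu : IsUnit q.det := isUnit_iff_ne_zero.2 hq
  have hu' : IsUnit qᵀ.det := by rwa [Matrix.det_transpose]
  rw [solP, mul_mul_pinv_mul _ _ hq, solP, Matrix.mul_sub, Matrix.sub_mul, Matrix.mul_smul,
    Matrix.smul_mul, Matrix.mul_one, Matrix.nonsing_inv_mul _ hu]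
  congr 1
  rw [Matrix.transpose_mul, Matrix.transpose_mul, Matrix.mul_assoc, ← Matrix.mul_assoc aᵀ,
    Matrix.mul_inv_rev, Matrix.mul_inv_rev, Matrix.mul_assoc, Matrix.mul_assoc qᵀ,
    Matrix.nonsing_inv_mul_cancel_left _ _ hu']
  simp only [Matrix.mul_assoc]

theorem explicitSol_mul (a v : Matrix (Fin n) (Fin m) ℝ) (hq : q.det ≠ 0) (t : ℝ) :
    explicitSol (a * q) (v * q) t = explicitSol a v t * q := by
  have hu : IsUnit q.det := isUnit_iff_ne_zero.2 hq
  rw [explicitSol, solF_mul _ _ hq, solS_mul _ _ hq, solOmega_mul _ _ hq, solP_mul _ _ hq,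
    explicitSol, Matrix.smul_mul]
  congr 1
  have h : solS a v t • (q⁻¹ * solP a v * q) = q⁻¹ * (solS a v t • solP a v) * q := by
    rw [Matrix.mul_smul, Matrix.smul_mul]
  rw [h, Matrix.exp_conj' _ _ ((Matrix.isUnit_iff_isUnit_det _).2 hu)]
  simp only [← Matrix.mul_assoc]
  rw [Matrix.mul_assoc _ q q⁻¹, Matrix.mul_nonsing_inv _ hu, Matrix.mul_one]

end Equivariance

/-! ### Smooth dependence on the foot point -/

section MatrixSmooth

attribute [local instance] Matrix.normedAddCommGroup Matrix.normedSpace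

variable {m n : ℕ} {E : Type*} [NormedAddCommGroup E] [NormedSpace ℝ E] {x : E} {k : WithTop ℕ∞}
  {A U V W : E → Matrix (Fin n) (Fin m) ℝ}

theorem _root_.ContDiffAt.pinv (hA : ContDiffAt ℝ k A x) (ha : Full (A x)) :
    ContDiffAt ℝ k (fun y => pinv (A y)) x :=
  ((hA.matrix_transpose.matrix_mul hA).matrix_inv ha.ne').matrix_mul hA.matrix_transpose

theorem _root_.ContDiffAt.sqrt_det_gram (hA : ContDiffAt ℝ k A x) (ha : Full (A x)) :
    ContDiffAt ℝ k (fun y => √(((A y)ᵀ * A y).det)) x :=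
  (hA.matrix_transpose.matrix_mul hA).matrix_det.sqrt ha.ne'

theorem _root_.ContDiffAt.matMetric (hA : ContDiffAt ℝ k A x) (hU : ContDiffAt ℝ k U x)
    (hV : ContDiffAt ℝ k V x) (ha : Full (A x)) :
    ContDiffAt ℝ k (fun y => matMetric (A y) (U y) (V y)) x :=
  ((hU.matrix_mul ((hA.matrix_transpose.matrix_mul hA).matrix_inv ha.ne')).matrix_mul
    hV.matrix_transpose).matrix_trace.mul (hA.sqrt_det_gram ha)

theorem _root_.ContDiffAt.metricDeriv (hA : ContDiffAt ℝ k A x) (hW : ContDiffAt ℝ k W x)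
    (hU : ContDiffAt ℝ k U x) (hV : ContDiffAt ℝ k V x) (ha : Full (A x)) :
    ContDiffAt ℝ k (fun y => metricDeriv (A y) (W y) (U y) (V y)) x := by
  have hp := hA.pinv ha
  have hU' := hU.matrix_mul hp
  have hV' := hV.matrix_mul hp
  have hW' := hW.matrix_mul hp
  exact (((hU'.matrix_mul hV'.matrix_transpose).matrix_trace.mul hW'.matrix_trace).sub
    ((hU'.matrix_mul (hW'.add hW'.matrix_transpose)).matrix_mul
      hV'.matrix_transpose).matrix_trace).mul (hA.sqrt_det_gram ha)

theorem _root_.ContDiffAt.christoffelBil {U V : E → Matrix (Fin n) (Fin n) ℝ}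
    (hU : ContDiffAt ℝ k U x) (hV : ContDiffAt ℝ k V x) :
    ContDiffAt ℝ k (fun y => christoffelBil (U y) (V y)) x := by
  have h1 := (((((hU.matrix_mul hV.matrix_transpose).add
    (hV.matrix_mul hU.matrix_transpose)).add (hU.matrix_mul hV)).add (hV.matrix_mul hU)).sub
    (hU.matrix_transpose.matrix_mul hV)).sub (hV.matrix_transpose.matrix_mul hU)
  have h2 := (hU.matrix_mul hV.matrix_transpose).matrix_trace
  exact (((h1.const_smul (1 / 2 : ℝ)).add ((contDiffAt_const.mul h2).smul contDiffAt_const)).sub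
    ((contDiffAt_const.mul hU.matrix_trace).smul hV)).sub
    ((contDiffAt_const.mul hV.matrix_trace).smul hU)

theorem _root_.ContDiffAt.matChristoffel (hA : ContDiffAt ℝ k A x) (hU : ContDiffAt ℝ k U x)
    (hV : ContDiffAt ℝ k V x) (ha : Full (A x)) :
    ContDiffAt ℝ k (fun y => matChristoffel (A y) (U y) (V y)) x :=
  ((hU.matrix_mul (hA.pinv ha)).christoffelBil (hV.matrix_mul (hA.pinv ha))).matrix_mul hA

theorem _root_.ContDiffAt.leftDeriv {P U V : E → Matrix (Fin n) (Fin n) ℝ}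
    (hP : ContDiffAt ℝ k P x) (hU : ContDiffAt ℝ k U x) (hV : ContDiffAt ℝ k V x) :
    ContDiffAt ℝ k (fun y => leftDeriv (P y) (U y) (V y)) x :=
  ((hU.matrix_mul hV.matrix_transpose).matrix_mul (contDiffAt_const.sub hP)).sub
    (hU.matrix_mul hV)

theorem _root_.ContDiffAt.curvOp {P U V : E → Matrix (Fin n) (Fin n) ℝ}
    (hP : ContDiffAt ℝ k P x) (hU : ContDiffAt ℝ k U x) (hV : ContDiffAt ℝ k V x) :
    ContDiffAt ℝ k (fun y => curvOp (P y) (U y) (V y)) x := by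
  have h1 := hP.leftDeriv hV hU
  have h2 := hP.leftDeriv hU hV
  have h3 := hP.leftDeriv hV hV
  exact ((((((h1.christoffelBil hV).add (hV.christoffelBil h1)).add
    ((hV.christoffelBil hV).matrix_mul hU)).neg).add (((h2.christoffelBil hV).add
    (hU.christoffelBil h3)).add ((hU.christoffelBil hV).matrix_mul hV))).add
    (hU.christoffelBil ((hV.christoffelBil hV).matrix_mul hP))).sub
    (hV.christoffelBil ((hU.christoffelBil hV).matrix_mul hP))

/-- An explicit formula for the sectional curvature of the matrix metric. -/
def matSectional (a u v : Matrix (Fin n) (Fin m) ℝ) : ℝ :=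
  (curvOp (a * pinv a) (u * pinv a) (v * pinv a) * (u * pinv a)ᵀ).trace * √((aᵀ * a).det)

theorem _root_.ContDiffAt.matSectional (hA : ContDiffAt ℝ k A x) (hU : ContDiffAt ℝ k U x)
    (hV : ContDiffAt ℝ k V x) (ha : Full (A x)) :
    ContDiffAt ℝ k (fun y => matSectional (A y) (U y) (V y)) x := by
  have hp := hA.pinv ha
  exact ((ContDiffAt.curvOp (hA.matrix_mul hp) (hU.matrix_mul hp) (hV.matrix_mul hp)).matrix_mul
    (hU.matrix_mul hp).matrix_transpose).matrix_trace.mul (hA.sqrt_det_gram ha)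

theorem isOpen_full : IsOpen {a : Matrix (Fin n) (Fin m) ℝ | Full a} := by
  refine isOpen_lt continuous_const ?_
  exact (continuous_id.matrix_transpose.matrix_mul continuous_id).matrix_det

end MatrixSmooth

/-! ### The matrix exponential. -/

section MatrixExp

/-- Analyticity of the exponential needs a submultiplicative norm, which the entrywise sup norm used
elsewhere is not. A statement about single entries does not depend on the norm and can be passed
between the two. -/
theorem contDiffAt_exp_entry {p : ℕ} {E : Type*} [NormedAddCommGroup E] [NormedSpace ℝ E] {x : E}
    {k : WithTop ℕ∞} {A : E → Matrix (Fin p) (Fin p) ℝ}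
    (hA : ∀ i j, ContDiffAt ℝ k (fun y => A y i j) x) (i j : Fin p) :
    ContDiffAt ℝ k (fun y => NormedSpace.exp (A y) i j) x := by
  let _ : NormedRing (Matrix (Fin p) (Fin p) ℝ) := Matrix.linftyOpNormedRing
  let _ : NormedAlgebra ℝ (Matrix (Fin p) (Fin p) ℝ) := Matrix.linftyOpNormedAlgebra
  have h1 : ContDiffAt ℝ k A x := by
    have : A = fun y => ∑ i, ∑ j, A y i j • Matrix.single i j (1 : ℝ) := by
      funext y
      conv_lhs => rw [Matrix.matrix_eq_sum_single (A y)]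
      simp
    rw [this]
    exact ContDiffAt.sum fun i _ => ContDiffAt.sum fun j _ => (hA i j).smul contDiffAt_const
  have h2 : ContDiffAt ℝ k (fun y => NormedSpace.exp (A y)) x :=
    (NormedSpace.exp_analytic (𝕂 := ℝ) (A x)).contDiffAt.comp x h1
  let l : Matrix (Fin p) (Fin p) ℝ →ₗ[ℝ] ℝ :=
    { toFun := fun B => B i j, map_add' := fun _ _ => rfl, map_smul' := fun _ _ => rfl }
  exact (LinearMap.toContinuousLinearMap l).contDiff.contDiffAt.comp x h2

theorem hasDerivAt_exp_smul {p : ℕ} (B : Matrix (Fin p) (Fin p) ℝ) {s : ℝ → ℝ} {s' t : ℝ}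
    (hs : HasDerivAt s s' t) :
    HasDerivAt (fun r => NormedSpace.exp (s r • B)) (s' • (B * NormedSpace.exp (s t • B))) t := by
  let _ : NormedRing (Matrix (Fin p) (Fin p) ℝ) := Matrix.linftyOpNormedRing
  let _ : NormedAlgebra ℝ (Matrix (Fin p) (Fin p) ℝ) := Matrix.linftyOpNormedAlgebra
  exact (hasDerivAt_exp_smul_const' (𝕂 := ℝ) B (s t)).scomp t hs

theorem exp_smul_mul_comm {p : ℕ} (B : Matrix (Fin p) (Fin p) ℝ) (s : ℝ) :
    NormedSpace.exp (s • B) * B = B * NormedSpace.exp (s • B) := by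
  let _ : NormedRing (Matrix (Fin p) (Fin p) ℝ) := Matrix.linftyOpNormedRing
  let _ : NormedAlgebra ℝ (Matrix (Fin p) (Fin p) ℝ) := Matrix.linftyOpNormedAlgebra
  exact (((Commute.refl B).smul_left s).exp_left).eq

attribute [local instance] Matrix.normedAddCommGroup Matrix.normedSpace

theorem _root_.ContDiffAt.matrix_exp {p : ℕ} {E : Type*} [NormedAddCommGroup E] [NormedSpace ℝ E]
    {x : E} {k : WithTop ℕ∞} {A : E → Matrix (Fin p) (Fin p) ℝ} (hA : ContDiffAt ℝ k A x) :
    ContDiffAt ℝ k (fun y => NormedSpace.exp (A y)) x :=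
  contDiffAt_matrix.2 (contDiffAt_exp_entry (contDiffAt_matrix.1 hA))

end MatrixExp

/-! ### Integrals depending on a parameter -/

section ParametricIntegrals

set_option linter.unusedSectionVars false

variable {Y : Type*} [TopologicalSpace Y] [MeasurableSpace Y] [OpensMeasurableSpace Y]
  [SecondCountableTopology Y] {μ : Measure Y} {K : Set Y}
  {P : Type*} [NormedAddCommGroup P] [ProperSpace P] {U : Set P}
  {G : Type*} [NormedAddCommGroup G] [NormedSpace ℝ G]

/-- Compactness of closed balls and of `K` gives a bound that is uniform near `p₀`; this constant is
the dominating function for the parametric integrals below. -/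
theorem exists_ball_bound (hU : IsOpen U) (hK : IsCompact K) {F : P → Y → G}
    (hF : ContinuousOn (Function.uncurry F) (U ×ˢ K)) {p₀ : P} (hp : p₀ ∈ U) :
    ∃ r > 0, Metric.ball p₀ r ⊆ U ∧ ∃ C, ∀ p ∈ Metric.ball p₀ r, ∀ y ∈ K, ‖F p y‖ ≤ C := by
  obtain ⟨r, hr, hrU⟩ := Metric.nhds_basis_closedBall.mem_iff.1 (hU.mem_nhds hp)
  obtain ⟨C, hC⟩ := ((isCompact_closedBall p₀ r).prod hK).exists_bound_of_continuousOn
    (hF.mono (prod_mono_left hrU))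
  exact ⟨r, hr, Metric.ball_subset_closedBall.trans hrU, C, fun p hp y hy =>
    hC (p, y) ⟨Metric.ball_subset_closedBall hp, hy⟩⟩

theorem slice_continuousOn {F : P → Y → G}
    (hF : ContinuousOn (Function.uncurry F) (U ×ˢ K)) {p : P} (hp : p ∈ U) :
    ContinuousOn (F p) K :=
  hF.comp (f := fun y => (p, y)) (by fun_prop) fun _ hy => ⟨hp, hy⟩

theorem continuousOn_integral_of_compact (hU : IsOpen U) (hK : IsCompact K)
    (hKm : MeasurableSet K) (hμ : μ K ≠ ⊤) {F : P → Y → G}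
    (hF : ContinuousOn (Function.uncurry F) (U ×ˢ K)) :
    ContinuousOn (fun p => ∫ y in K, F p y ∂μ) U := by
  intro p₀ hp
  refine ContinuousAt.continuousWithinAt ?_
  obtain ⟨r, hr, hrU, C, hC⟩ := exists_ball_bound hU hK hF hp
  refine continuousAt_of_dominated (bound := fun _ => C) ?_ ?_ (integrableOn_const hμ) ?_
  · filter_upwards [Metric.ball_mem_nhds p₀ hr] with p hp
    exact (slice_continuousOn hF (hrU hp)).aestronglyMeasurable_of_isCompact hK hKm
  · filter_upwards [Metric.ball_mem_nhds p₀ hr] with p hp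
    filter_upwards [ae_restrict_mem hKm] with y hy using hC p hp y hy
  · filter_upwards [ae_restrict_mem hKm] with y hy
    have h1 : ContinuousOn (fun p => F p y) U :=
      hF.comp (f := fun p => (p, y)) (by fun_prop) fun _ hq => ⟨hq, hy⟩
    exact h1.continuousAt (hU.mem_nhds hp)

theorem hasFDerivAt_integral_of_compact [NormedSpace ℝ P] (hU : IsOpen U) (hK : IsCompact K)
    (hKm : MeasurableSet K) (hμ : μ K ≠ ⊤) {F : P → Y → G} {F' : P → Y → P →L[ℝ] G}
    (hF : ContinuousOn (Function.uncurry F) (U ×ˢ K))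
    (hF' : ContinuousOn (Function.uncurry F') (U ×ˢ K))
    (hd : ∀ p ∈ U, ∀ y ∈ K, HasFDerivAt (fun q => F q y) (F' p y) p) {p₀ : P} (hp : p₀ ∈ U) :
    HasFDerivAt (fun p => ∫ y in K, F p y ∂μ) (∫ y in K, F' p₀ y ∂μ) p₀ := by
  obtain ⟨r, hr, hrU, C, hC⟩ := exists_ball_bound hU hK hF' hp
  refine hasFDerivAt_integral_of_dominated_of_fderiv_le (bound := fun _ => C)
    (Metric.ball_mem_nhds p₀ hr) ?_ ?_ ?_ ?_ (integrableOn_const hμ) ?_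
  · filter_upwards [Metric.ball_mem_nhds p₀ hr] with p hp
    exact (slice_continuousOn hF (hrU hp)).aestronglyMeasurable_of_isCompact hK hKm
  · obtain ⟨D, hD⟩ := hK.exists_bound_of_continuousOn (slice_continuousOn hF hp)
    refine Integrable.mono' (g := fun _ => D) (integrableOn_const hμ)
      ((slice_continuousOn hF hp).aestronglyMeasurable_of_isCompact hK hKm) ?_
    filter_upwards [ae_restrict_mem hKm] with y hy using hD y hy
  · exact (slice_continuousOn hF' hp).aestronglyMeasurable_of_isCompact hK hKm
  · filter_upwards [ae_restrict_mem hKm] with y hy p hp using hC p hp y hy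
  · filter_upwards [ae_restrict_mem hKm] with y hy p hp using hd p (hrU hp) y hy

theorem hasDerivAt_integral_of_compact {U : Set ℝ} (hU : IsOpen U) (hK : IsCompact K)
    (hKm : MeasurableSet K) (hμ : μ K ≠ ⊤) {F F' : ℝ → Y → G}
    (hF : ContinuousOn (Function.uncurry F) (U ×ˢ K))
    (hF' : ContinuousOn (Function.uncurry F') (U ×ˢ K))
    (hd : ∀ p ∈ U, ∀ y ∈ K, HasDerivAt (fun q => F q y) (F' p y) p) {p₀ : ℝ} (hp : p₀ ∈ U) :
    HasDerivAt (fun p => ∫ y in K, F p y ∂μ) (∫ y in K, F' p₀ y ∂μ) p₀ := by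
  obtain ⟨r, hr, hrU, C, hC⟩ := exists_ball_bound hU hK hF' hp
  refine (hasDerivAt_integral_of_dominated_loc_of_deriv_le (bound := fun _ => C)
    (Metric.ball_mem_nhds p₀ hr) ?_ ?_ ?_ ?_ (integrableOn_const hμ) ?_).2
  · filter_upwards [Metric.ball_mem_nhds p₀ hr] with p hp
    exact (slice_continuousOn hF (hrU hp)).aestronglyMeasurable_of_isCompact hK hKm
  · obtain ⟨D, hD⟩ := hK.exists_bound_of_continuousOn (slice_continuousOn hF hp)
    refine Integrable.mono' (g := fun _ => D) (integrableOn_const hμ)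
      ((slice_continuousOn hF hp).aestronglyMeasurable_of_isCompact hK hKm) ?_
    filter_upwards [ae_restrict_mem hKm] with y hy using hD y hy
  · exact (slice_continuousOn hF' hp).aestronglyMeasurable_of_isCompact hK hKm
  · filter_upwards [ae_restrict_mem hKm] with y hy p hp using hC p hp y hy
  · filter_upwards [ae_restrict_mem hKm] with y hy p hp using hd p (hrU hp) y hy

/-- Differentiation under the integral sign, repeated `k` times. The target `G` is quantified inside
the induction because the derivative takes values in `P →L[ℝ] G`; the open set `I` around the unit
interval makes ordinary derivatives available up to its end points. -/
theorem contDiffOn_integral_unitInterval {P : Type} [NormedAddCommGroup P] [NormedSpace ℝ P]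
    [ProperSpace P] {U : Set P} {I : Set ℝ} (hU : IsOpen U) (hI : IsOpen I) (hI1 : Icc 0 1 ⊆ I)
    (k : ℕ) : ∀ {G : Type} [NormedAddCommGroup G] [NormedSpace ℝ G] {F : P → ℝ → G},
      ContDiffOn ℝ k (Function.uncurry F) (U ×ˢ I) →
      ContDiffOn ℝ k (fun p => ∫ θ in Icc (0 : ℝ) 1, F p θ) U := by
  have hsub : U ×ˢ Icc (0 : ℝ) 1 ⊆ U ×ˢ I := prod_mono_right hI1
  have hUI : IsOpen (U ×ˢ I) := hU.prod hI
  induction k with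
  | zero =>
    intro G _ _ F hF
    have hF0 := hF.continuousOn.mono hsub
    exact contDiffOn_zero.2 (continuousOn_integral_of_compact hU isCompact_Icc measurableSet_Icc
      isCompact_Icc.measure_ne_top hF0)
  | succ k ih =>
    intro G _ _ F hF
    have hF1 := (contDiffOn_succ_iff_fderiv_of_isOpen (n := k) hUI).1
      (by exact_mod_cast hF)
    have hF' : ContDiffOn ℝ k (Function.uncurry fun p θ =>
        (fderiv ℝ (Function.uncurry F) (p, θ)).comp (ContinuousLinearMap.inl ℝ P ℝ)) (U ×ˢ I) :=
      ContDiffOn.clm_comp hF1.2.2 contDiffOn_const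
    have hd : ∀ p ∈ U, ∀ θ ∈ Icc (0 : ℝ) 1, HasFDerivAt (fun q => F q θ)
        ((fderiv ℝ (Function.uncurry F) (p, θ)).comp (ContinuousLinearMap.inl ℝ P ℝ)) p := by
      intro p hp θ hθ
      have hm : (p, θ) ∈ U ×ˢ I := ⟨hp, hI1 hθ⟩
      have h1 := (hF1.1.differentiableAt (hUI.mem_nhds hm)).hasFDerivAt
      exact HasFDerivAt.comp (f := fun q : P => (q, θ)) p h1 (hasFDerivAt_prodMk_left (𝕜 := ℝ) p θ)
    have hD : ∀ p ∈ U, HasFDerivAt (fun p => ∫ θ in Icc (0 : ℝ) 1, F p θ) (∫ θ in Icc (0 : ℝ) 1,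
        (fderiv ℝ (Function.uncurry F) (p, θ)).comp (ContinuousLinearMap.inl ℝ P ℝ)) p :=
      fun p hp => hasFDerivAt_integral_of_compact hU isCompact_Icc measurableSet_Icc
        isCompact_Icc.measure_ne_top (hF.continuousOn.mono hsub) (hF'.continuousOn.mono hsub) hd hp
    have := (contDiffOn_succ_iff_fderiv_of_isOpen (n := k) (f := fun p => ∫ θ in Icc (0 : ℝ) 1,
      F p θ) hU).2 ⟨fun p hp => (hD p hp).differentiableAt.differentiableWithinAt, by simp,
        (ih hF').congr fun p hp => (hD p hp).fderiv⟩
    exact_mod_cast this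

end ParametricIntegrals

/-! ### The geodesic equation on the space of matrices -/

section MatrixODE

attribute [local instance] Matrix.normedAddCommGroup Matrix.normedSpace

variable {m n : ℕ} {a v : Matrix (Fin n) (Fin m) ℝ}

/-- `A` solves the geodesic equation on `J` with velocity `V`. -/
def IsMatSolution (J : Set ℝ) (A V : ℝ → Matrix (Fin n) (Fin m) ℝ) : Prop :=
  ∀ t ∈ J, Full (A t) ∧ HasDerivAt A (V t) t ∧ HasDerivAt V (geodesicRHS (A t) (V t)) t

theorem metricDeriv_comm (a w u v : Matrix (Fin n) (Fin m) ℝ) :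
    metricDeriv a w u v = metricDeriv a w v u := by
  have h1 : ∀ U V : Matrix (Fin n) (Fin n) ℝ, (U * Vᵀ).trace = (V * Uᵀ).trace := fun U V => by
    rw [← Matrix.trace_transpose, Matrix.transpose_mul, Matrix.transpose_transpose]
  have h2 : ∀ U V W : Matrix (Fin n) (Fin n) ℝ,
      (U * (W + Wᵀ) * Vᵀ).trace = (V * (W + Wᵀ) * Uᵀ).trace := fun U V W => by
    rw [← Matrix.trace_transpose]
    simp only [Matrix.transpose_mul, Matrix.transpose_add, Matrix.transpose_transpose,
      Matrix.mul_assoc, add_comm Wᵀ]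
  rw [metricDeriv, metricDeriv, h1, h2]

/-- Euler's identity: for fixed `u`, `v` the metric is homogeneous of degree `m - 2` in the foot
point, `-2` from `(aᵀa)⁻¹` and `m` from the volume. -/
theorem Full.metricDeriv_self (ha : Full a) (u v : Matrix (Fin n) (Fin m) ℝ) :
    metricDeriv a a u v = (m - 2) * matMetric a u v := by
  rw [metricDeriv, ha.trace_proj, proj_transpose, Matrix.mul_add, ha.mul_proj, ha.matMetric_eq,
    Matrix.add_mul, Matrix.trace_add]
  ring

namespace IsMatSolution

variable {J : Set ℝ} {A V : ℝ → Matrix (Fin n) (Fin m) ℝ}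

/-- Conservation of energy: the Koszul formula with three equal arguments says that twice the
product of the acceleration with the velocity cancels the derivative of the metric along the
velocity. -/
theorem hasDerivAt_energy (h : IsMatSolution J A V) {t : ℝ} (ht : t ∈ J) :
    HasDerivAt (fun s => matMetric (A s) (V s) (V s)) 0 t := by
  obtain ⟨ha, hA, hV⟩ := h t ht
  have h1 := ha.hasDerivAt_matMetric hA hV hV
  rw [ha.geodesicRHS_eq] at h1
  have h2 := ha.koszul (V t) (V t) (V t)
  convert! h1 using 1
  rw [matMetric_comm (A t) (V t) (matChristoffel _ _ _)]
  linarith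

/-- The product of `a` with itself is `m` times the volume, so the volume can be differentiated
through the metric. -/
theorem hasDerivAt_volume (h : IsMatSolution J A V) {t : ℝ} (ht : t ∈ J) :
    HasDerivAt (fun s => √(((A s)ᵀ * A s).det)) (matMetric (A t) (A t) (V t)) t := by
  obtain ⟨ha, hA, hV⟩ := h t ht
  -- For `m = 0` the volume is the constant 1; the general argument divides by `m`.
  by_cases hm : m = 0
  · subst hm
    have : (fun s => √(((A s)ᵀ * A s).det)) = fun _ => 1 := by funext s; simp
    rw [this]
    convert! hasDerivAt_const t (1 : ℝ) using 1
    rw [ha.matMetric_self_left, Matrix.trace_mul_comm]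
    simp [Matrix.trace]
  have hm' : (m : ℝ) ≠ 0 := Nat.cast_ne_zero.2 hm
  have h1 : HasDerivAt (fun s => (m : ℝ)⁻¹ * matMetric (A s) (A s) (A s))
      ((m : ℝ)⁻¹ * (metricDeriv (A t) (V t) (A t) (A t) + matMetric (A t) (V t) (A t)
        + matMetric (A t) (A t) (V t))) t :=
    (ha.hasDerivAt_matMetric hA hA hA).const_mul _
  have h2 : metricDeriv (A t) (V t) (A t) (A t) = (m - 2) * matMetric (A t) (A t) (V t) := by
    have e1 : (A t * pinv (A t) * (V t * pinv (A t))).trace = (V t * pinv (A t)).trace := by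
      rw [Matrix.trace_mul_comm, ha.mul_proj]
    have e2 : (A t * pinv (A t) * (V t * pinv (A t))ᵀ).trace = (V t * pinv (A t)).trace := by
      rw [ha.proj_mul_transpose, Matrix.trace_transpose]
    have e3 : (A t * pinv (A t) * (V t * pinv (A t) + (V t * pinv (A t))ᵀ)
        * (A t * pinv (A t))).trace = 2 * (V t * pinv (A t)).trace := by
      rw [Matrix.mul_add, Matrix.add_mul, Matrix.trace_add, Matrix.mul_assoc _ _ (A t * pinv (A t)),
        ha.mul_proj, e1, ha.proj_mul_transpose,
        Matrix.trace_mul_comm (V t * pinv (A t))ᵀ, e2]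
      ring
    rw [metricDeriv, proj_transpose, e3, ha.mul_proj, ha.trace_proj, ha.matMetric_self_left]
    ring
  refine (h1.congr_deriv ?_).congr_of_eventuallyEq ?_
  · rw [h2, matMetric_comm (A t) (V t) (A t)]
    field_simp
    ring
  · filter_upwards [hA.continuousAt.preimage_mem_nhds (isOpen_full.mem_nhds ha)] with s hs
    rw [Full.matMetric_self_self hs, inv_mul_cancel_left₀ hm']

/-- The Koszul formula tested with `a` itself, together with homogeneity of degree `m - 2`,
contributes `(m - 2) / 2` times the energy density; differentiating the first slot of the product
contributes one more copy, in total `m / 2`. -/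
theorem hasDerivAt_volume_deriv (h : IsMatSolution J A V) {t : ℝ} (ht : t ∈ J) :
    HasDerivAt (fun s => matMetric (A s) (A s) (V s)) (m / 2 * matMetric (A t) (V t) (V t)) t := by
  obtain ⟨ha, hA, hV⟩ := h t ht
  have h1 := ha.hasDerivAt_matMetric hA hA hV
  rw [ha.geodesicRHS_eq] at h1
  have h2 := ha.koszul (V t) (V t) (A t)
  rw [ha.metricDeriv_self] at h2
  convert! h1 using 1
  rw [matMetric_comm (A t) (A t) (matChristoffel _ _ _), metricDeriv_comm (A t) (V t) (A t)]
  linarith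

/-- Along a geodesic the volume `√det(aᵀa)` is a multiple of `f`. -/
theorem volume_eq (h : IsMatSolution J A V) (hJ : IsOpen J) (hJc : J.OrdConnected)
    (h0 : (0 : ℝ) ∈ J) {t : ℝ} (ht : t ∈ J) :
    √(((A t)ᵀ * A t).det) = √(((A 0)ᵀ * A 0).det) * solF (A 0) (V 0) t := by
  have hpc : IsPreconnected J := hJc.isPreconnected
  have const : ∀ {f : ℝ → ℝ}, (∀ s ∈ J, HasDerivAt f 0 s) → ∀ s ∈ J, f s = f 0 := by
    intro f hf s hs
    exact hJ.is_const_of_deriv_eq_zero hpc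
      (fun r hr => (hf r hr).differentiableAt.differentiableWithinAt)
      (fun r hr => (hf r hr).deriv) hs h0
  set e := matMetric (A 0) (V 0) (V 0)
  have he : ∀ s ∈ J, matMetric (A s) (V s) (V s) = e := const fun s hs => h.hasDerivAt_energy hs
  -- The second derivative of the volume is the constant `m e / 2`; two integrations give the
  -- quadratic polynomial.
  have h1 : ∀ s ∈ J, matMetric (A s) (A s) (V s) - m / 2 * e * s =
      matMetric (A 0) (A 0) (V 0) - m / 2 * e * 0 := by
    refine const fun s hs => ?_
    convert! (h.hasDerivAt_volume_deriv hs).sub ((hasDerivAt_id s).const_mul (m / 2 * e)) using 1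
    rw [he s hs]
    ring
  have h2 := const (f := fun s => √(((A s)ᵀ * A s).det)
    - (m / 4 * e * s ^ 2 + matMetric (A 0) (A 0) (V 0) * s)) (fun s hs => by
      convert! (h.hasDerivAt_volume hs).sub (((hasDerivAt_pow 2 s).const_mul (m / 4 * e)).add
        ((hasDerivAt_id s).const_mul (matMetric (A 0) (A 0) (V 0)))) using 1
      have := h1 s hs
      simp only [Nat.cast_ofNat, Nat.add_one_sub_one, pow_one]
      linarith) t ht
  have ha := (h 0 h0).1
  have h3 : e = ((V 0 * pinv (A 0))ᵀ * (V 0 * pinv (A 0))).trace * √(((A 0)ᵀ * A 0).det) := by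
    rw [Matrix.trace_mul_comm]
    exact ha.matMetric_eq _ _
  simp only [h3, ha.matMetric_self_left] at h2
  rw [solF]
  linarith

theorem solF_pos (h : IsMatSolution J A V) (hJ : IsOpen J) (hJc : J.OrdConnected)
    (h0 : (0 : ℝ) ∈ J) {t : ℝ} (ht : t ∈ J) : 0 < solF (A 0) (V 0) t := by
  have h1 : 0 < √(((A t)ᵀ * A t).det) := Real.sqrt_pos.2 (h t ht).1
  rw [h.volume_eq hJ hJc h0 ht] at h1
  exact pos_of_mul_pos_right h1 (Real.sqrt_nonneg _)

end IsMatSolution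

theorem contDiffAt_geodesicRHS {y : Matrix (Fin n) (Fin m) ℝ × Matrix (Fin n) (Fin m) ℝ}
    (hy : Full y.1) : ContDiffAt ℝ 1 (fun z : Matrix (Fin n) (Fin m) ℝ ×
      Matrix (Fin n) (Fin m) ℝ => geodesicRHS z.1 z.2) y := by
  refine (ContDiffAt.matChristoffel contDiffAt_fst contDiffAt_snd contDiffAt_snd
    hy).congr_of_eventuallyEq ?_
  filter_upwards [continuousAt_fst.preimage_mem_nhds (isOpen_full.mem_nhds hy)] with z hz
  exact Full.geodesicRHS_eq hz z.2

/-- Solutions of the geodesic equation are determined by their initial values. -/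
theorem IsMatSolution.unique {J : Set ℝ} {A V B W : ℝ → Matrix (Fin n) (Fin m) ℝ}
    (h : IsMatSolution J A V) (h' : IsMatSolution J B W) (hJ : IsOpen J) (hJc : J.OrdConnected)
    (h0 : (0 : ℝ) ∈ J) (hA : A 0 = B 0) (hV : V 0 = W 0) : ∀ t ∈ J, A t = B t := by
  set F : ℝ → Matrix (Fin n) (Fin m) ℝ × Matrix (Fin n) (Fin m) ℝ := fun t => (A t, V t)
  set F' : ℝ → Matrix (Fin n) (Fin m) ℝ × Matrix (Fin n) (Fin m) ℝ := fun t => (B t, W t)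
  set X : Matrix (Fin n) (Fin m) ℝ × Matrix (Fin n) (Fin m) ℝ → Matrix (Fin n) (Fin m) ℝ ×
    Matrix (Fin n) (Fin m) ℝ := fun z => (z.2, geodesicRHS z.1 z.2)
  have hF : ∀ t ∈ J, HasDerivAt F (X (F t)) t := fun t ht => (h t ht).2.1.prodMk (h t ht).2.2
  have hF' : ∀ t ∈ J, HasDerivAt F' (X (F' t)) t := fun t ht =>
    (h' t ht).2.1.prodMk (h' t ht).2.2
  -- Local uniqueness: the vector field is `C¹` at full rank matrices, hence locally Lipschitz.
  have key : ∀ t ∈ J, F t = F' t → F =ᶠ[nhds t] F' := by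
    intro t ht heq
    have hX : ContDiffAt ℝ 1 X (F t) :=
      contDiffAt_snd.prodMk (contDiffAt_geodesicRHS (y := F t) (h t ht).1)
    obtain ⟨K, s, hs, hL⟩ := hX.exists_lipschitzOnWith
    refine ODE_solution_unique_of_eventually (v := fun _ => X) (s := fun _ => s) (K := K)
      (.of_forall fun _ => hL) ?_ ?_ heq
    · filter_upwards [hJ.mem_nhds ht, (hF t ht).continuousAt.preimage_mem_nhds hs] with r hr hr'
      exact ⟨hF r hr, hr'⟩
    · filter_upwards [hJ.mem_nhds ht,
        (hF' t ht).continuousAt.preimage_mem_nhds (heq ▸ hs)] with r hr hr'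
      exact ⟨hF' r hr, hr'⟩
  have hopen : IsOpen {t | F =ᶠ[nhds t] F'} := isOpen_setOfPred_eventually_nhds
  -- The set of times near which the two solutions coincide is open, and relatively closed in `J` by
  -- continuity and `key`; as `J` is connected, it contains `J`.
  have hsub := hJc.isPreconnected.subset_of_closure_inter_subset hopen
    ⟨0, h0, key 0 h0 (Prod.ext hA hV)⟩ (by
      rintro t ⟨htc, htJ⟩
      refine key t htJ ?_
      have hc : ContinuousAt (fun s => F s - F' s) t :=
        (hF t htJ).continuousAt.sub (hF' t htJ).continuousAt
      by_contra hne
      have hev := hc.eventually_ne (sub_ne_zero.2 hne)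
      obtain ⟨s, hs, hs'⟩ := mem_closure_iff_nhds.1 htc _ hev
      exact hs (sub_eq_zero.2 (hs' : F =ᶠ[nhds s] F').eq_of_nhds))
  intro t ht
  exact congrArg Prod.fst (hsub ht : F =ᶠ[nhds t] F').eq_of_nhds

/-! ### The explicit solution -/

theorem solF_zero (a v : Matrix (Fin n) (Fin m) ℝ) : solF a v 0 = 1 := by simp [solF]

theorem continuous_solF (a v : Matrix (Fin n) (Fin m) ℝ) : Continuous (solF a v) := by
  unfold solF
  fun_prop

theorem hasDerivAt_solF (a v : Matrix (Fin n) (Fin m) ℝ) (t : ℝ) :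
    HasDerivAt (solF a v)
      (m * (((v * pinv a)ᵀ * (v * pinv a)).trace / 2 * t) + (v * pinv a).trace) t := by
  have := ((((hasDerivAt_pow 2 t).const_mul
    ((m : ℝ) * ((v * pinv a)ᵀ * (v * pinv a)).trace / 4)).add
    ((hasDerivAt_id t).const_mul (v * pinv a).trace)).add_const 1)
  convert! this using 1
  simp
  ring

theorem hasDerivAt_solS {J : Set ℝ} (hJ : IsOpen J) (hJc : J.OrdConnected) (h0 : (0 : ℝ) ∈ J)
    (hf : ∀ s ∈ J, 0 < solF a v s) {t : ℝ} (ht : t ∈ J) :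
    HasDerivAt (solS a v) (1 / solF a v t) t := by
  have hc : ContinuousOn (fun s => 1 / solF a v s) J :=
    continuousOn_const.div (continuous_solF a v).continuousOn fun s hs => (hf s hs).ne'
  refine intervalIntegral.integral_hasDerivAt_right
    ((hc.mono (hJc.uIcc_subset h0 ht)).intervalIntegrable) ?_ (hc.continuousAt (hJ.mem_nhds ht))
  exact hc.stronglyMeasurableAtFilter hJ t ht

/-- Left multiplication by an orthogonal matrix is an isometry: the Gram matrix and all traces are
unchanged. -/
theorem geodesicRHS_orthogonal_mul {O : Matrix (Fin n) (Fin n) ℝ} (hO : Oᵀ * O = 1)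
    (a v : Matrix (Fin n) (Fin m) ℝ) : geodesicRHS (O * a) (O * v) = O * geodesicRHS a v := by
  have h1 : (O * a)ᵀ * (O * a) = aᵀ * a := by
    rw [Matrix.transpose_mul, Matrix.mul_assoc, ← Matrix.mul_assoc Oᵀ, hO, Matrix.one_mul]
  have k1 : ∀ {p : ℕ} (Z : Matrix (Fin n) (Fin p) ℝ), Oᵀ * (O * Z) = Z := fun Z => by
    rw [← Matrix.mul_assoc, hO, Matrix.one_mul]
  have t1 : ∀ Z : Matrix (Fin n) (Fin n) ℝ, (O * (Z * Oᵀ)).trace = Z.trace := fun Z => by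
    rw [Matrix.trace_mul_comm, Matrix.mul_assoc, hO, Matrix.mul_one]
  have t2 : ∀ b : Matrix (Fin n) (Fin m) ℝ, (O * (v * ((aᵀ * a)⁻¹ * (bᵀ * Oᵀ)))).trace =
      (v * ((aᵀ * a)⁻¹ * bᵀ)).trace := fun b => by
    have := t1 (v * ((aᵀ * a)⁻¹ * bᵀ))
    simpa only [Matrix.mul_assoc] using this
  simp only [geodesicRHS, h1]
  simp only [Matrix.transpose_mul, Matrix.mul_assoc, k1, t2, Matrix.mul_add, Matrix.mul_sub,
    Matrix.mul_smul]

/-- Each term is quadratic in the velocity and homogeneous of degree `-1` in the foot point. -/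
theorem geodesicRHS_smul {c : ℝ} (hc : c ≠ 0) (d : ℝ) (a v : Matrix (Fin n) (Fin m) ℝ) :
    geodesicRHS (c • a) (d • v) = (d ^ 2 / c) • geodesicRHS a v := by
  have h1 : ((c • a)ᵀ * (c • a))⁻¹ = (c ^ 2)⁻¹ • (aᵀ * a)⁻¹ := by
    rw [Matrix.transpose_smul, Matrix.smul_mul, Matrix.mul_smul, smul_smul, ← pow_two]
    by_cases h : IsUnit (aᵀ * a).det
    · refine Matrix.inv_eq_right_inv ?_
      rw [Matrix.smul_mul, Matrix.mul_smul, smul_smul, mul_inv_cancel₀ (pow_ne_zero 2 hc),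
        one_smul, Matrix.mul_nonsing_inv _ h]
    -- A singular Gram matrix stays singular after scaling, and both inverses then have the default
    -- value 0.
    · have h' : ¬ IsUnit (c ^ 2 • (aᵀ * a)).det := by
        rw [isUnit_iff_ne_zero, not_not] at h ⊢
        rw [Matrix.det_smul, h, mul_zero]
      rw [Matrix.nonsing_inv_apply_not_isUnit _ h, Matrix.nonsing_inv_apply_not_isUnit _ h',
        smul_zero]
  simp only [geodesicRHS, h1]
  simp only [Matrix.transpose_smul, Matrix.smul_mul, Matrix.mul_smul, Matrix.trace_smul,
    smul_smul, smul_add, smul_sub, smul_eq_mul]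
  match_scalars <;> field_simp

/-- The algebraic identity behind the explicit solution of the geodesic equation. -/
theorem Full.geodesicRHS_add_smul (ha : Full a) (hm : 1 ≤ m) (c : ℝ) :
    geodesicRHS a (v + c • a) =
      (c - m * c - (v * pinv a).trace + (v * pinv a).trace / m) • (v + c • a)
        - solOmega a v * (v + c • a) + (v + c • a) * solP a v
        + (m / 2 * c ^ 2 + (v * pinv a).trace * c
          + ((v * pinv a)ᵀ * (v * pinv a)).trace / 2) • a := by
  have hm' : (m : ℝ) ≠ 0 := by positivity
  -- Right multiplication by `solP` is rewritten with `n × n` matrices on the left, so that all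
  -- terms are words in `L = v a⁺` and the projection, applied to `a` or `v`.
  have hP : ∀ w : Matrix (Fin n) (Fin m) ℝ, w * solP a v =
      (w * pinv a) * (v * pinv a)ᵀ * a - ((v * pinv a).trace / (m : ℝ)) • w := fun w => by
    rw [solP, Matrix.mul_sub, Matrix.mul_smul, Matrix.mul_one, Matrix.transpose_mul,
      ← Matrix.mul_assoc (w * pinv a), Matrix.mul_assoc w (pinv a), ha.pinv_mul_transpose]
    simp only [Matrix.mul_assoc]
  have t1 : (a * pinv a * (v * pinv a)ᵀ).trace = (v * pinv a).trace := by
    rw [ha.proj_mul_transpose, Matrix.trace_transpose]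
  have t3 : ((v * pinv a)ᵀ * (v * pinv a)).trace = ((v * pinv a) * (v * pinv a)ᵀ).trace :=
    Matrix.trace_mul_comm _ _
  have r1 := ha.mul_pinv_mul v
  have r2 := ha.mul_pinv_mul a
  have r3 := ha.mul_proj v
  have r4 := ha.proj_mul_transpose v
  have r5 := ha.mul_proj a
  have t5 := ha.trace_proj
  rw [ha.geodesicRHS_eq, hP, matChristoffel, christoffelBil, solOmega]
  simp only [Matrix.add_mul, Matrix.smul_mul, Matrix.transpose_add, Matrix.transpose_smul,
    proj_transpose]
  generalize v * pinv a = L at *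
  generalize a * pinv a = Q at *
  simp only [Matrix.mul_add, Matrix.add_mul, Matrix.smul_mul, Matrix.mul_smul, r3, r4, r5,
    Matrix.trace_add, Matrix.trace_smul, smul_eq_mul, Matrix.trace_transpose, t3, t5,
    Matrix.sub_mul, Matrix.one_mul, Matrix.mul_assoc, r1, r2, smul_add, smul_sub]
  match_scalars <;> field_simp <;> ring

theorem solOmega_transpose (a v : Matrix (Fin n) (Fin m) ℝ) :
    (solOmega a v)ᵀ = -solOmega a v := by
  rw [solOmega, Matrix.transpose_sub, Matrix.transpose_transpose, neg_sub]

/-- The rotation in the explicit solution is orthogonal. -/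
theorem exp_solOmega_orthogonal (a v : Matrix (Fin n) (Fin m) ℝ) (s : ℝ) :
    (NormedSpace.exp (-s • solOmega a v))ᵀ * NormedSpace.exp (-s • solOmega a v) = 1 := by
  have h : (-s • solOmega a v)ᵀ = -(-s • solOmega a v) := by
    rw [Matrix.transpose_smul, solOmega_transpose, smul_neg]
  rw [← Matrix.exp_transpose, h]
  generalize -s • solOmega a v = B
  rw [Matrix.exp_neg]
  exact Matrix.nonsing_inv_mul _ ((Matrix.isUnit_iff_isUnit_det _).1 (Matrix.isUnit_exp B))

/-- The velocity of the explicit solution. -/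
def explicitVel (a v : Matrix (Fin n) (Fin m) ℝ) (t : ℝ) : Matrix (Fin n) (Fin m) ℝ :=
  ((solF a v t) ^ (1 / (m : ℝ)) / solF a v t) •
    (NormedSpace.exp (-(solS a v t) • solOmega a v) *
      (v + (((v * pinv a)ᵀ * (v * pinv a)).trace / 2 * t) • a) *
      NormedSpace.exp (solS a v t • solP a v))

/-- With `k = f^(1/m)`, rotation `O` and invertible `Q`, the position is `k O a Q` and the velocity
is `(k / f) O (v + c a) Q` with `c = δ t / 2`. Rotation, change of basis and scaling can be stripped
from the geodesic equation, which leaves `Full.geodesicRHS_add_smul` at the initial point. -/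
theorem Full.isMatSolution_explicitSol (ha : Full a) (hm : 1 ≤ m) {J : Set ℝ} (hJ : IsOpen J)
    (hJc : J.OrdConnected) (h0 : (0 : ℝ) ∈ J) (hf : ∀ s ∈ J, 0 < solF a v s) :
    IsMatSolution J (explicitSol a v) (explicitVel a v) := by
  intro t ht
  have hm' : (m : ℝ) ≠ 0 := by positivity
  have hft := hf t ht
  have hF := hasDerivAt_solF a v t
  have hS := hasDerivAt_solS hJ hJc h0 hf ht
  set δ := ((v * pinv a)ᵀ * (v * pinv a)).trace with hδ
  set τ := (v * pinv a).trace with hτ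
  set s := solS a v t with hs
  have hk := hF.rpow_const (p := 1 / (m : ℝ)) (Or.inl hft.ne')
  have hE := hasDerivAt_exp_smul (solOmega a v) hS.neg
  have hQ := hasDerivAt_exp_smul (solP a v) hS
  have hkp : 0 < solF a v t ^ (1 / (m : ℝ)) := Real.rpow_pos_of_pos hft _
  set f := solF a v t with hfdef
  set k := f ^ (1 / (m : ℝ)) with hkdef
  have hk1 : f ^ (1 / (m : ℝ) - 1) = k / f := by rw [Real.rpow_sub hft, Real.rpow_one]
  rw [hk1] at hk
  have hfval : f = m * δ / 4 * t ^ 2 + τ * t + 1 := rfl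
  have cO : solOmega a v * NormedSpace.exp (-s • solOmega a v) =
      NormedSpace.exp (-s • solOmega a v) * solOmega a v := (exp_smul_mul_comm _ _).symm
  have cP : solP a v * NormedSpace.exp (s • solP a v) =
      NormedSpace.exp (s • solP a v) * solP a v := (exp_smul_mul_comm _ _).symm
  have hOrth := exp_solOmega_orthogonal a v s
  have hQu : IsUnit (NormedSpace.exp (s • solP a v)).det :=
    (Matrix.isUnit_iff_isUnit_det _).1 (Matrix.isUnit_exp _)
  simp only [Pi.neg_apply, ← hs] at hE hQ
  change HasDerivAt (fun r => NormedSpace.exp (-(solS a v r) • solOmega a v)) _ t at hE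
  rw [cO] at hE
  set O := NormedSpace.exp (-s • solOmega a v) with hO
  set Q := NormedSpace.exp (s • solP a v) with hQdef
  -- At `a`, the rotation by `solOmega` and the right action of `solP` differ exactly by `v` and its
  -- trace correction. This cancels the motion of `O` and `Q` against each other and leaves `v` in
  -- the velocity.
  have hWa : solOmega a v * a = a * solP a v + (τ / m) • a - v := by
    have hP : a * solP a v =
        (a * pinv a) * (v * pinv a)ᵀ * a - (τ / (m : ℝ)) • a := by
      rw [solP, ← hτ, Matrix.mul_sub, Matrix.mul_smul, Matrix.mul_one, Matrix.transpose_mul,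
        ← Matrix.mul_assoc (a * pinv a), Matrix.mul_assoc a (pinv a), ha.pinv_mul_transpose]
      simp only [Matrix.mul_assoc]
    rw [hP, ha.proj_mul_transpose, solOmega, Matrix.sub_mul, ha.mul_pinv_mul]
    abel
  refine ⟨?_, ?_, ?_⟩
  · have h1 : Full (O * a) := by
      rw [Full, Matrix.transpose_mul, Matrix.mul_assoc, ← Matrix.mul_assoc Oᵀ, hOrth,
        Matrix.one_mul]
      exact ha
    have h2 := (h1.mul_right hQu.ne_zero).mul_right (q := k • (1 : Matrix (Fin m) (Fin m) ℝ))
      (by rw [Matrix.det_smul, Matrix.det_one, mul_one]; exact (pow_pos hkp _).ne')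
    rwa [Matrix.mul_smul, Matrix.mul_one] at h2
  · have h1 := hk.smul ((hE.matrix_mul (hasDerivAt_const t a)).matrix_mul hQ)
    refine HasDerivAt.congr_deriv h1 ?_
    rw [Matrix.mul_zero, add_zero, explicitVel, ← hδ, ← hfdef, ← hkdef, ← hs, ← hO, ← hQdef]
    simp only [Matrix.smul_mul, Matrix.mul_smul, Matrix.mul_assoc, cP, hWa, neg_smul,
      Matrix.neg_mul]
    simp only [Matrix.mul_add, Matrix.add_mul, Matrix.mul_sub, Matrix.sub_mul, Matrix.smul_mul,
      Matrix.mul_smul, Matrix.mul_assoc, cP]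
    match_scalars <;> field_simp <;> ring
  · set c := δ / 2 * t with hc
    have hw : HasDerivAt (fun r : ℝ => v + (δ / 2 * r) • a) ((δ / 2) • a) t := by
      have := (((hasDerivAt_id t).const_mul (δ / 2)).smul_const a).const_add v
      rwa [mul_one] at this
    have h1 := (hk.div hF hft.ne').smul ((hE.matrix_mul hw).matrix_mul hQ)
    refine HasDerivAt.congr_deriv h1 ?_
    have hsol : explicitSol a v t = k • (O * a * Q) := rfl
    have hvel : explicitVel a v t = (k / f) • (O * (v + c • a) * Q) := rfl
    have hfull : Full (O * a) := by
      rw [Full, Matrix.transpose_mul, Matrix.mul_assoc, ← Matrix.mul_assoc Oᵀ, hOrth,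
        Matrix.one_mul]
      exact ha
    -- The right factor `Q` need only be invertible, since the Christoffel symbol is equivariant
    -- under all changes of basis; the left factor `O` passes through because it is orthogonal.
    have hR : geodesicRHS (O * a * Q) (O * (v + c • a) * Q) =
        O * geodesicRHS a (v + c • a) * Q := by
      rw [(hfull.mul_right hQu.ne_zero).geodesicRHS_eq, matChristoffel_mul _ _ _ hQu.ne_zero,
        ← hfull.geodesicRHS_eq, geodesicRHS_orthogonal_mul hOrth]
    rw [hsol, hvel, geodesicRHS_smul hkp.ne', hR, ha.geodesicRHS_add_smul hm, ← hδ, ← hτ, ← hfdef,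
      ← hkdef, ← hc]
    set w := v + c • a with hwdef
    have hkf : ((fun y => solF a v y ^ (1 / (m : ℝ))) / solF a v) t = k / f := rfl
    rw [hkf, ← hs, ← hO, ← hQdef]
    simp only [Matrix.smul_mul, Matrix.mul_smul, Matrix.mul_assoc, cP,
      Matrix.mul_add, Matrix.add_mul, Matrix.mul_sub, Matrix.sub_mul]
    -- The remaining scalar equation is `δ f = m c² + 2 τ c + δ`, which holds because `f` has these
    -- coefficients and `c = δ t / 2`.
    have hff : f = m / 2 * c * t + τ * t + 1 := by rw [hfval, hc]; ring
    match_scalars <;> field_simp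
    · linear_combination δ * hff - (m * c + 2 * τ) * hc
    · ring

theorem explicitSol_zero (a v : Matrix (Fin n) (Fin m) ℝ) : explicitSol a v 0 = a := by
  simp [explicitSol, solF, solS]

theorem explicitVel_zero (a v : Matrix (Fin n) (Fin m) ℝ) : explicitVel a v 0 = v := by
  simp [explicitVel, solF, solS]

end MatrixODE

/-! ### Smooth dependence of the explicit solution on the initial data -/

section ExplicitSmooth

attribute [local instance] Matrix.normedAddCommGroup Matrix.normedSpace

variable {m n : ℕ} {E : Type*} [NormedAddCommGroup E] [NormedSpace ℝ E] {x : E} {k : WithTop ℕ∞}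
  {T : E → ℝ} {A V : E → Matrix (Fin n) (Fin m) ℝ}

theorem _root_.ContDiffAt.solF (hA : ContDiffAt ℝ k A x) (hV : ContDiffAt ℝ k V x)
    (hT : ContDiffAt ℝ k T x) (ha : Full (A x)) :
    ContDiffAt ℝ k (fun y => solF (A y) (V y) (T y)) x := by
  have hL := hV.matrix_mul (hA.pinv ha)
  exact (((((contDiffAt_const (c := (m : ℝ))).mul
    (hL.matrix_transpose.matrix_mul hL).matrix_trace).div_const 4).mul (hT.pow 2)).add
    (hL.matrix_trace.mul hT)).add contDiffAt_const

/-- The substitution `σ = t θ` fixes the domain of integration, so the time enters only through the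
integrand and is treated like the other parameters. -/
theorem solS_eq_integral (a v : Matrix (Fin n) (Fin m) ℝ) (t : ℝ) :
    solS a v t = ∫ θ in Icc (0 : ℝ) 1, t / solF a v (t * θ) := by
  rw [integral_Icc_eq_integral_Ioc, ← intervalIntegral.integral_of_le zero_le_one]
  have h := intervalIntegral.smul_integral_comp_mul_left (a := 0) (b := 1)
    (fun σ => 1 / solF a v σ) t
  rw [mul_zero, mul_one] at h
  rw [solS, ← h, smul_eq_mul, ← intervalIntegral.integral_const_mul]
  simp [div_eq_mul_inv]

/-- Positivity of `f` on the compact segment from 0 to the given time persists, by the tube lemma,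
for all nearby parameters and for `θ` in a neighbourhood of the unit interval. There the integrand
is smooth. -/
theorem contDiffAt_solS_param
    {p : ℝ × Matrix (Fin n) (Fin m) ℝ × Matrix (Fin n) (Fin m) ℝ} (ha : Full p.2.1)
    (hf : ∀ θ ∈ Icc (0 : ℝ) 1, 0 < solF p.2.1 p.2.2 (p.1 * θ)) :
    ContDiffAt ℝ ∞ (fun q : ℝ × Matrix (Fin n) (Fin m) ℝ × Matrix (Fin n) (Fin m) ℝ =>
      solS q.2.1 q.2.2 q.1) p := by
  let W : Set ((ℝ × Matrix (Fin n) (Fin m) ℝ × Matrix (Fin n) (Fin m) ℝ) × ℝ) :=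
    {q | Full q.1.2.1}
  have hW : IsOpen W := isOpen_full.preimage
    (f := fun q : (ℝ × Matrix (Fin n) (Fin m) ℝ × Matrix (Fin n) (Fin m) ℝ) × ℝ => q.1.2.1)
    (by fun_prop)
  have hs : ∀ q ∈ W, ContDiffAt ℝ ∞
      (fun q : (ℝ × Matrix (Fin n) (Fin m) ℝ × Matrix (Fin n) (Fin m) ℝ) × ℝ =>
        solF q.1.2.1 q.1.2.2 (q.1.1 * q.2)) q := fun q hq =>
    ContDiffAt.solF contDiffAt_fst.snd.fst contDiffAt_fst.snd.snd
      (contDiffAt_fst.fst.mul contDiffAt_snd) hq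
  have hS : IsOpen (W ∩ (fun q : (ℝ × Matrix (Fin n) (Fin m) ℝ × Matrix (Fin n) (Fin m) ℝ) × ℝ =>
      solF q.1.2.1 q.1.2.2 (q.1.1 * q.2)) ⁻¹' Ioi 0) :=
    ContinuousOn.isOpen_inter_preimage (fun q hq => (hs q hq).continuousAt.continuousWithinAt)
      hW isOpen_Ioi
  obtain ⟨U, I, hU, hI, hpU, hI1, hUI⟩ := generalized_tube_lemma isCompact_singleton
    isCompact_Icc hS (s := {p}) (t := Icc (0 : ℝ) 1) (by
      rintro ⟨q, θ⟩ ⟨rfl, hθ⟩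
      exact ⟨ha, hf θ hθ⟩)
  refine contDiffAt_infty.2 fun k => ?_
  have h1 : ContDiffOn ℝ k (Function.uncurry fun
      (q : ℝ × Matrix (Fin n) (Fin m) ℝ × Matrix (Fin n) (Fin m) ℝ) (θ : ℝ) =>
        q.1 / solF q.2.1 q.2.2 (q.1 * θ)) (U ×ˢ I) := fun q hq => by
    have h2 := (hs q (hUI hq).1).of_le (m := k) (by exact_mod_cast le_top)
    exact (contDiffAt_fst.fst.div h2 (hUI hq).2.ne').contDiffWithinAt
  have h3 := contDiffOn_integral_unitInterval hU hI hI1 k h1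
  refine (h3.contDiffAt (hU.mem_nhds (hpU rfl))).congr_of_eventuallyEq
    (Filter.Eventually.of_forall fun q => solS_eq_integral _ _ _)

theorem _root_.ContDiffAt.explicitSol (hA : ContDiffAt ℝ ∞ A x) (hV : ContDiffAt ℝ ∞ V x)
    (hT : ContDiffAt ℝ ∞ T x) (ha : Full (A x))
    (hf : ∀ θ ∈ Icc (0 : ℝ) 1, 0 < GenEbin.solF (A x) (V x) (T x * θ)) :
    ContDiffAt ℝ ∞ (fun y => explicitSol (A y) (V y) (T y)) x := by
  have h1 : ContDiffAt ℝ ∞ (fun y => GenEbin.solF (A y) (V y) (T y)) x := hA.solF hV hT ha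
  have h0 : 0 < GenEbin.solF (A x) (V x) (T x) := by
    simpa using hf 1 (right_mem_Icc.2 zero_le_one)
  have h2 : ContDiffAt ℝ ∞ (fun y => solS (A y) (V y) (T y)) x :=
    ContDiffAt.comp (f := fun y => (T y, A y, V y)) x
      (contDiffAt_solS_param (p := (T x, A x, V x)) ha hf) (hT.prodMk (hA.prodMk hV))
  have hp := hA.pinv ha
  have hL := hV.matrix_mul hp
  have h3 : ContDiffAt ℝ ∞ (fun y => solOmega (A y) (V y)) x := hL.matrix_transpose.sub hL
  have h4 : ContDiffAt ℝ ∞ (fun y => solP (A y) (V y)) x :=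
    (((hA.matrix_transpose.matrix_mul hA).matrix_inv ha.ne').matrix_mul
      (hV.matrix_transpose.matrix_mul hA)).sub
      ((hL.matrix_trace.div_const _).smul contDiffAt_const)
  exact (h1.rpow_const_of_ne h0.ne').smul
    (((h2.neg.smul h3).matrix_exp.matrix_mul hA).matrix_mul (h2.smul h4).matrix_exp)

end ExplicitSmooth

/-! ### One-forms in frames and in charts -/

section Frames

attribute [local instance] Matrix.normedAddCommGroup Matrix.normedSpace

variable {m n : ℕ}

/-- Linear maps `ℝᵐ → ℝⁿ` as matrices. -/
def matrixOfCLM : (EuclideanSpace ℝ (Fin m) →L[ℝ] EuclideanSpace ℝ (Fin n)) ≃L[ℝ]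
    Matrix (Fin n) (Fin m) ℝ :=
  (Matrix.toEuclideanLin.trans LinearMap.toContinuousLinearMap).symm.toContinuousLinearEquiv

theorem matrixOfCLM_apply (L : EuclideanSpace ℝ (Fin m) →L[ℝ] EuclideanSpace ℝ (Fin n))
    (i : Fin n) (j : Fin m) : matrixOfCLM L i j = L (EuclideanSpace.single j 1) i := by
  obtain ⟨A, rfl⟩ := matrixOfCLM.symm.surjective L
  rw [ContinuousLinearEquiv.apply_symm_apply]
  have : (matrixOfCLM.symm A : EuclideanSpace ℝ (Fin m) →L[ℝ] EuclideanSpace ℝ (Fin n))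
      (EuclideanSpace.single j 1) = Matrix.toEuclideanLin A (EuclideanSpace.single j 1) := rfl
  rw [this]
  simp

variable {H : Type*} [TopologicalSpace H]
  {I : ModelWithCorners ℝ (EuclideanSpace ℝ (Fin m)) H}
  {M : Type*} [TopologicalSpace M] [ChartedSpace H M]

theorem frameMatrix_add {x : M} (b : Fin m → TangentSpace I x)
    (L L' : TangentSpace I x →L[ℝ] EuclideanSpace ℝ (Fin n)) :
    frameMatrix I b (L + L') = frameMatrix I b L + frameMatrix I b L' := by
  ext i j; simp [frameMatrix]

theorem frameMatrix_smul {x : M} (b : Fin m → TangentSpace I x) (r : ℝ)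
    (L : TangentSpace I x →L[ℝ] EuclideanSpace ℝ (Fin n)) :
    frameMatrix I b (r • L) = r • frameMatrix I b L := by
  ext i j; simp [frameMatrix]

theorem frameMatrix_sub {x : M} (b : Fin m → TangentSpace I x)
    (L L' : TangentSpace I x →L[ℝ] EuclideanSpace ℝ (Fin n)) :
    frameMatrix I b (L - L') = frameMatrix I b L - frameMatrix I b L' := by
  ext i j; simp [frameMatrix]

theorem frameMatrix_zero {x : M} (b : Fin m → TangentSpace I x) :
    frameMatrix I b (0 : TangentSpace I x →L[ℝ] EuclideanSpace ℝ (Fin n)) = 0 := by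
  ext i j; simp [frameMatrix]

theorem frameMatrix_mulVec {x : M} (b : Module.Basis (Fin m) ℝ (TangentSpace I x))
    (L : TangentSpace I x →L[ℝ] EuclideanSpace ℝ (Fin n)) (v : Fin m → ℝ) :
    frameMatrix I b L *ᵥ v = L (∑ j, v j • b j) := by
  ext i
  simp [frameMatrix, Matrix.mulVec, dotProduct, mul_comm]

theorem frameMatrix_injective {x : M} (b : Module.Basis (Fin m) ℝ (TangentSpace I x))
    {L L' : TangentSpace I x →L[ℝ] EuclideanSpace ℝ (Fin n)}
    (h : frameMatrix I b L = frameMatrix I b L') : L = L' := by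
  have : (L : TangentSpace I x →ₗ[ℝ] EuclideanSpace ℝ (Fin n)) = L' :=
    b.ext fun j => by
      ext i
      exact congrFun (congrFun h i) j
  exact ContinuousLinearMap.coe_injective this

theorem frameMatrix_change {x : M} (b b' : Module.Basis (Fin m) ℝ (TangentSpace I x))
    (L : TangentSpace I x →L[ℝ] EuclideanSpace ℝ (Fin n)) :
    frameMatrix I b' L = frameMatrix I b L * b.toMatrix b' := by
  ext i j
  simp only [frameMatrix, Matrix.of_apply, Matrix.mul_apply, Module.Basis.toMatrix_apply]
  have h := congrArg (fun v => L v i) (b.sum_repr (b' j))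
  simp only [map_sum, map_smul] at h
  rw [← h]
  simp [mul_comm]

theorem det_toMatrix_ne_zero {x : M} (b b' : Module.Basis (Fin m) ℝ (TangentSpace I x)) :
    (b.toMatrix b').det ≠ 0 := by
  have h := congrArg Matrix.det (b.toMatrix_mul_toMatrix_flip b')
  rw [Matrix.det_mul, Matrix.det_one] at h
  exact left_ne_zero_of_mul (h ▸ one_ne_zero)

theorem full_frameMatrix_iff {x : M} (b : Module.Basis (Fin m) ℝ (TangentSpace I x))
    (L : TangentSpace I x →L[ℝ] EuclideanSpace ℝ (Fin n)) :
    Full (frameMatrix I b L) ↔ Function.Injective L := by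
  rw [full_iff_injective]
  have h1 : (frameMatrix I b L).mulVec =
      (WithLp.equiv 2 (Fin n → ℝ)) ∘ L ∘ b.equivFun.symm := by
    funext v
    rw [frameMatrix_mulVec]
    simp [Module.Basis.equivFun_symm_apply]
  rw [h1, Equiv.comp_injective]
  exact b.equivFun.symm.toEquiv.injective_comp L

variable [IsManifold I ∞ M]

/-- The coordinate frame at `c` as a basis of `T_xM`. -/
def chartBasis (c x : M) (hx : x ∈ (chartAt H c).source) :
    Module.Basis (Fin m) ℝ (TangentSpace I x) :=
  (EuclideanSpace.basisFun (Fin m) ℝ).toBasis.map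
    ((trivializationAt (EuclideanSpace ℝ (Fin m)) (TangentSpace I : M → Type _)
      c).continuousLinearEquivAt ℝ x (by simpa using hx)).symm.toLinearEquiv

theorem coe_chartBasis (c x : M) (hx : x ∈ (chartAt H c).source) :
    ⇑(chartBasis (I := I) c x hx) = chartFrame I c x := by
  funext j
  simp only [chartBasis, chartFrame, Module.Basis.map_apply, OrthonormalBasis.coe_toBasis,
    EuclideanSpace.basisFun_apply]
  exact congrFun (Trivialization.symm_continuousLinearEquivAt_eq _ _) _

theorem chartMatrix_eq (c x : M) (hx : x ∈ (chartAt H c).source)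
    (L : TangentSpace I x →L[ℝ] EuclideanSpace ℝ (Fin n)) :
    chartMatrix I c x L = frameMatrix I (chartBasis (I := I) c x hx) L := by
  rw [chartMatrix, coe_chartBasis]

theorem chartMatrix_eq_matrixOfCLM (c x : M) (L : TangentSpace I x →L[ℝ] EuclideanSpace ℝ (Fin n)) :
    chartMatrix I c x L = matrixOfCLM (L ∘L (trivializationAt (EuclideanSpace ℝ (Fin m))
      (TangentSpace I : M → Type _) c).symmL ℝ x) := by
  ext i j
  rw [matrixOfCLM_apply]
  rfl

/-- A family of matrices that transforms as the matrices of a one-form is a one-form. -/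
theorem exists_form (G : ∀ x : M, Module.Basis (Fin m) ℝ (TangentSpace I x) →
    Matrix (Fin n) (Fin m) ℝ) (hG : ∀ x b b', G x b' = G x b * b.toMatrix b') :
    ∃ β : RawForm I M n, ∀ x (b : Module.Basis (Fin m) ℝ (TangentSpace I x)),
      frameMatrix I b (β x) = G x b := by
  let B : ∀ x : M, Module.Basis (Fin m) ℝ (TangentSpace I x) :=
    fun x => chartBasis (I := I) x x (mem_chart_source H x)
  let β : RawForm I M n := fun x => (matrixOfCLM.symm (G x (B x)) :
    EuclideanSpace ℝ (Fin m) →L[ℝ] EuclideanSpace ℝ (Fin n)) ∘L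
      ((trivializationAt (EuclideanSpace ℝ (Fin m)) (TangentSpace I : M → Type _)
        x).continuousLinearEquivAt ℝ x (by simp) : TangentSpace I x →L[ℝ] EuclideanSpace ℝ (Fin m))
  have h0 : ∀ x, frameMatrix I (B x) (β x) = G x (B x) := fun x => by
    ext i j
    have h1 : B x j = ((trivializationAt (EuclideanSpace ℝ (Fin m))
      (TangentSpace I : M → Type _) x).continuousLinearEquivAt ℝ x (by simp)).symm
        (EuclideanSpace.single j 1) := by
      simp only [B, chartBasis, Module.Basis.map_apply, OrthonormalBasis.coe_toBasis,
        EuclideanSpace.basisFun_apply]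
      rfl
    conv_rhs => rw [← matrixOfCLM.apply_symm_apply (G x (B x)), matrixOfCLM_apply]
    simp only [frameMatrix, Matrix.of_apply, β, h1, ContinuousLinearMap.comp_apply,
      ContinuousLinearEquiv.coe_coe, ContinuousLinearEquiv.apply_symm_apply]
  refine ⟨β, fun x b => ?_⟩
  rw [frameMatrix_change (B x) b, h0, ← hG]

/-! ### Smoothness of paths of one-forms in charts -/

variable (I) in
/-- A matrix-valued function of `(t, x)` is smooth at `p`. -/
def SmoothMatAt (g : ℝ × M → Matrix (Fin n) (Fin m) ℝ) (p : ℝ × M) : Prop :=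
  ContMDiffAt (𝓘(ℝ, ℝ).prod I) 𝓘(ℝ, Fin n → Fin m → ℝ) ∞ (fun p i j => g p i j) p

/-- Smoothness of a section is smoothness of its coordinates in one local trivialization. In the hom
bundle with trivial target these coordinates are the composition with the inverse tangent
trivialization, which is the chart matrix. -/
theorem contMDiffAt_mk_iff (β : ℝ → RawForm I M n) (t : ℝ) {c x : M}
    (hx : x ∈ (chartAt H c).source) :
    ContMDiffAt (𝓘(ℝ, ℝ).prod I)
        (I.prod 𝓘(ℝ, EuclideanSpace ℝ (Fin m) →L[ℝ] EuclideanSpace ℝ (Fin n))) ∞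
        (fun p : ℝ × M => TotalSpace.mk' (EuclideanSpace ℝ (Fin m) →L[ℝ] EuclideanSpace ℝ (Fin n))
        (E := fun x : M => TangentSpace I x →L[ℝ] Bundle.Trivial M (EuclideanSpace ℝ (Fin n)) x)
        p.2 (β p.1 p.2)) (t, x) ↔
      SmoothMatAt I (fun p : ℝ × M => chartMatrix I c p.2 (β p.1 p.2)) (t, x) := by
  rw [Trivialization.contMDiffAt_iff (e := trivializationAt
    (EuclideanSpace ℝ (Fin m) →L[ℝ] EuclideanSpace ℝ (Fin n))
    (fun x : M => TangentSpace I x →L[ℝ] Bundle.Trivial M (EuclideanSpace ℝ (Fin n)) x) c)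
    (by simpa [hom_trivializationAt_source] using hx)]
  let T : ℝ × M → (EuclideanSpace ℝ (Fin m) →L[ℝ] EuclideanSpace ℝ (Fin n)) := fun p =>
    ((trivializationAt (EuclideanSpace ℝ (Fin m) →L[ℝ] EuclideanSpace ℝ (Fin n))
      (fun x : M => TangentSpace I x →L[ℝ] Bundle.Trivial M (EuclideanSpace ℝ (Fin n)) x) c)
      (TotalSpace.mk' (EuclideanSpace ℝ (Fin m) →L[ℝ] EuclideanSpace ℝ (Fin n))
      (E := fun x : M => TangentSpace I x →L[ℝ] Bundle.Trivial M (EuclideanSpace ℝ (Fin n)) x)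
      p.2 (β p.1 p.2))).2
  let φ : (EuclideanSpace ℝ (Fin m) →L[ℝ] EuclideanSpace ℝ (Fin n)) ≃L[ℝ]
    (Fin n → Fin m → ℝ) := matrixOfCLM
  have h1 : (fun (p : ℝ × M) i j => chartMatrix I c p.2 (β p.1 p.2) i j) = fun p => φ (T p) := by
    funext p
    change chartMatrix I c p.2 (β p.1 p.2) = matrixOfCLM (T p)
    rw [chartMatrix_eq_matrixOfCLM]
    congr 1
    simp only [T, hom_trivializationAt_apply]
    ext v i
    simp [ContinuousLinearMap.inCoordinates]
  rw [SmoothMatAt, h1]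
  constructor
  · intro h
    exact φ.contDiff.contMDiff.contMDiffAt.comp (t, x) h.2
  · intro h
    refine ⟨contMDiffAt_snd, ?_⟩
    have h2 := φ.symm.contDiff.contMDiff.contMDiffAt.comp (t, x) h
    have h3 : (φ.symm ∘ fun p => φ (T p)) = T := by funext p; simp
    rwa [h3] at h2

/-- Both sides express smoothness of the same section, so transition matrices never have to be
differentiated. -/
theorem smoothMatAt_chart_iff (β : ℝ → RawForm I M n) (t : ℝ) {c c' x : M}
    (hx : x ∈ (chartAt H c).source) (hx' : x ∈ (chartAt H c').source) :
    SmoothMatAt I (fun p : ℝ × M => chartMatrix I c p.2 (β p.1 p.2)) (t, x) ↔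
      SmoothMatAt I (fun p : ℝ × M => chartMatrix I c' p.2 (β p.1 p.2)) (t, x) :=
  (contMDiffAt_mk_iff β t hx).symm.trans (contMDiffAt_mk_iff β t hx')

theorem isSmoothPathOn_iff {J : Set ℝ} (hJ : IsOpen J) {β : ℝ → RawForm I M n} :
    IsSmoothPathOn I J β ↔ ∀ t ∈ J, ∀ c x : M, x ∈ (chartAt H c).source →
      SmoothMatAt I (fun p : ℝ × M => chartMatrix I c p.2 (β p.1 p.2)) (t, x) := by
  have hopen : IsOpen (J ×ˢ (univ : Set M)) := hJ.prod isOpen_univ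
  constructor
  · intro h t ht c x hx
    exact (contMDiffAt_mk_iff β t hx).1
      ((h (t, x) ⟨ht, mem_univ _⟩).contMDiffAt (hopen.mem_nhds ⟨ht, mem_univ _⟩))
  · rintro h ⟨t, x⟩ ⟨ht, -⟩
    have hx := mem_chart_source H x
    exact ((contMDiffAt_mk_iff β t hx).2 (h t ht x x hx)).contMDiffWithinAt

end Frames

/-! ### Calculus for paths of one-forms -/

section Paths

attribute [local instance] Matrix.normedAddCommGroup Matrix.normedSpace

variable {m n : ℕ} {H : Type*} [TopologicalSpace H]
  {I : ModelWithCorners ℝ (EuclideanSpace ℝ (Fin m)) H}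
  {M : Type*} [TopologicalSpace M] [ChartedSpace H M]

/-- Raw forms carry only the product topology over `M`, in which differentiability is
differentiability at each point. -/
theorem hasDerivAt_rawForm {β : ℝ → RawForm I M n} {β' : RawForm I M n} {t : ℝ} :
    HasDerivAt β β' t ↔ ∀ x, HasDerivAt (fun s => β s x) (β' x) t := by
  simp only [hasDerivAt_iff_hasFDerivAt, hasFDerivAt_iff_isLittleOTVS]
  exact Asymptotics.isLittleOTVS_pi

/-- Taking the matrix with respect to a basis is an isomorphism. -/
def frameCLE {x : M} (b : Module.Basis (Fin m) ℝ (TangentSpace I x)) :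
    (EuclideanSpace ℝ (Fin m) →L[ℝ] EuclideanSpace ℝ (Fin n)) ≃L[ℝ] (Fin n → Fin m → ℝ) :=
  LinearEquiv.toContinuousLinearEquiv <| LinearEquiv.ofBijective
    { toFun := fun L => (frameMatrix I b L : Fin n → Fin m → ℝ)
      map_add' := frameMatrix_add _
      map_smul' := frameMatrix_smul _ } <| by
    refine ⟨fun L L' h => frameMatrix_injective b h, fun A => ?_⟩
    let bE : Module.Basis (Fin m) ℝ (EuclideanSpace ℝ (Fin m)) := b
    refine ⟨((Matrix.toEuclideanLin (A : Matrix (Fin n) (Fin m) ℝ)).comp ((WithLp.linearEquiv 2 ℝ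
      (Fin m → ℝ)).symm.toLinearMap.comp bE.equivFun.toLinearMap)).toContinuousLinearMap, ?_⟩
    ext i j
    change (Matrix.toEuclideanLin (A : Matrix (Fin n) (Fin m) ℝ)
      (WithLp.toLp 2 (bE.equivFun (bE j)))) i = A i j
    rw [show bE.equivFun (bE j) = Pi.single j 1 by
      ext k; simp [Module.Basis.equivFun_self, Pi.single_apply, eq_comm]]
    simp

theorem hasDerivAt_clm_iff {x : M} (b : Module.Basis (Fin m) ℝ (TangentSpace I x))
    {L : ℝ → (TangentSpace I x →L[ℝ] EuclideanSpace ℝ (Fin n))}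
    {L' : TangentSpace I x →L[ℝ] EuclideanSpace ℝ (Fin n)} {t : ℝ} :
    HasDerivAt L L' t ↔
      HasDerivAt (fun s => frameMatrix I b (L s)) (frameMatrix I b L') t := by
  let K : ℝ → (EuclideanSpace ℝ (Fin m) →L[ℝ] EuclideanSpace ℝ (Fin n)) := L
  let K' : EuclideanSpace ℝ (Fin m) →L[ℝ] EuclideanSpace ℝ (Fin n) := L'
  let φ := frameCLE (n := n) b
  change HasDerivAt K K' t ↔ HasDerivAt (fun s => φ (K s)) (φ K') t
  constructor
  · intro h
    exact φ.toContinuousLinearMap.hasFDerivAt.comp_hasDerivAt t h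
  · intro h
    have h2 := φ.symm.toContinuousLinearMap.hasFDerivAt.comp_hasDerivAt t h
    simpa [Function.comp_def] using h2

theorem hasDerivAt_form_iff {β : ℝ → RawForm I M n} {β' : RawForm I M n} {t : ℝ} :
    HasDerivAt β β' t ↔ ∀ x (b : Module.Basis (Fin m) ℝ (TangentSpace I x)),
      HasDerivAt (fun s => frameMatrix I b (β s x)) (frameMatrix I b (β' x)) t := by
  rw [hasDerivAt_rawForm]
  refine ⟨fun h x b => (hasDerivAt_clm_iff b).1 (h x), fun h x => ?_⟩
  let b : Module.Basis (Fin m) ℝ (TangentSpace I x) :=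
    (EuclideanSpace.basisFun (Fin m) ℝ).toBasis
  exact (hasDerivAt_clm_iff b).2 (h x b)

/-- The space of raw forms is not normed. The chosen value of `deriv` is shown to be a derivative,
and uniqueness is then checked in a frame at each point, where the matrices form a normed space. -/
theorem hasDerivAt_deriv_form {β : ℝ → RawForm I M n} {β' : RawForm I M n} {t : ℝ}
    (h : HasDerivAt β β' t) : deriv β t = β' := by
  have h1 : HasDerivAt β (deriv β t) t := by
    have h0 : DifferentiableWithinAt ℝ β univ t := ⟨_, hasFDerivWithinAt_univ.2 h⟩
    have h2 : HasFDerivAt β (fderiv ℝ β t) t := by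
      rw [← hasFDerivWithinAt_univ]
      -- By definition `fderiv` is zero if zero is a derivative, and a chosen derivative otherwise;
      -- in both cases it is one.
      simp only [fderiv, fderivWithin, dif_pos h0]
      split_ifs with h₀
      exacts [h₀, Classical.choose_spec h0]
    have h4 : ∀ r : ℝ, fderiv ℝ β t r =
        ContinuousLinearMap.toSpanSingleton ℝ (deriv β t) r := fun r => by
      have h3 : fderiv ℝ β t (r * 1) = r • fderiv ℝ β t 1 := (fderiv ℝ β t).map_smul r 1
      rwa [mul_one] at h3
    have h5 : fderiv ℝ β t = ContinuousLinearMap.toSpanSingleton ℝ (deriv β t) :=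
      ContinuousLinearMap.ext h4
    rwa [h5] at h2
  rw [hasDerivAt_form_iff] at h h1
  funext x
  let b : Module.Basis (Fin m) ℝ (TangentSpace I x) :=
    (EuclideanSpace.basisFun (Fin m) ℝ).toBasis
  exact frameMatrix_injective b ((h1 x b).unique (h x b))

theorem SmoothMatAt.op {g₁ g₂ g₃ : ℝ × M → Matrix (Fin n) (Fin m) ℝ} {p : ℝ × M}
    (h₁ : SmoothMatAt I g₁ p) (h₂ : SmoothMatAt I g₂ p) (h₃ : SmoothMatAt I g₃ p)
    {F : ℝ × Matrix (Fin n) (Fin m) ℝ × Matrix (Fin n) (Fin m) ℝ × Matrix (Fin n) (Fin m) ℝ →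
      Matrix (Fin n) (Fin m) ℝ} (hF : ContDiffAt ℝ ∞ F (p.1, g₁ p, g₂ p, g₃ p)) :
    SmoothMatAt I (fun q => F (q.1, g₁ q, g₂ q, g₃ q)) p := by
  have h0 : ContMDiffAt (𝓘(ℝ, ℝ).prod I) 𝓘(ℝ, ℝ × (Fin n → Fin m → ℝ) × (Fin n → Fin m → ℝ) ×
      (Fin n → Fin m → ℝ)) ∞ (fun q : ℝ × M => (q.1, (fun i j => g₁ q i j),
        (fun i j => g₂ q i j), (fun i j => g₃ q i j))) p :=
    contMDiffAt_fst.prodMk_space (h₁.prodMk_space (h₂.prodMk_space h₃))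
  let F' : ℝ × (Fin n → Fin m → ℝ) × (Fin n → Fin m → ℝ) × (Fin n → Fin m → ℝ) →
    (Fin n → Fin m → ℝ) := F
  have h4 : ContDiffAt ℝ ∞ F' (p.1, (fun i j => g₁ p i j), (fun i j => g₂ p i j),
    (fun i j => g₃ p i j)) := hF
  have h5 : ContMDiffAt 𝓘(ℝ, ℝ × (Fin n → Fin m → ℝ) × (Fin n → Fin m → ℝ) ×
      (Fin n → Fin m → ℝ)) 𝓘(ℝ, Fin n → Fin m → ℝ) ∞ F' (p.1, (fun i j => g₁ p i j),
        (fun i j => g₂ p i j), (fun i j => g₃ p i j)) := h4.contMDiffAt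
  exact ContMDiffAt.comp (f := fun q : ℝ × M => (q.1, (fun i j => g₁ q i j),
        (fun i j => g₂ q i j), (fun i j => g₃ q i j))) p h5 h0

/-- The time derivative is the derivative of a function on `ℝ` depending smoothly on the parameter
`q`, taken at the moving point `q.1` and evaluated on the vector 1. -/
theorem SmoothMatAt.deriv [IsManifold I ∞ M] {g : ℝ × M → Matrix (Fin n) (Fin m) ℝ} {p : ℝ × M}
    (h : SmoothMatAt I g p) :
    SmoothMatAt I (fun q => deriv (fun s => g (s, q.2)) q.1) p := by
  let f : ℝ × M → ℝ → (Fin n → Fin m → ℝ) := fun q s => g (s, q.2)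
  have hmap : ContMDiffAt ((𝓘(ℝ, ℝ).prod I).prod 𝓘(ℝ, ℝ)) (𝓘(ℝ, ℝ).prod I) ∞
      (fun q : (ℝ × M) × ℝ => (q.2, q.1.2)) (p, p.1) :=
    contMDiffAt_snd.prodMk contMDiffAt_fst.snd
  have h1 : ContMDiffAt ((𝓘(ℝ, ℝ).prod I).prod 𝓘(ℝ, ℝ)) 𝓘(ℝ, Fin n → Fin m → ℝ) ∞
      (Function.uncurry f) (p, p.1) :=
    ContMDiffAt.comp (f := fun q : (ℝ × M) × ℝ => (q.2, q.1.2)) (p, p.1) h hmap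
  have : IsManifold I 1 M := IsManifold.of_le (n := ∞) (by exact_mod_cast le_top)
  have h2 := ContMDiffAt.mfderiv (m := ∞) f Prod.fst h1 contMDiffAt_fst le_rfl
  let ψ : ℝ × M → (ℝ →L[ℝ] (Fin n → Fin m → ℝ)) := fun q => fderiv ℝ (f q) q.1
  have h2' : ContMDiffAt (𝓘(ℝ, ℝ).prod I) 𝓘(ℝ, ℝ →L[ℝ] (Fin n → Fin m → ℝ)) ∞ ψ p := by
    refine h2.congr_of_eventuallyEq (Filter.Eventually.of_forall fun q => ?_)
    -- Between vector spaces the tangent coordinates are trivial, so the manifold derivative in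
    -- coordinates is the usual one.
    have e := congrFun (inTangentCoordinates_model_space (I := 𝓘(ℝ, ℝ))
      (I' := 𝓘(ℝ, Fin n → Fin m → ℝ)) (Prod.fst : ℝ × M → ℝ) (fun q => f q q.1) ψ p) q
    rw [← e]
    simp only [inTangentCoordinates, ψ, mfderiv_eq_fderiv]
  let ev : (ℝ →L[ℝ] (Fin n → Fin m → ℝ)) →L[ℝ] (Fin n → Fin m → ℝ) :=
    ContinuousLinearMap.apply ℝ (Fin n → Fin m → ℝ) (1 : ℝ)
  exact ev.contDiff.contMDiff.contMDiffAt.comp p h2'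

theorem SmoothMatAt.hasDerivAt {g : ℝ × M → Matrix (Fin n) (Fin m) ℝ} {t : ℝ} {x : M}
    (h : SmoothMatAt I g (t, x)) :
    HasDerivAt (fun s => g (s, x)) (_root_.deriv (fun s => g (s, x)) t) t := by
  have h0 : ContMDiffAt 𝓘(ℝ, ℝ) (𝓘(ℝ, ℝ).prod I) ∞ (fun s : ℝ => (s, x)) t :=
    contMDiffAt_id.prodMk contMDiffAt_const
  have h1 : ContMDiffAt 𝓘(ℝ, ℝ) 𝓘(ℝ, Fin n → Fin m → ℝ) ∞ (fun s : ℝ => fun i j => g (s, x) i j) t :=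
    ContMDiffAt.comp (f := fun s : ℝ => (s, x)) t h h0
  exact (h1.contDiffAt.differentiableAt (by simp)).hasDerivAt

theorem SmoothMatAt.continuousAt {g : ℝ × M → Matrix (Fin n) (Fin m) ℝ} {p : ℝ × M}
    (h : SmoothMatAt I g p) : ContinuousAt g p :=
  ContMDiffAt.continuousAt (M' := Fin n → Fin m → ℝ) h

variable [IsManifold I ∞ M] {J : Set ℝ}

/-- A pointwise operation `F` that is given by the same smooth formula in all frames maps smooth
paths of one-forms to smooth paths. -/
theorem isSmoothPathOn_of_op (hJ : IsOpen J) {α ζ η β : ℝ → RawForm I M n}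
    (hα : IsSmoothPathOn I J α) (hζ : IsSmoothPathOn I J ζ) (hη : IsSmoothPathOn I J η)
    (F : ℝ → Matrix (Fin n) (Fin m) ℝ → Matrix (Fin n) (Fin m) ℝ → Matrix (Fin n) (Fin m) ℝ →
      Matrix (Fin n) (Fin m) ℝ)
    (hβ : ∀ t ∈ J, ∀ x (b : Module.Basis (Fin m) ℝ (TangentSpace I x)), frameMatrix I b (β t x) =
      F t (frameMatrix I b (α t x)) (frameMatrix I b (ζ t x)) (frameMatrix I b (η t x)))
    (hF : ∀ t ∈ J, ∀ x (b : Module.Basis (Fin m) ℝ (TangentSpace I x)), ContDiffAt ℝ ∞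
      (fun q : ℝ × Matrix (Fin n) (Fin m) ℝ × Matrix (Fin n) (Fin m) ℝ × Matrix (Fin n) (Fin m) ℝ =>
        F q.1 q.2.1 q.2.2.1 q.2.2.2) (t, frameMatrix I b (α t x), frameMatrix I b (ζ t x),
          frameMatrix I b (η t x))) :
    IsSmoothPathOn I J β := by
  rw [isSmoothPathOn_iff hJ] at hα hζ hη ⊢
  intro t ht c x hx
  have h := (hα t ht c x hx).op (hζ t ht c x hx) (hη t ht c x hx)
    (by simpa only [chartMatrix_eq c x hx] using hF t ht x (chartBasis c x hx))
  refine ContMDiffAt.congr_of_eventuallyEq h ?_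
  have hn : J ×ˢ (chartAt H c).source ∈ nhds (t, x) :=
    (hJ.prod (chartAt H c).open_source).mem_nhds ⟨ht, hx⟩
  filter_upwards [hn] with p hp
  funext i j
  simp only [chartMatrix_eq c p.2 hp.2, hβ p.1 hp.1]

theorem IsSmoothPathOn.mono {J' : Set ℝ} {β : ℝ → RawForm I M n} (h : IsSmoothPathOn I J β)
    (hJ : J' ⊆ J) : IsSmoothPathOn I J' β :=
  ContMDiffOn.mono h (prod_mono_left hJ)

theorem IsSmoothPathOn.mem_omega {β : ℝ → RawForm I M n} (h : IsSmoothPathOn I J β) {t : ℝ}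
    (ht : t ∈ J) : β t ∈ Omega I M n := by
  have h1 : ContMDiff I (𝓘(ℝ, ℝ).prod I) ∞ (fun x : M => (t, x)) :=
    contMDiff_const.prodMk contMDiff_id
  exact ContMDiffOn.comp_contMDiff h h1 fun x => ⟨ht, mem_univ _⟩

theorem isSmoothPathOn_const {ζ : RawForm I M n} (h : ζ ∈ Omega I M n) (J : Set ℝ) :
    IsSmoothPathOn I J fun _ => ζ :=
  (ContMDiff.comp (I := 𝓘(ℝ, ℝ).prod I) (f := (Prod.snd : ℝ × M → M)) h contMDiff_snd).contMDiffOn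

theorem mem_omega_iff {ζ : RawForm I M n} :
    ζ ∈ Omega I M n ↔ IsSmoothPathOn I univ fun _ => ζ :=
  ⟨fun h => isSmoothPathOn_const h _, fun h => h.mem_omega (mem_univ 0)⟩

theorem IsSmoothPathOn.congr {β β' : ℝ → RawForm I M n} (h : IsSmoothPathOn I J β)
    (h' : ∀ t ∈ J, β' t = β t) : IsSmoothPathOn I J β' :=
  ContMDiffOn.congr h fun p hp => by simp only [h' p.1 hp.1]

theorem IsSmoothPathOn.hasDerivAt {β : ℝ → RawForm I M n} (hJ : IsOpen J)
    (h : IsSmoothPathOn I J β) {t : ℝ} (ht : t ∈ J) : HasDerivAt β (deriv β t) t := by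
  have h1 : ∀ x, HasDerivAt (fun s => β s x) (deriv (fun s => β s x) t) t := fun x => by
    have hx := mem_chart_source H x
    have h2 := ((isSmoothPathOn_iff hJ).1 h t ht x x hx).hasDerivAt
    simp only [chartMatrix_eq x x hx] at h2
    let φ := frameCLE (n := n) (chartBasis (I := I) x x hx)
    have h3 := φ.symm.toContinuousLinearMap.hasFDerivAt.comp_hasDerivAt t h2
    let K : ℝ → (EuclideanSpace ℝ (Fin m) →L[ℝ] EuclideanSpace ℝ (Fin n)) := fun s => β s x
    have h4 : HasDerivAt K _ t := h3.congr_of_eventuallyEq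
      (Filter.Eventually.of_forall fun s => (φ.symm_apply_apply (K s)).symm)
    exact h4.differentiableAt.hasDerivAt
  have h5 : HasDerivAt β (fun x => deriv (fun s => β s x) t) t := hasDerivAt_rawForm.2 h1
  rwa [hasDerivAt_deriv_form h5]

theorem IsSmoothPathOn.hasDerivAt_frameMatrix {β : ℝ → RawForm I M n} (hJ : IsOpen J)
    (h : IsSmoothPathOn I J β) {t : ℝ} (ht : t ∈ J) (x : M)
    (b : Module.Basis (Fin m) ℝ (TangentSpace I x)) :
    HasDerivAt (fun s => frameMatrix I b (β s x)) (frameMatrix I b (deriv β t x)) t :=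
  hasDerivAt_form_iff.1 (h.hasDerivAt hJ ht) x b

theorem deriv_frameMatrix {β : ℝ → RawForm I M n} (hJ : IsOpen J)
    (h : IsSmoothPathOn I J β) {t : ℝ} (ht : t ∈ J) (x : M)
    (b : Module.Basis (Fin m) ℝ (TangentSpace I x)) :
    deriv (fun s => frameMatrix I b (β s x)) t = frameMatrix I b (deriv β t x) :=
  (h.hasDerivAt_frameMatrix hJ ht x b).deriv

theorem IsSmoothPathOn.deriv {β : ℝ → RawForm I M n} (hJ : IsOpen J)
    (h : IsSmoothPathOn I J β) : IsSmoothPathOn I J (deriv β) := by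
  rw [isSmoothPathOn_iff hJ]
  intro t ht c x hx
  have h1 := ((isSmoothPathOn_iff hJ).1 h t ht c x hx).deriv
  refine ContMDiffAt.congr_of_eventuallyEq h1 ?_
  have hn : J ×ˢ (chartAt H c).source ∈ nhds (t, x) :=
    (hJ.prod (chartAt H c).open_source).mem_nhds ⟨ht, hx⟩
  filter_upwards [hn] with p hp
  funext i j
  simp only [chartMatrix_eq c p.2 hp.2, deriv_frameMatrix hJ h hp.1]

end Paths

/-! ### Integration of continuous densities -/

section Densities

variable {m : ℕ} {H : Type*} [TopologicalSpace H]
  {I : ModelWithCorners ℝ (EuclideanSpace ℝ (Fin m)) H}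
  {M : Type*} [TopologicalSpace M] [ChartedSpace H M]

theorem measurableSet_extChartAt_target (c : M) : MeasurableSet (extChartAt I c).target := by
  rw [extChartAt_target]
  exact ((I.continuous_symm.isOpen_preimage _ (chartAt H c).open_target).measurableSet).inter
    I.isClosed_range.measurableSet

theorem symm_mem_source {c : M} {y : EuclideanSpace ℝ (Fin m)}
    (hy : y ∈ (extChartAt I c).target) : (extChartAt I c).symm y ∈ (chartAt H c).source := by
  rw [← extChartAt_source I]
  exact (extChartAt I c).map_target hy

variable [IsManifold I ∞ M] [CompactSpace M] [T2Space M]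

theorem chartPartition_isSubordinate :
    (chartPartition I M).IsSubordinate fun c => (chartAt H c).source :=
  Classical.choose_spec (SmoothPartitionOfUnity.exists_isSubordinate_chartAt_source I M)

variable (I) in
/-- The support of a function of the partition of unity, in coordinates. -/
def chartSupport (c : M) : Set (EuclideanSpace ℝ (Fin m)) :=
  extChartAt I c '' tsupport (chartPartition I M c)

theorem tsupport_chartPartition_subset (c : M) :
    tsupport (chartPartition I M c) ⊆ (extChartAt I c).source := by
  rw [extChartAt_source]
  exact chartPartition_isSubordinate c

theorem isCompact_chartSupport (c : M) : IsCompact (chartSupport I c) :=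
  (isClosed_tsupport _).isCompact.image_of_continuousOn
    ((continuousOn_extChartAt c).mono (tsupport_chartPartition_subset c))

theorem chartSupport_subset (c : M) : chartSupport I c ⊆ (extChartAt I c).target := by
  rintro _ ⟨x, hx, rfl⟩
  exact (extChartAt I c).map_source (tsupport_chartPartition_subset c hx)

theorem chartPartition_eq_zero {c : M} {y : EuclideanSpace ℝ (Fin m)}
    (hy : y ∈ (extChartAt I c).target) (hy' : y ∉ chartSupport I c) :
    chartPartition I M c ((extChartAt I c).symm y) = 0 := by
  by_contra h
  exact hy' ⟨_, subset_tsupport _ h, (extChartAt I c).right_inv hy⟩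

/-- The partition function vanishes off a compact subset of the chart image, so the integrals can be
differentiated and bounded by compactness. -/
theorem integral_target_eq (D : M → M → ℝ) (c : M) :
    ∫ y in (extChartAt I c).target, densityIntegrand I D c y =
      ∫ y in chartSupport I c, densityIntegrand I D c y :=
  setIntegral_eq_of_subset_of_forall_sdiff_eq_zero (f := densityIntegrand I D c)
    (measurableSet_extChartAt_target c) (chartSupport_subset c) fun y hy => by
      rw [densityIntegrand, chartPartition_eq_zero hy.1 hy.2, zero_mul]

theorem finite_chartPartition :
    {c : M | ∃ x, chartPartition I M c x ≠ 0}.Finite := by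
  have h := (chartPartition I M).locallyFinite.finite_nonempty_of_compact
  exact h.subset fun c ⟨x, hx⟩ => ⟨x, hx⟩

variable (I M) in
/-- The finitely many charts that contribute to integrals over `M`. -/
def activeCharts : Finset M := (finite_chartPartition (I := I) (M := M)).toFinset

theorem densityIntegral_eq_sum (D : M → M → ℝ) :
    densityIntegral I D = ∑ c ∈ activeCharts I M,
      ∫ y in chartSupport I c, densityIntegrand I D c y := by
  simp only [densityIntegral, integral_target_eq]
  refine finsum_eq_sum_of_support_subset _ fun c hc => ?_
  simp only [activeCharts, Finite.coe_toFinset, mem_ofPred_eq]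
  by_contra h
  push Not at h
  refine hc ?_
  simp [densityIntegrand, h]

/-- Pointwise identities are integrated chart by chart, so independence of the integral from the
charts is not used. -/
theorem densityIntegral_congr {D D' : M → M → ℝ}
    (h : ∀ c, ∀ x ∈ (chartAt H c).source, D c x = D' c x) :
    densityIntegral I D = densityIntegral I D' := by
  unfold densityIntegral
  congr 1
  funext c
  refine setIntegral_congr_fun (measurableSet_extChartAt_target c) fun y hy => ?_
  simp only [densityIntegrand, h c _ (symm_mem_source hy)]

theorem continuousOn_chartPartition_symm (c : M) :
    ContinuousOn (fun y => chartPartition I M c ((extChartAt I c).symm y))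
      (extChartAt I c).target :=
  (chartPartition I M c).contMDiff.continuous.comp_continuousOn (continuousOn_extChartAt_symm c)

variable {P : Type*} [TopologicalSpace P]

theorem continuousOn_densityIntegrand {U : Set P} {D : P → M → M → ℝ} {c : M}
    (hD : ContinuousOn (fun q : P × M => D q.1 c q.2) (U ×ˢ (chartAt H c).source)) :
    ContinuousOn (Function.uncurry fun p y => densityIntegrand I (D p) c y)
      (U ×ˢ (extChartAt I c).target) := by
  have h1 : ContinuousOn (fun q : P × EuclideanSpace ℝ (Fin m) =>
      chartPartition I M c ((extChartAt I c).symm q.2)) (U ×ˢ (extChartAt I c).target) :=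
    (continuousOn_chartPartition_symm c).comp continuousOn_snd fun _ h => h.2
  have h2 : ContinuousOn (fun q : P × EuclideanSpace ℝ (Fin m) =>
      (q.1, (extChartAt I c).symm q.2)) (U ×ˢ (extChartAt I c).target) :=
    continuousOn_fst.prodMk ((continuousOn_extChartAt_symm c).comp continuousOn_snd fun _ h => h.2)
  exact h1.mul (hD.comp h2 fun q hq => ⟨hq.1, symm_mem_source hq.2⟩)

variable (H) in
/-- The coefficients of the density `D` are continuous. -/
def ContinuousDensity (D : M → M → ℝ) : Prop :=
  ∀ c, ContinuousOn (D c) (chartAt H c).source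

variable {D D' : M → M → ℝ}

theorem ContinuousDensity.continuousOn_integrand (hD : ContinuousDensity H D) (c : M) :
    ContinuousOn (densityIntegrand I D c) (extChartAt I c).target :=
  (continuousOn_chartPartition_symm c).mul ((hD c).comp (continuousOn_extChartAt_symm c)
    fun _ hy => symm_mem_source hy)

theorem ContinuousDensity.integrableOn (hD : ContinuousDensity H D) (c : M) :
    IntegrableOn (densityIntegrand I D c) (chartSupport I c) :=
  ((hD.continuousOn_integrand c).mono (chartSupport_subset c)).integrableOn_compact
    (isCompact_chartSupport c)

theorem ContinuousDensity.densityIntegrable (hD : ContinuousDensity H D) :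
    DensityIntegrable I D := fun c =>
  (hD.integrableOn c).of_forall_sdiff_eq_zero (measurableSet_extChartAt_target c) fun y hy => by
    rw [densityIntegrand, chartPartition_eq_zero hy.1 hy.2, zero_mul]

theorem densityIntegral_add (hD : ContinuousDensity H D) (hD' : ContinuousDensity H D') :
    densityIntegral I (fun c x => D c x + D' c x) = densityIntegral I D + densityIntegral I D' := by
  simp only [densityIntegral_eq_sum, ← Finset.sum_add_distrib]
  refine Finset.sum_congr rfl fun c _ => ?_
  rw [← integral_add (hD.integrableOn c) (hD'.integrableOn c)]
  simp only [densityIntegrand, mul_add]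

theorem densityIntegral_const_mul (r : ℝ) (D : M → M → ℝ) :
    densityIntegral I (fun c x => r * D c x) = r * densityIntegral I D := by
  simp only [densityIntegral_eq_sum, Finset.mul_sum]
  refine Finset.sum_congr rfl fun c _ => ?_
  rw [← integral_const_mul]
  simp only [densityIntegrand, mul_left_comm]

theorem densityIntegral_zero : densityIntegral I (fun _ _ : M => (0 : ℝ)) = 0 := by
  simp [densityIntegral, densityIntegrand]

theorem chartPartition_nonneg (c x : M) : 0 ≤ chartPartition I M c x :=
  (chartPartition I M).nonneg c x

theorem densityIntegral_nonneg (h : ∀ c, ∀ x ∈ (chartAt H c).source, 0 ≤ D c x) :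
    0 ≤ densityIntegral I D :=
  finsum_nonneg fun c => setIntegral_nonneg (measurableSet_extChartAt_target c) fun _ hy =>
    mul_nonneg (chartPartition_nonneg _ _) (h c _ (symm_mem_source hy))

/-- Some function of the partition is positive at `x₀`. In its chart the nonnegative continuous
integrand is positive near the image of `x₀`, on a set of positive measure. -/
theorem densityIntegral_pos (hD : ContinuousDensity H D)
    (h : ∀ c, ∀ x ∈ (chartAt H c).source, 0 ≤ D c x) {x₀ : M}
    (hx₀ : ∀ c, x₀ ∈ (chartAt H c).source → 0 < D c x₀) : 0 < densityIntegral I D := by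
  have hnn : ∀ c, ∀ y ∈ (extChartAt I c).target, 0 ≤ densityIntegrand I D c y := fun c y hy =>
    mul_nonneg (chartPartition_nonneg _ _) (h c _ (symm_mem_source hy))
  obtain ⟨c, hc⟩ : ∃ c, chartPartition I M c x₀ ≠ 0 := by
    by_contra hcon
    push Not at hcon
    have := (chartPartition I M).sum_eq_one (mem_univ x₀)
    simp [hcon] at this
  have hcs : x₀ ∈ (chartAt H c).source :=
    chartPartition_isSubordinate c (subset_tsupport _ hc)
  have hce : x₀ ∈ (extChartAt I c).source := by rwa [extChartAt_source]
  rw [densityIntegral_eq_sum]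
  refine Finset.sum_pos' (fun c _ => setIntegral_nonneg (isCompact_chartSupport c).measurableSet
    fun y hy => hnn c y (chartSupport_subset c hy)) ⟨c, ?_, ?_⟩
  · simp only [activeCharts, Finite.mem_toFinset, mem_ofPred_eq]
    exact ⟨x₀, hc⟩
  · rw [← integral_target_eq]
    have hint := hD.densityIntegrable (I := I) c
    rw [setIntegral_pos_iff_support_of_nonneg_ae
      ((ae_restrict_mem (measurableSet_extChartAt_target c)).mono fun y hy => hnn c y hy) hint]
    have hy₀ := (extChartAt I c).map_source hce
    have h0 : 0 < densityIntegrand I D c (extChartAt I c x₀) := by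
      rw [densityIntegrand, (extChartAt I c).left_inv hce]
      exact mul_pos ((chartPartition_nonneg _ _).lt_of_ne' hc) (hx₀ c hcs)
    have h1 : ∀ᶠ y in nhdsWithin (extChartAt I c x₀) (range I),
        0 < densityIntegrand I D c y ∧ y ∈ (extChartAt I c).target := by
      rw [← nhdsWithin_extChartAt_target_eq' hce]
      exact ((hD.continuousOn_integrand c _ hy₀).eventually (lt_mem_nhds h0)).and
        self_mem_nhdsWithin
    obtain ⟨O, hO, hyO, hsub⟩ := mem_nhdsWithin.1 h1
    -- If `x₀` is a boundary point, its neighbourhood is only relatively open in the model range; it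
    -- still contains a nonempty open set because the range lies in the closure of its interior.
    have hne : (O ∩ interior (range I)).Nonempty := by
      have h2 : extChartAt I c x₀ ∈ closure (interior (range I)) :=
        I.range_subset_closure_interior (extChartAt_target_subset_range c hy₀)
      exact mem_closure_iff.1 h2 O hO hyO
    refine lt_of_lt_of_le ((hO.inter isOpen_interior).measure_pos volume hne)
      (measure_mono fun y hy => ?_)
    have h3 := hsub ⟨hy.1, interior_subset hy.2⟩
    exact ⟨h3.1.ne', h3.2⟩

theorem continuousOn_densityIntegral {P : Type*} [NormedAddCommGroup P] [ProperSpace P] {U : Set P}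
    (hU : IsOpen U) {D : P → M → M → ℝ}
    (hD : ∀ c, ContinuousOn (fun q : P × M => D q.1 c q.2) (U ×ˢ (chartAt H c).source)) :
    ContinuousOn (fun p => densityIntegral I (D p)) U := by
  simp only [densityIntegral_eq_sum]
  refine continuousOn_finsetSum _ fun c _ => ?_
  exact continuousOn_integral_of_compact hU (isCompact_chartSupport c)
    (isCompact_chartSupport c).measurableSet (isCompact_chartSupport c).measure_ne_top
    ((continuousOn_densityIntegrand (hD c)).mono (prod_mono_right (chartSupport_subset c)))

theorem hasDerivAt_densityIntegral {U : Set ℝ} (hU : IsOpen U) {D D' : ℝ → M → M → ℝ}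
    (hD : ∀ c, ContinuousOn (fun q : ℝ × M => D q.1 c q.2) (U ×ˢ (chartAt H c).source))
    (hD' : ∀ c, ContinuousOn (fun q : ℝ × M => D' q.1 c q.2) (U ×ˢ (chartAt H c).source))
    (hd : ∀ t ∈ U, ∀ c, ∀ x ∈ (chartAt H c).source, HasDerivAt (fun s => D s c x) (D' t c x) t)
    {t : ℝ} (ht : t ∈ U) :
    HasDerivAt (fun s => densityIntegral I (D s)) (densityIntegral I (D' t)) t := by
  simp only [densityIntegral_eq_sum]
  refine HasDerivAt.fun_sum fun c _ => ?_
  exact hasDerivAt_integral_of_compact hU (isCompact_chartSupport c)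
    (isCompact_chartSupport c).measurableSet (isCompact_chartSupport c).measure_ne_top
    ((continuousOn_densityIntegrand (hD c)).mono (prod_mono_right (chartSupport_subset c)))
    ((continuousOn_densityIntegrand (hD' c)).mono (prod_mono_right (chartSupport_subset c)))
    (fun s hs y hy => (hd s hs c _ (symm_mem_source (chartSupport_subset c hy))).const_mul _) ht

end Densities

/-! ### Continuous families of one-forms -/

section Families

attribute [local instance] Matrix.normedAddCommGroup Matrix.normedSpace

variable {m n : ℕ}

theorem Full.continuousAt_matMetric {a : Matrix (Fin n) (Fin m) ℝ} (ha : Full a)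
    (u v : Matrix (Fin n) (Fin m) ℝ) :
    ContinuousAt (fun q : Matrix (Fin n) (Fin m) ℝ × Matrix (Fin n) (Fin m) ℝ ×
      Matrix (Fin n) (Fin m) ℝ => matMetric q.1 q.2.1 q.2.2) (a, u, v) :=
  (ContDiffAt.matMetric (k := 0) (A := fun q : Matrix (Fin n) (Fin m) ℝ ×
    Matrix (Fin n) (Fin m) ℝ × Matrix (Fin n) (Fin m) ℝ => q.1) (x := (a, u, v))
    contDiffAt_fst contDiffAt_snd.fst contDiffAt_snd.snd ha).continuousAt

theorem Full.continuousAt_metricDeriv {a : Matrix (Fin n) (Fin m) ℝ} (ha : Full a)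
    (w u v : Matrix (Fin n) (Fin m) ℝ) :
    ContinuousAt (fun q : Matrix (Fin n) (Fin m) ℝ × Matrix (Fin n) (Fin m) ℝ ×
      Matrix (Fin n) (Fin m) ℝ × Matrix (Fin n) (Fin m) ℝ =>
        metricDeriv q.1 q.2.1 q.2.2.1 q.2.2.2) (a, w, u, v) :=
  (ContDiffAt.metricDeriv (k := 0) (A := fun q : Matrix (Fin n) (Fin m) ℝ ×
    Matrix (Fin n) (Fin m) ℝ × Matrix (Fin n) (Fin m) ℝ × Matrix (Fin n) (Fin m) ℝ => q.1)
    (x := (a, w, u, v)) contDiffAt_fst contDiffAt_snd.fst contDiffAt_snd.snd.fst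
    contDiffAt_snd.snd.snd ha).continuousAt

/-- The explicit formula is smooth at full rank matrices and agrees with the curvature nearby, since
full rank is an open condition. -/
theorem Full.continuousAt_sectional {a : Matrix (Fin n) (Fin m) ℝ} (ha : Full a)
    (u v : Matrix (Fin n) (Fin m) ℝ) :
    ContinuousAt (fun q : Matrix (Fin n) (Fin m) ℝ × Matrix (Fin n) (Fin m) ℝ ×
      Matrix (Fin n) (Fin m) ℝ => sectional univ matMetric q.1 q.2.1 q.2.2) (a, u, v) := by
  have h : ContinuousAt (fun q : Matrix (Fin n) (Fin m) ℝ × Matrix (Fin n) (Fin m) ℝ ×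
      Matrix (Fin n) (Fin m) ℝ => matSectional q.1 q.2.1 q.2.2) (a, u, v) :=
    (ContDiffAt.matSectional (k := 0) (A := fun q : Matrix (Fin n) (Fin m) ℝ ×
      Matrix (Fin n) (Fin m) ℝ × Matrix (Fin n) (Fin m) ℝ => q.1) (x := (a, u, v))
      contDiffAt_fst contDiffAt_snd.fst contDiffAt_snd.snd ha).continuousAt
  refine h.congr ?_
  have hopen : IsOpen {q : Matrix (Fin n) (Fin m) ℝ × Matrix (Fin n) (Fin m) ℝ ×
      Matrix (Fin n) (Fin m) ℝ | Full q.1} := isOpen_full.preimage continuous_fst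
  filter_upwards [hopen.mem_nhds ha] with q hq
  exact (Full.sectional_eq hq _ _).symm

variable {H : Type*} [TopologicalSpace H]
  {I : ModelWithCorners ℝ (EuclideanSpace ℝ (Fin m)) H}
  {M : Type*} [TopologicalSpace M] [ChartedSpace H M] [IsManifold I ∞ M]

theorem full_chartMatrix {P : Type*} {U : Set P} {β : P → RawForm I M n}
    (hinj : ∀ p ∈ U, ∀ x, Function.Injective (β p x)) {p : P} (hp : p ∈ U) {c x : M}
    (hx : x ∈ (chartAt H c).source) : Full (chartMatrix I c x (β p x)) := by
  rw [chartMatrix_eq c x hx, full_frameMatrix_iff]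
  exact hinj p hp x

variable {P : Type*} [TopologicalSpace P] {U : Set P}

/-- The family `β` of one-forms is continuous in the parameter and the point jointly. -/
def IsContFamilyOn (U : Set P) (β : P → RawForm I M n) : Prop :=
  ∀ c, ContinuousOn (fun q : P × M => chartMatrix I c q.2 (β q.1 q.2)) (U ×ˢ (chartAt H c).source)

theorem IsSmoothPathOn.isContFamilyOn {J : Set ℝ} (hJ : IsOpen J) {β : ℝ → RawForm I M n}
    (h : IsSmoothPathOn I J β) : IsContFamilyOn J β := fun c q hq =>
  ((isSmoothPathOn_iff hJ).1 h q.1 hq.1 c q.2 hq.2).continuousAt.continuousWithinAt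

namespace IsContFamilyOn

variable {β γ δ ε : P → RawForm I M n}

theorem mono {U' : Set P} (h : IsContFamilyOn U β) (hU : U' ⊆ U) : IsContFamilyOn U' β :=
  fun c => (h c).mono (prod_mono_left hU)

theorem comp {P' : Type*} [TopologicalSpace P'] {U' : Set P'} {f : P' → P}
    (h : IsContFamilyOn U β) (hf : ContinuousOn f U') (hU : MapsTo f U' U) :
    IsContFamilyOn U' fun p => β (f p) := fun c => by
  have h1 : ContinuousOn (fun q : P' × M => (f q.1, q.2)) (U' ×ˢ (chartAt H c).source) :=
    (hf.comp continuousOn_fst fun _ hq => hq.1).prodMk continuousOn_snd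
  exact ContinuousOn.comp (g := fun q : P × M => chartMatrix I c q.2 (β q.1 q.2)) (h c) h1 fun q hq => ⟨hU hq.1, hq.2⟩

theorem add (h : IsContFamilyOn U β) (h' : IsContFamilyOn U γ) :
    IsContFamilyOn U fun p => β p + γ p := fun c => by
  refine ((h c).add (h' c)).congr fun q _ => ?_
  exact frameMatrix_add _ _ _

theorem smul {r : P → ℝ} (hr : ContinuousOn r U) (h : IsContFamilyOn U β) :
    IsContFamilyOn U fun p => r p • β p := fun c => by
  refine ((hr.comp (f := Prod.fst) continuousOn_fst fun _ hq => hq.1).smul (h c)).congr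
    fun q _ => ?_
  exact frameMatrix_smul _ _ _

theorem continuousOn_matMetric (h : IsContFamilyOn U β)
    (hinj : ∀ p ∈ U, ∀ x, Function.Injective (β p x))
    (hγ : IsContFamilyOn U γ) (hδ : IsContFamilyOn U δ) (c : M) :
    ContinuousOn (fun q : P × M => matMetric (chartMatrix I c q.2 (β q.1 q.2))
      (chartMatrix I c q.2 (γ q.1 q.2)) (chartMatrix I c q.2 (δ q.1 q.2)))
      (U ×ˢ (chartAt H c).source) := fun q hq =>
  ((full_chartMatrix hinj hq.1 hq.2).continuousAt_matMetric _ _).comp_continuousWithinAt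
    (f := fun q : P × M => (chartMatrix I c q.2 (β q.1 q.2),
      chartMatrix I c q.2 (γ q.1 q.2), chartMatrix I c q.2 (δ q.1 q.2)))
    ((h c q hq).prodMk ((hγ c q hq).prodMk (hδ c q hq)))

theorem continuousOn_sectional (h : IsContFamilyOn U β)
    (hinj : ∀ p ∈ U, ∀ x, Function.Injective (β p x))
    (hγ : IsContFamilyOn U γ) (hδ : IsContFamilyOn U δ) (c : M) :
    ContinuousOn (fun q : P × M => sectional univ matMetric (chartMatrix I c q.2 (β q.1 q.2))
      (chartMatrix I c q.2 (γ q.1 q.2)) (chartMatrix I c q.2 (δ q.1 q.2)))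
      (U ×ˢ (chartAt H c).source) := fun q hq =>
  ((full_chartMatrix hinj hq.1 hq.2).continuousAt_sectional _ _).comp_continuousWithinAt
    (f := fun q : P × M => (chartMatrix I c q.2 (β q.1 q.2),
      chartMatrix I c q.2 (γ q.1 q.2), chartMatrix I c q.2 (δ q.1 q.2)))
    ((h c q hq).prodMk ((hγ c q hq).prodMk (hδ c q hq)))

theorem continuousOn_metricDeriv (h : IsContFamilyOn U β)
    (hinj : ∀ p ∈ U, ∀ x, Function.Injective (β p x)) (hε : IsContFamilyOn U ε)
    (hγ : IsContFamilyOn U γ) (hδ : IsContFamilyOn U δ) (c : M) :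
    ContinuousOn (fun q : P × M => metricDeriv (chartMatrix I c q.2 (β q.1 q.2))
      (chartMatrix I c q.2 (ε q.1 q.2)) (chartMatrix I c q.2 (γ q.1 q.2))
      (chartMatrix I c q.2 (δ q.1 q.2))) (U ×ˢ (chartAt H c).source) := fun q hq =>
  ((full_chartMatrix hinj hq.1 hq.2).continuousAt_metricDeriv _ _ _).comp_continuousWithinAt
    (f := fun q : P × M => (chartMatrix I c q.2 (β q.1 q.2), chartMatrix I c q.2 (ε q.1 q.2),
      chartMatrix I c q.2 (γ q.1 q.2), chartMatrix I c q.2 (δ q.1 q.2)))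
    ((h c q hq).prodMk ((hε c q hq).prodMk ((hγ c q hq).prodMk (hδ c q hq))))

/-- Injectivity at a point is the open condition of full rank in a chart; the tube lemma over the
compact `M` makes it open in the parameter uniformly in `x`. -/
theorem isOpen_injective [CompactSpace M] (hU : IsOpen U) (h : IsContFamilyOn U β) :
    IsOpen {p | p ∈ U ∧ ∀ x, Function.Injective (β p x)} := by
  have h1 : IsOpen {q : P × M | q.1 ∈ U ∧ Function.Injective (β q.1 q.2)} := by
    refine isOpen_iff_mem_nhds.2 fun q hq => ?_
    have hx := mem_chart_source H q.2
    have hS : U ×ˢ (chartAt H q.2).source ∈ nhds q :=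
      (hU.prod (chartAt H q.2).open_source).mem_nhds ⟨hq.1, hx⟩
    have hf : Full (chartMatrix I q.2 q.2 (β q.1 q.2)) := by
      rw [chartMatrix_eq q.2 q.2 hx, full_frameMatrix_iff]
      exact hq.2
    have hc := ((h q.2).continuousAt hS).eventually (isOpen_full.mem_nhds hf)
    filter_upwards [hS, hc] with r hr hr'
    have hr2 : Full (chartMatrix I q.2 r.2 (β r.1 r.2)) := hr'
    rw [chartMatrix_eq q.2 r.2 hr.2, full_frameMatrix_iff] at hr2
    exact ⟨hr.1, hr2⟩
  refine isOpen_iff_mem_nhds.2 fun p hp => ?_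
  obtain ⟨V, W, hV, -, hpV, hW, hVW⟩ := generalized_tube_lemma (isCompact_singleton (x := p))
    (isCompact_univ (X := M)) h1 (by
      rintro ⟨p', x⟩ ⟨rfl, -⟩
      exact ⟨hp.1, hp.2 x⟩)
  filter_upwards [hV.mem_nhds (hpV rfl), hU.mem_nhds hp.1] with p' hp' hpU
  have h2 : ∀ x, (p', x) ∈ {q : P × M | q.1 ∈ U ∧ Function.Injective (β q.1 q.2)} :=
    fun x => hVW ⟨hp', hW (mem_univ x)⟩
  exact ⟨hpU, fun x => (h2 x).2⟩

end IsContFamilyOn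

end Families

/-! ### The Levi-Civita connection of the generalized Ebin metric -/

section FormConnection

attribute [local instance] Matrix.normedAddCommGroup Matrix.normedSpace

variable {m n : ℕ} {H : Type*} [TopologicalSpace H]
  {I : ModelWithCorners ℝ (EuclideanSpace ℝ (Fin m)) H}
  {M : Type*} [TopologicalSpace M] [ChartedSpace H M]

theorem zero_smul_form (ζ : RawForm I M n) : (0 : ℝ) • ζ = 0 :=
  funext fun _ => ContinuousLinearMap.ext fun _ => zero_smul ℝ _

theorem deriv_const_form (ζ : RawForm I M n) (t : ℝ) : deriv (fun _ : ℝ => ζ) t = 0 :=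
  hasDerivAt_deriv_form (hasDerivAt_form_iff.2 fun x b => by
    have := hasDerivAt_const (F := Fin n → Fin m → ℝ) t
      (fun i j => frameMatrix I b (ζ x) i j)
    have h0 : frameMatrix I b ((0 : RawForm I M n) x) = 0 := frameMatrix_zero _
    rw [h0]
    exact this)

theorem deriv_line (α w : RawForm I M n) (t : ℝ) : deriv (fun s : ℝ => α + s • w) t = w :=
  hasDerivAt_deriv_form (hasDerivAt_form_iff.2 fun x b => by
    have h := ((hasDerivAt_id t).smul_const (fun i j => frameMatrix I b (w x) i j)).const_add
      (fun i j => frameMatrix I b (α x) i j)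
    simp only [one_smul] at h
    refine HasDerivAt.congr_of_eventuallyEq (F := Fin n → Fin m → ℝ) h
      (Filter.Eventually.of_forall fun s => ?_)
    exact (frameMatrix_add _ _ _).trans (congrArg _ (frameMatrix_smul _ _ _)))

theorem matMetric_zero_left (a v : Matrix (Fin n) (Fin m) ℝ) : matMetric a 0 v = 0 := by
  simp [matMetric]

theorem matMetric_zero_right (a v : Matrix (Fin n) (Fin m) ℝ) : matMetric a v 0 = 0 := by
  simp [matMetric]

variable [IsManifold I ∞ M]

theorem Omega.add {ζ η : RawForm I M n} (hζ : ζ ∈ Omega I M n) (hη : η ∈ Omega I M n) :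
    ζ + η ∈ Omega I M n :=
  mem_omega_iff.2 <| isSmoothPathOn_of_op isOpen_univ (mem_omega_iff.1 hζ) (mem_omega_iff.1 hη)
    (mem_omega_iff.1 hη) (fun _ a u _ => a + u) (fun _ _ _ _ => frameMatrix_add _ _ _)
    fun _ _ _ _ => contDiffAt_snd.fst.add contDiffAt_snd.snd.fst

theorem Omega.const_smul {ζ : RawForm I M n} (hζ : ζ ∈ Omega I M n) (r : ℝ) :
    r • ζ ∈ Omega I M n :=
  mem_omega_iff.2 <| isSmoothPathOn_of_op isOpen_univ (mem_omega_iff.1 hζ) (mem_omega_iff.1 hζ)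
    (mem_omega_iff.1 hζ) (fun _ a _ _ => r • a) (fun _ _ _ _ => frameMatrix_smul _ _ _)
    fun _ _ _ _ => contDiffAt_snd.fst.const_smul r

theorem Omega.sub {ζ η : RawForm I M n} (hζ : ζ ∈ Omega I M n) (hη : η ∈ Omega I M n) :
    ζ - η ∈ Omega I M n :=
  mem_omega_iff.2 <| isSmoothPathOn_of_op isOpen_univ (mem_omega_iff.1 hζ) (mem_omega_iff.1 hη)
    (mem_omega_iff.1 hη) (fun _ a u _ => a - u) (fun _ _ _ _ => frameMatrix_sub _ _ _)
    fun _ _ _ _ => contDiffAt_snd.fst.sub contDiffAt_snd.snd.fst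

theorem isContFamilyOn_const {P : Type*} [TopologicalSpace P] {ζ : RawForm I M n}
    (hζ : ζ ∈ Omega I M n) (U : Set P) : IsContFamilyOn U fun _ => ζ :=
  ((mem_omega_iff.1 hζ).isContFamilyOn isOpen_univ).comp (f := fun _ : P => (0 : ℝ))
    continuousOn_const fun _ _ => mem_univ _

/-- The line `t ↦ α + t w` is a smooth path. -/
theorem isSmoothPathOn_line {α w : RawForm I M n} (hα : α ∈ Omega I M n) (hw : w ∈ Omega I M n) :
    IsSmoothPathOn I univ fun t : ℝ => α + t • w :=
  isSmoothPathOn_of_op isOpen_univ (mem_omega_iff.1 hα) (mem_omega_iff.1 hw)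
    (mem_omega_iff.1 hw) (fun t a u _ => a + t • u)
    (fun _ _ _ _ => by simp [frameMatrix_add, frameMatrix_smul])
    fun _ _ _ _ => contDiffAt_snd.fst.add (contDiffAt_fst.smul contDiffAt_snd.snd.fst)

theorem OmegaPlus.full {α : RawForm I M n} (hα : α ∈ OmegaPlus I M n) {c x : M}
    (hx : x ∈ (chartAt H c).source) : Full (chartMatrix I c x (α x)) := by
  rw [chartMatrix_eq c x hx, full_frameMatrix_iff]
  exact hα.2 x

theorem isOpen_line [CompactSpace M] {α w : RawForm I M n} (hα : α ∈ OmegaPlus I M n)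
    (hw : w ∈ Omega I M n) :
    ∃ J : Set ℝ, IsOpen J ∧ (0 : ℝ) ∈ J ∧ ∀ t ∈ J, α + t • w ∈ OmegaPlus I M n := by
  have h := (isSmoothPathOn_line hα.1 hw).isContFamilyOn isOpen_univ
  refine ⟨_, h.isOpen_injective isOpen_univ, ⟨mem_univ _, by simpa using hα.2⟩, fun t ht =>
    ⟨(isSmoothPathOn_line hα.1 hw).mem_omega (mem_univ t), ht.2⟩⟩

/-- The pointwise Christoffel symbol of one-forms. -/
theorem exists_formChristoffel (α ζ η : RawForm I M n) :
    ∃ β : RawForm I M n, ∀ x (b : Module.Basis (Fin m) ℝ (TangentSpace I x)),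
      frameMatrix I b (β x) = matChristoffel (frameMatrix I b (α x)) (frameMatrix I b (ζ x))
        (frameMatrix I b (η x)) :=
  exists_form _ fun x b b' => by
    rw [frameMatrix_change b b' (α x), frameMatrix_change b b' (ζ x), frameMatrix_change b b' (η x),
      matChristoffel_mul _ _ _ (det_toMatrix_ne_zero b b')]

/-- The pointwise Christoffel symbol of one-forms. -/
def formChristoffel (α ζ η : RawForm I M n) : RawForm I M n :=
  Classical.choose (exists_formChristoffel α ζ η)

theorem frameMatrix_formChristoffel (α ζ η : RawForm I M n) (x : M)
    (b : Module.Basis (Fin m) ℝ (TangentSpace I x)) :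
    frameMatrix I b (formChristoffel α ζ η x) =
      matChristoffel (frameMatrix I b (α x)) (frameMatrix I b (ζ x)) (frameMatrix I b (η x)) :=
  Classical.choose_spec (exists_formChristoffel α ζ η) x b

theorem chartMatrix_formChristoffel (α ζ η : RawForm I M n) {c x : M}
    (hx : x ∈ (chartAt H c).source) :
    chartMatrix I c x (formChristoffel α ζ η x) =
      matChristoffel (chartMatrix I c x (α x)) (chartMatrix I c x (ζ x))
        (chartMatrix I c x (η x)) := by
  simp only [chartMatrix_eq c x hx, frameMatrix_formChristoffel]

theorem isSmoothPathOn_formChristoffel {J : Set ℝ} (hJ : IsOpen J) {α ζ η : ℝ → RawForm I M n}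
    (hα : IsOmegaPlusPathOn I J α) (hζ : IsSmoothPathOn I J ζ) (hη : IsSmoothPathOn I J η) :
    IsSmoothPathOn I J fun t => formChristoffel (α t) (ζ t) (η t) :=
  isSmoothPathOn_of_op hJ hα.1 hζ hη (fun _ a u v => matChristoffel a u v)
    (fun _ _ _ _ => frameMatrix_formChristoffel _ _ _ _ _)
    fun t ht x b => ContDiffAt.matChristoffel contDiffAt_snd.fst contDiffAt_snd.snd.fst
      contDiffAt_snd.snd.snd ((full_frameMatrix_iff b _).2 ((hα.2 t ht).2 x))

theorem formChristoffel_mem {α ζ η : RawForm I M n} (hα : α ∈ OmegaPlus I M n)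
    (hζ : ζ ∈ Omega I M n) (hη : η ∈ Omega I M n) : formChristoffel α ζ η ∈ Omega I M n :=
  mem_omega_iff.2 <| isSmoothPathOn_formChristoffel isOpen_univ
    ⟨mem_omega_iff.1 hα.1, fun _ _ => hα⟩ (mem_omega_iff.1 hζ) (mem_omega_iff.1 hη)

theorem continuousDensity_matMetric {α ζ η : RawForm I M n} (hα : α ∈ OmegaPlus I M n)
    (hζ : ζ ∈ Omega I M n) (hη : η ∈ Omega I M n) :
    ContinuousDensity H fun c x => matMetric (chartMatrix I c x (α x)) (chartMatrix I c x (ζ x))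
      (chartMatrix I c x (η x)) := fun c =>
  ((isContFamilyOn_const hα.1 univ).continuousOn_matMetric (fun _ _ => hα.2)
    (isContFamilyOn_const hζ univ) (isContFamilyOn_const hη univ) c).comp
    (f := fun x : M => ((0 : ℝ), x)) (by fun_prop) fun _ hx => ⟨mem_univ _, hx⟩

theorem continuousDensity_metricDeriv {α w ζ η : RawForm I M n} (hα : α ∈ OmegaPlus I M n)
    (hw : w ∈ Omega I M n) (hζ : ζ ∈ Omega I M n) (hη : η ∈ Omega I M n) :
    ContinuousDensity H fun c x => metricDeriv (chartMatrix I c x (α x)) (chartMatrix I c x (w x))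
      (chartMatrix I c x (ζ x)) (chartMatrix I c x (η x)) := fun c =>
  ((isContFamilyOn_const hα.1 univ).continuousOn_metricDeriv (fun _ _ => hα.2)
    (isContFamilyOn_const hw univ) (isContFamilyOn_const hζ univ)
    (isContFamilyOn_const hη univ) c).comp
    (f := fun x : M => ((0 : ℝ), x)) (by fun_prop) fun _ hx => ⟨mem_univ _, hx⟩

theorem continuousDensity_sectional {α ζ η : RawForm I M n} (hα : α ∈ OmegaPlus I M n)
    (hζ : ζ ∈ Omega I M n) (hη : η ∈ Omega I M n) :
    ContinuousDensity H fun c x => sectional univ matMetric (chartMatrix I c x (α x))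
      (chartMatrix I c x (ζ x)) (chartMatrix I c x (η x)) := fun c =>
  ((isContFamilyOn_const hα.1 univ).continuousOn_sectional (fun _ _ => hα.2)
    (isContFamilyOn_const hζ univ) (isContFamilyOn_const hη univ) c).comp
    (f := fun x : M => ((0 : ℝ), x)) (by fun_prop) fun _ hx => ⟨mem_univ _, hx⟩

variable [CompactSpace M] [T2Space M]

theorem formMetric_add_left {α ζ ζ' η : RawForm I M n} (hα : α ∈ OmegaPlus I M n)
    (hζ : ζ ∈ Omega I M n) (hζ' : ζ' ∈ Omega I M n) (hη : η ∈ Omega I M n) :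
    formMetric I α (ζ + ζ') η = formMetric I α ζ η + formMetric I α ζ' η := by
  unfold formMetric
  rw [← densityIntegral_add (continuousDensity_matMetric hα hζ hη)
    (continuousDensity_matMetric hα hζ' hη)]
  refine densityIntegral_congr fun c x _ => ?_
  rw [← matMetric_add_left]
  exact congrArg (fun u => matMetric _ u _) (frameMatrix_add _ _ _)

theorem formMetric_smul_left (α ζ η : RawForm I M n) (r : ℝ) :
    formMetric I α (r • ζ) η = r * formMetric I α ζ η := by
  unfold formMetric
  rw [← densityIntegral_const_mul]
  refine densityIntegral_congr fun c x _ => ?_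
  rw [← matMetric_smul_left]
  exact congrArg (fun u => matMetric _ u _) (frameMatrix_smul _ _ _)

theorem formMetric_comm (α ζ η : RawForm I M n) : formMetric I α ζ η = formMetric I α η ζ := by
  simp only [formMetric, matMetric_comm]

theorem formMetric_smul_right (α ζ η : RawForm I M n) (r : ℝ) :
    formMetric I α ζ (r • η) = r * formMetric I α ζ η := by
  rw [formMetric_comm, formMetric_smul_left, formMetric_comm]

theorem formMetric_self_pos {α ζ : RawForm I M n} (hα : α ∈ OmegaPlus I M n)
    (hζ : ζ ∈ Omega I M n) (h0 : ζ ≠ 0) : 0 < formMetric I α ζ ζ := by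
  obtain ⟨x, hx⟩ := Function.ne_iff.1 h0
  refine densityIntegral_pos (continuousDensity_matMetric hα hζ hζ)
    (fun c x hx => (OmegaPlus.full hα hx).matMetric_self_nonneg _) (x₀ := x) fun c hc => ?_
  refine ((OmegaPlus.full hα hc).matMetric_self_nonneg _).lt_of_ne' fun h => hx ?_
  rw [(OmegaPlus.full hα hc).matMetric_self_eq_zero, chartMatrix_eq c x hc] at h
  exact frameMatrix_injective (chartBasis (I := I) c x hc) (h.trans (frameMatrix_zero _).symm)

/-- The derivative of `G_α(ζ, η)` along paths. -/
theorem hasDerivAt_formMetric {J : Set ℝ} (hJ : IsOpen J) {α ζ η : ℝ → RawForm I M n}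
    (hα : IsOmegaPlusPathOn I J α) (hζ : IsSmoothPathOn I J ζ) (hη : IsSmoothPathOn I J η)
    {t : ℝ} (ht : t ∈ J) :
    HasDerivAt (fun s => formMetric I (α s) (ζ s) (η s))
      (densityIntegral I fun c x =>
        metricDeriv (chartMatrix I c x (α t x)) (chartMatrix I c x (deriv α t x))
          (chartMatrix I c x (ζ t x)) (chartMatrix I c x (η t x)) +
        matMetric (chartMatrix I c x (α t x)) (chartMatrix I c x (deriv ζ t x))
          (chartMatrix I c x (η t x)) +
        matMetric (chartMatrix I c x (α t x)) (chartMatrix I c x (ζ t x))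
          (chartMatrix I c x (deriv η t x))) t := by
  have hinj : ∀ p ∈ J, ∀ x, Function.Injective (α p x) := fun p hp => (hα.2 p hp).2
  have cα := hα.1.isContFamilyOn hJ
  have cζ := hζ.isContFamilyOn hJ
  have cη := hη.isContFamilyOn hJ
  have cα' := (hα.1.deriv hJ).isContFamilyOn hJ
  have cζ' := (hζ.deriv hJ).isContFamilyOn hJ
  have cη' := (hη.deriv hJ).isContFamilyOn hJ
  refine hasDerivAt_densityIntegral hJ (D := fun s c x => matMetric (chartMatrix I c x (α s x))
      (chartMatrix I c x (ζ s x)) (chartMatrix I c x (η s x)))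
    (D' := fun t c x =>
        metricDeriv (chartMatrix I c x (α t x)) (chartMatrix I c x (deriv α t x))
          (chartMatrix I c x (ζ t x)) (chartMatrix I c x (η t x)) +
        matMetric (chartMatrix I c x (α t x)) (chartMatrix I c x (deriv ζ t x))
          (chartMatrix I c x (η t x)) +
        matMetric (chartMatrix I c x (α t x)) (chartMatrix I c x (ζ t x))
          (chartMatrix I c x (deriv η t x)))
    (fun c => cα.continuousOn_matMetric hinj cζ cη c)
    (fun c => ((cα.continuousOn_metricDeriv hinj cα' cζ cη c).add
      (cα.continuousOn_matMetric hinj cζ' cη c)).add (cα.continuousOn_matMetric hinj cζ cη' c))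
    (fun s hs c x hx => ?_) ht
  have h1 := hα.1.hasDerivAt_frameMatrix hJ hs x (chartBasis c x hx)
  have h2 := hζ.hasDerivAt_frameMatrix hJ hs x (chartBasis c x hx)
  have h3 := hη.hasDerivAt_frameMatrix hJ hs x (chartBasis c x hx)
  simp only [chartMatrix_eq c x hx]
  exact Full.hasDerivAt_matMetric ((full_frameMatrix_iff _ _).2 (hinj s hs x)) h1 h2 h3

theorem hasDerivAt_formMetric_line {α w ζ η : RawForm I M n} (hα : α ∈ OmegaPlus I M n)
    (hw : w ∈ Omega I M n) (hζ : ζ ∈ Omega I M n) (hη : η ∈ Omega I M n) :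
    HasDerivAt (fun t : ℝ => formMetric I (α + t • w) ζ η)
      (densityIntegral I fun c x =>
        metricDeriv (chartMatrix I c x (α x)) (chartMatrix I c x (w x))
          (chartMatrix I c x (ζ x)) (chartMatrix I c x (η x))) 0 := by
  obtain ⟨J, hJ, h0, hJα⟩ := isOpen_line hα hw
  have h := hasDerivAt_formMetric hJ ⟨(isSmoothPathOn_line hα.1 hw).mono (subset_univ J), hJα⟩
    (isSmoothPathOn_const hζ J) (isSmoothPathOn_const hη J) h0
  convert h using 1
  refine densityIntegral_congr fun c x hx => ?_
  have hz : chartMatrix I c x ((0 : RawForm I M n) x) = 0 := frameMatrix_zero _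
  have h0 : chartMatrix I c x ((α + (0 : ℝ) • w) x) = chartMatrix I c x (α x) :=
    (frameMatrix_add _ (α x) ((0 : ℝ) • w x)).trans (by
      rw [frameMatrix_smul, zero_smul, add_zero]; rfl)
  rw [deriv_line, deriv_const_form, deriv_const_form, hz, matMetric_zero_left,
    matMetric_zero_right, h0, add_zero, add_zero]

/-- Differentiating under the integral gives the integrals of the pointwise derivatives, so this is
the integral of `Full.koszul` over `M`. -/
theorem isChristoffelAt_form {α ζ η : RawForm I M n} (hα : α ∈ OmegaPlus I M n)
    (hζ : ζ ∈ Omega I M n) (hη : η ∈ Omega I M n) :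
    IsChristoffelAt (Omega I M n) (formMetric I) α ζ η (formChristoffel α ζ η) := by
  refine ⟨formChristoffel_mem hα hζ hη, fun w hw => ?_⟩
  have h1 := hasDerivAt_formMetric_line hα hw hζ hη
  have h2 := hasDerivAt_formMetric_line hα hζ hη hw
  have h3 := hasDerivAt_formMetric_line hα hη hζ hw
  refine ⟨h1.differentiableAt, h2.differentiableAt, h3.differentiableAt, ?_⟩
  rw [h1.deriv, h2.deriv, h3.deriv, sub_eq_add_neg, sub_eq_add_neg, ← neg_one_mul,
    ← neg_one_mul (densityIntegral I _), ← densityIntegral_const_mul (-1),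
    ← densityIntegral_const_mul (-1), ← densityIntegral_add, ← densityIntegral_add, formMetric,
    ← densityIntegral_const_mul]
  · refine densityIntegral_congr fun c x hx => ?_
    rw [chartMatrix_formChristoffel _ _ _ hx, (OmegaPlus.full hα hx).koszul]
    ring
  · exact fun c => (continuousDensity_metricDeriv hα hw hζ hη c).add
      (continuousOn_const.mul (continuousDensity_metricDeriv hα hζ hη hw c))
  · exact fun c => continuousOn_const.mul (continuousDensity_metricDeriv hα hη hζ hw c)
  · exact continuousDensity_metricDeriv hα hw hζ hη
  · exact fun c => continuousOn_const.mul (continuousDensity_metricDeriv hα hζ hη hw c)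

/-- Both candidates are smooth, so their difference is an admissible test direction, and `G` is
positive on it unless it vanishes. -/
theorem isChristoffelAt_form_unique {α ζ η β β' : RawForm I M n} (hα : α ∈ OmegaPlus I M n)
    (h : IsChristoffelAt (Omega I M n) (formMetric I) α ζ η β)
    (h' : IsChristoffelAt (Omega I M n) (formMetric I) α ζ η β') : β = β' := by
  by_contra hne
  have hd0 : β - β' ≠ 0 := fun h => hne (funext fun x => sub_eq_zero.1 (congrFun h x))
  have hd := Omega.sub h.1 h'.1
  have hpos := formMetric_self_pos hα hd hd0
  have h1 := (h.2 _ hd).2.2.2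
  rw [← (h'.2 _ hd).2.2.2] at h1
  have h3 := formMetric_add_left hα h'.1 hd hd
  have h2 : β' + (β - β') = β := funext fun x => add_sub_cancel (β' x) (β x)
  rw [h2] at h3
  linarith

theorem christoffel_form_eq {α ζ η : RawForm I M n} (hα : α ∈ OmegaPlus I M n)
    (hζ : ζ ∈ Omega I M n) (hη : η ∈ Omega I M n) :
    christoffel (Omega I M n) (formMetric I) α ζ η = formChristoffel α ζ η :=
  isChristoffelAt_form_unique hα
    (Classical.epsilon_spec (p := IsChristoffelAt (Omega I M n) (formMetric I) α ζ η)
      ⟨_, isChristoffelAt_form hα hζ hη⟩) (isChristoffelAt_form hα hζ hη)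

end FormConnection

/-! ### Geodesics of the generalized Ebin metric -/

section Geodesics

attribute [local instance] Matrix.normedAddCommGroup Matrix.normedSpace

variable {m n : ℕ} {H : Type*} [TopologicalSpace H]
  {I : ModelWithCorners ℝ (EuclideanSpace ℝ (Fin m)) H}
  {M : Type*} [TopologicalSpace M] [ChartedSpace H M] [IsManifold I ∞ M]
  {J : Set ℝ} {α δ : ℝ → RawForm I M n}

theorem matMetric_sub_left (a u u' v : Matrix (Fin n) (Fin m) ℝ) :
    matMetric a (u - u') v = matMetric a u v - matMetric a u' v := by
  rw [sub_eq_add_neg, matMetric_add_left, ← neg_one_smul ℝ u', matMetric_smul_left]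
  ring

/-- The defect of the geodesic equation, `α_tt - Γ_α(α_t, α_t)`. -/
def geodesicDefect (α : ℝ → RawForm I M n) (t : ℝ) : RawForm I M n :=
  deriv (deriv α) t - formChristoffel (α t) (deriv α t) (deriv α t)

theorem isSmoothPathOn_sub (hJ : IsOpen J) (hα : IsSmoothPathOn I J α)
    (hδ : IsSmoothPathOn I J δ) : IsSmoothPathOn I J fun t => α t - δ t :=
  isSmoothPathOn_of_op hJ hα hδ hδ (fun _ a u _ => a - u) (fun _ _ _ _ => frameMatrix_sub _ _ _)
    fun _ _ _ _ => contDiffAt_snd.fst.sub contDiffAt_snd.snd.fst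

theorem isSmoothPathOn_smul (hJ : IsOpen J) {χ : ℝ → ℝ} (hχ : ContDiff ℝ ∞ χ)
    (hα : IsSmoothPathOn I J α) : IsSmoothPathOn I J fun t => χ t • α t :=
  isSmoothPathOn_of_op hJ hα hα hα (fun t a _ _ => χ t • a) (fun _ _ _ _ => frameMatrix_smul _ _ _)
    fun _ _ _ _ => (hχ.contDiffAt.comp _ contDiffAt_fst).smul contDiffAt_snd.fst

theorem IsSmoothPathOn.union {J' : Set ℝ} (hJ : IsOpen J) (hJ' : IsOpen J')
    (h : IsSmoothPathOn I J α) (h' : IsSmoothPathOn I J' α) : IsSmoothPathOn I (J ∪ J') α := by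
  rw [isSmoothPathOn_iff hJ] at h
  rw [isSmoothPathOn_iff hJ'] at h'
  rw [isSmoothPathOn_iff (hJ.union hJ')]
  rintro t (ht | ht)
  exacts [h t ht, h' t ht]

theorem zero_mem_omega : (0 : RawForm I M n) ∈ Omega I M n :=
  mem_omega_iff.2 <| (isSmoothPathOn_iff isOpen_univ).2 fun t _ c x _ => by
    have h : (fun p : ℝ × M => fun i j => chartMatrix I c p.2 ((0 : RawForm I M n) p.2) i j) =
        fun _ => 0 := funext fun p => frameMatrix_zero (n := n) (chartFrame I c p.2)
    rw [SmoothMatAt, h]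
    exact contMDiffAt_const

theorem isSmoothPathOn_geodesicDefect (hJ : IsOpen J) (hα : IsOmegaPlusPathOn I J α) :
    IsSmoothPathOn I J (geodesicDefect α) :=
  isSmoothPathOn_sub hJ ((hα.1.deriv hJ).deriv hJ)
    (isSmoothPathOn_formChristoffel hJ hα (hα.1.deriv hJ) (hα.1.deriv hJ))

theorem deriv_variation (hJ : IsOpen J) (hα : IsSmoothPathOn I J α)
    (hδ : IsSmoothPathOn I univ δ) {t : ℝ} (ht : t ∈ J) (s : ℝ) :
    deriv (fun t => α t + s • δ t) t = deriv α t + s • deriv δ t :=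
  hasDerivAt_deriv_form <| hasDerivAt_form_iff.2 fun x b => by
    have h1 := hα.hasDerivAt_frameMatrix hJ ht x b
    have h2 := hδ.hasDerivAt_frameMatrix isOpen_univ (mem_univ t) x b
    have h3 := HasDerivAt.add (F := Fin n → Fin m → ℝ) h1
      (HasDerivAt.const_smul (F := Fin n → Fin m → ℝ) s h2)
    have e : frameMatrix I b ((deriv α t + s • deriv δ t) x) =
        frameMatrix I b (deriv α t x) + s • frameMatrix I b (deriv δ t x) :=
      (frameMatrix_add _ _ _).trans (congrArg _ (frameMatrix_smul _ _ _))
    rw [e]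
    refine HasDerivAt.congr_of_eventuallyEq (F := Fin n → Fin m → ℝ) h3
      (Filter.Eventually.of_forall fun r => ?_)
    exact (frameMatrix_add _ _ _).trans (congrArg _ (frameMatrix_smul _ _ _))

theorem isContFamilyOn_variation {α δ : ℝ → RawForm I M n} (hα : IsContFamilyOn J α)
    (hδ : IsContFamilyOn univ δ) :
    IsContFamilyOn ((univ : Set ℝ) ×ˢ J) fun p : ℝ × ℝ => α p.2 + p.1 • δ p.2 :=
  (hα.comp continuousOn_snd fun _ h => h.2).add
    ((hδ.comp continuousOn_snd fun _ _ => mem_univ _).smul continuousOn_fst)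

theorem chartMatrix_add (c x : M) (L L' : TangentSpace I x →L[ℝ] EuclideanSpace ℝ (Fin n)) :
    chartMatrix I c x (L + L') = chartMatrix I c x L + chartMatrix I c x L' :=
  frameMatrix_add _ _ _

theorem chartMatrix_sub (c x : M) (L L' : TangentSpace I x →L[ℝ] EuclideanSpace ℝ (Fin n)) :
    chartMatrix I c x (L - L') = chartMatrix I c x L - chartMatrix I c x L' :=
  frameMatrix_sub _ _ _

theorem chartMatrix_smul (c x : M) (r : ℝ)
    (L : TangentSpace I x →L[ℝ] EuclideanSpace ℝ (Fin n)) :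
    chartMatrix I c x (r • L) = r • chartMatrix I c x L :=
  frameMatrix_smul _ _ _

theorem geodesicDefect_eq_zero_iff {t : ℝ} : geodesicDefect α t = 0 ↔
    deriv (deriv α) t = formChristoffel (α t) (deriv α t) (deriv α t) :=
  ⟨fun h => funext fun x => sub_eq_zero.1 (congrFun h x), fun h => funext fun x =>
    sub_eq_zero.2 (congrFun h x)⟩

theorem deriv_deriv_frameMatrix (hJ : IsOpen J) (hα : IsSmoothPathOn I J α) {t : ℝ} (ht : t ∈ J)
    (x : M) (b : Module.Basis (Fin m) ℝ (TangentSpace I x)) :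
    deriv (deriv fun s => frameMatrix I b (α s x)) t = frameMatrix I b (deriv (deriv α) t x) := by
  rw [← deriv_frameMatrix hJ (hα.deriv hJ) ht x b]
  refine Filter.EventuallyEq.deriv_eq (F := Fin n → Fin m → ℝ) ?_
  filter_upwards [hJ.mem_nhds ht] with s hs
  exact deriv_frameMatrix hJ hα hs x b

variable [CompactSpace M] [T2Space M]

theorem formMetric_zero_left (α ζ : RawForm I M n) : formMetric I α 0 ζ = 0 := by
  have h := formMetric_smul_left (I := I) α 0 ζ 0
  rwa [zero_smul_form, zero_mul] at h

theorem formMetric_zero_right (α ζ : RawForm I M n) : formMetric I α ζ 0 = 0 := by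
  rw [formMetric_comm, formMetric_zero_left]

/-- The variation of the integrand of the energy. -/
def energyVariation (α δ : ℝ → RawForm I M n) (s t : ℝ) : ℝ :=
  densityIntegral I fun c x =>
    metricDeriv (chartMatrix I c x ((α t + s • δ t) x)) (chartMatrix I c x (δ t x))
      (chartMatrix I c x ((deriv α t + s • deriv δ t) x))
      (chartMatrix I c x ((deriv α t + s • deriv δ t) x)) +
    matMetric (chartMatrix I c x ((α t + s • δ t) x)) (chartMatrix I c x (deriv δ t x))
      (chartMatrix I c x ((deriv α t + s • deriv δ t) x)) +
    matMetric (chartMatrix I c x ((α t + s • δ t) x))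
      (chartMatrix I c x ((deriv α t + s • deriv δ t) x)) (chartMatrix I c x (deriv δ t x))

/-- Differentiation under the integrals over the time interval and over `M`. -/
theorem hasDerivAt_energy_variation (hJ : IsOpen J) (hα : IsOmegaPlusPathOn I J α)
    (hδ : IsSmoothPathOn I univ δ) {t₀ t₁ : ℝ} (h01 : t₀ < t₁) (hsub : Icc t₀ t₁ ⊆ J) :
    HasDerivAt (fun s : ℝ => energy (formMetric I) (fun t => α t + s • δ t) t₀ t₁)
      (∫ t in t₀..t₁, energyVariation α δ 0 t) 0 := by
  have cα := hα.1.isContFamilyOn hJ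
  have cδ := hδ.isContFamilyOn isOpen_univ
  have cα' := (hα.1.deriv hJ).isContFamilyOn hJ
  have cδ' := (hδ.deriv isOpen_univ).isContFamilyOn isOpen_univ
  have cγ := isContFamilyOn_variation cα cδ
  have cγ' := isContFamilyOn_variation cα' cδ'
  -- The varied path must remain injective for all small `s`, uniformly for `t` in the compact
  -- interval; the tube lemma supplies such a product neighbourhood.
  obtain ⟨S, T, hS, hT, h0S, hIT, hST⟩ := generalized_tube_lemma (isCompact_singleton (x := (0 : ℝ)))
    (isCompact_Icc (a := t₀) (b := t₁)) (cγ.isOpen_injective (isOpen_univ.prod hJ)) (by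
      rintro ⟨s, t⟩ ⟨rfl, ht⟩
      refine ⟨⟨mem_univ _, hsub ht⟩, ?_⟩
      simpa using (hα.2 t (hsub ht)).2)
  have hTJ : ∀ t ∈ T, t ∈ J := fun t ht => (hST ⟨h0S rfl, ht⟩ : ((0 : ℝ), t) ∈ _).1.2
  have hST' : S ×ˢ T ⊆ (univ : Set ℝ) ×ˢ J := fun p hp => ⟨mem_univ _, hTJ _ hp.2⟩
  have hinj : ∀ p ∈ S ×ˢ T, ∀ x, Function.Injective ((α p.2 + p.1 • δ p.2) x) :=
    fun p hp => (hST hp).2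
  replace cγ := cγ.mono hST'
  replace cγ' := cγ'.mono hST'
  have cδ₂ : IsContFamilyOn (S ×ˢ T) fun p : ℝ × ℝ => δ p.2 :=
    cδ.comp continuousOn_snd fun _ _ => mem_univ _
  have cδ₂' : IsContFamilyOn (S ×ˢ T) fun p : ℝ × ℝ => deriv δ p.2 :=
    cδ'.comp continuousOn_snd fun _ _ => mem_univ _
  have hF : ContinuousOn (Function.uncurry fun s t => formMetric I (α t + s • δ t)
      (deriv α t + s • deriv δ t) (deriv α t + s • deriv δ t)) (S ×ˢ T) :=
    continuousOn_densityIntegral (hS.prod hT) (D := fun (p : ℝ × ℝ) c x =>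
      matMetric (chartMatrix I c x ((α p.2 + p.1 • δ p.2) x))
        (chartMatrix I c x ((deriv α p.2 + p.1 • deriv δ p.2) x))
        (chartMatrix I c x ((deriv α p.2 + p.1 • deriv δ p.2) x)))
      fun c => cγ.continuousOn_matMetric hinj cγ' cγ' c
  have hF' : ContinuousOn (Function.uncurry (energyVariation α δ)) (S ×ˢ T) :=
    continuousOn_densityIntegral (hS.prod hT) (D := fun (p : ℝ × ℝ) c x =>
      metricDeriv (chartMatrix I c x ((α p.2 + p.1 • δ p.2) x)) (chartMatrix I c x (δ p.2 x))
        (chartMatrix I c x ((deriv α p.2 + p.1 • deriv δ p.2) x))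
        (chartMatrix I c x ((deriv α p.2 + p.1 • deriv δ p.2) x)) +
      matMetric (chartMatrix I c x ((α p.2 + p.1 • δ p.2) x)) (chartMatrix I c x (deriv δ p.2 x))
        (chartMatrix I c x ((deriv α p.2 + p.1 • deriv δ p.2) x)) +
      matMetric (chartMatrix I c x ((α p.2 + p.1 • δ p.2) x))
        (chartMatrix I c x ((deriv α p.2 + p.1 • deriv δ p.2) x)) (chartMatrix I c x (deriv δ p.2 x)))
      fun c => ((cγ.continuousOn_metricDeriv hinj cδ₂ cγ' cγ' c).add
        (cγ.continuousOn_matMetric hinj cδ₂' cγ' c)).add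
        (cγ.continuousOn_matMetric hinj cγ' cδ₂' c)
  have hd : ∀ s ∈ S, ∀ t ∈ Icc t₀ t₁, HasDerivAt (fun s => formMetric I (α t + s • δ t)
      (deriv α t + s • deriv δ t) (deriv α t + s • deriv δ t)) (energyVariation α δ s t) s := by
    intro s hs t ht
    have hαt := (hα.2 t (hsub ht)).1
    have hδt := hδ.mem_omega (mem_univ t)
    have l1 : IsSmoothPathOn I S fun s => α t + s • δ t :=
      (isSmoothPathOn_line hαt hδt).mono (subset_univ S)
    have l2 : IsSmoothPathOn I S fun s => deriv α t + s • deriv δ t :=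
      (isSmoothPathOn_line ((hα.1.deriv hJ).mem_omega (hsub ht))
        ((hδ.deriv isOpen_univ).mem_omega (mem_univ t))).mono (subset_univ S)
    have h := hasDerivAt_formMetric hS ⟨l1, fun r hr => ⟨l1.mem_omega hr, hinj (r, t) ⟨hr, hIT ht⟩⟩⟩
      l2 l2 hs
    simp only [deriv_line] at h
    exact h
  have hmain := hasDerivAt_integral_of_compact (μ := volume) hS isCompact_Icc measurableSet_Icc
    isCompact_Icc.measure_ne_top (hF.mono (prod_mono_right hIT)) (hF'.mono (prod_mono_right hIT))
    hd (h0S rfl)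
  rw [intervalIntegral.integral_of_le h01.le, ← integral_Icc_eq_integral_Ioc]
  refine hmain.congr_of_eventuallyEq (Filter.Eventually.of_forall fun s => ?_)
  simp only [energy]
  rw [intervalIntegral.integral_of_le h01.le, ← integral_Icc_eq_integral_Ioc]
  refine setIntegral_congr_fun measurableSet_Icc fun t ht => ?_
  simp only [deriv_variation hJ hα.1 hδ (hsub ht)]

/-- The first variation of the energy. -/
theorem hasDerivAt_energy_geodesicDefect (hJ : IsOpen J) (hα : IsOmegaPlusPathOn I J α)
    (hδ : IsSmoothPathOn I univ δ) {t₀ t₁ : ℝ} (h01 : t₀ < t₁) (hsub : Icc t₀ t₁ ⊆ J)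
    (h0 : δ t₀ = 0) (h1 : δ t₁ = 0) :
    HasDerivAt (fun s : ℝ => energy (formMetric I) (fun t => α t + s • δ t) t₀ t₁)
      (-2 * ∫ t in t₀..t₁, formMetric I (α t) (geodesicDefect α t) (δ t)) 0 := by
  convert hasDerivAt_energy_variation hJ hα hδ h01 hsub using 1
  have hinj : ∀ t ∈ J, ∀ x, Function.Injective (α t x) := fun t ht => (hα.2 t ht).2
  have sα' := hα.1.deriv hJ
  have sα'' := sα'.deriv hJ
  have sδ := hδ.mono (subset_univ J)
  have sδ' := (hδ.deriv isOpen_univ).mono (subset_univ J)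
  have cα := hα.1.isContFamilyOn hJ
  have cα' := sα'.isContFamilyOn hJ
  have cα'' := sα''.isContFamilyOn hJ
  have cδ := sδ.isContFamilyOn hJ
  have cδ' := sδ'.isContFamilyOn hJ
  have cβ := (isSmoothPathOn_geodesicDefect hJ hα).isContFamilyOn hJ
  -- The time derivative of `G(α_t, δ)`, whose integral vanishes because `δ` is zero at both ends;
  -- this is the integration by parts.
  let g' : ℝ → ℝ := fun t => densityIntegral I fun c x =>
    metricDeriv (chartMatrix I c x (α t x)) (chartMatrix I c x (deriv α t x))
      (chartMatrix I c x (deriv α t x)) (chartMatrix I c x (δ t x)) +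
    matMetric (chartMatrix I c x (α t x)) (chartMatrix I c x (deriv (deriv α) t x))
      (chartMatrix I c x (δ t x)) +
    matMetric (chartMatrix I c x (α t x)) (chartMatrix I c x (deriv α t x))
      (chartMatrix I c x (deriv δ t x))
  have hu : uIcc t₀ t₁ ⊆ J := by rwa [uIcc_of_le h01.le]
  have hg : ∀ t ∈ uIcc t₀ t₁, HasDerivAt (fun s => formMetric I (α s) (deriv α s) (δ s)) (g' t) t :=
    fun t ht => hasDerivAt_formMetric hJ hα sα' sδ (hu ht)
  have hgc : ∀ c, ContinuousOn (fun q : ℝ × M =>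
      metricDeriv (chartMatrix I c q.2 (α q.1 q.2)) (chartMatrix I c q.2 (deriv α q.1 q.2))
        (chartMatrix I c q.2 (deriv α q.1 q.2)) (chartMatrix I c q.2 (δ q.1 q.2)) +
      matMetric (chartMatrix I c q.2 (α q.1 q.2)) (chartMatrix I c q.2 (deriv (deriv α) q.1 q.2))
        (chartMatrix I c q.2 (δ q.1 q.2)) +
      matMetric (chartMatrix I c q.2 (α q.1 q.2)) (chartMatrix I c q.2 (deriv α q.1 q.2))
        (chartMatrix I c q.2 (deriv δ q.1 q.2))) (J ×ˢ (chartAt H c).source) := fun c =>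
    ((cα.continuousOn_metricDeriv hinj cα' cα' cδ c).add
      (cα.continuousOn_matMetric hinj cα'' cδ c)).add (cα.continuousOn_matMetric hinj cα' cδ' c)
  have hg'c : ContinuousOn g' J := continuousOn_densityIntegral hJ hgc
  have hβc : ContinuousOn (fun t => formMetric I (α t) (geodesicDefect α t) (δ t)) J :=
    continuousOn_densityIntegral hJ (D := fun t c x => matMetric (chartMatrix I c x (α t x))
      (chartMatrix I c x (geodesicDefect α t x)) (chartMatrix I c x (δ t x)))
      fun c => cα.continuousOn_matMetric hinj cβ cδ c
  have hzero : ∫ t in t₀..t₁, g' t = 0 := by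
    rw [intervalIntegral.integral_eq_sub_of_hasDerivAt hg
      (hg'c.mono hu).intervalIntegrable, h0, h1]
    rw [formMetric_zero_right, formMetric_zero_right, sub_zero]
  -- The pointwise Koszul formula with arguments `α_t`, `α_t`, `δ` trades the derivative of the
  -- metric along `δ` for the one along `α_t` and the Christoffel term.
  have hpt : ∀ t ∈ uIcc t₀ t₁, energyVariation α δ 0 t =
      -2 * formMetric I (α t) (geodesicDefect α t) (δ t) + 2 * g' t := fun t ht => by
    have htJ := hu ht
    rw [formMetric, ← densityIntegral_const_mul, ← densityIntegral_const_mul,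
      ← densityIntegral_add]
    · refine densityIntegral_congr fun c x hx => ?_
      have hk := (OmegaPlus.full (hα.2 t htJ) hx).koszul (chartMatrix I c x (deriv α t x))
        (chartMatrix I c x (deriv α t x)) (chartMatrix I c x (δ t x))
      have e1 : chartMatrix I c x ((α t + (0 : ℝ) • δ t) x) = chartMatrix I c x (α t x) :=
        (chartMatrix_add c x (α t x) ((0 : ℝ) • δ t x)).trans (by
          rw [chartMatrix_smul, zero_smul, add_zero])
      have e2 : chartMatrix I c x ((deriv α t + (0 : ℝ) • deriv δ t) x) =
          chartMatrix I c x (deriv α t x) :=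
        (chartMatrix_add c x (deriv α t x) ((0 : ℝ) • deriv δ t x)).trans (by
          rw [chartMatrix_smul, zero_smul, add_zero])
      have e3 : chartMatrix I c x (geodesicDefect α t x) =
          chartMatrix I c x (deriv (deriv α) t x) - matChristoffel (chartMatrix I c x (α t x))
            (chartMatrix I c x (deriv α t x)) (chartMatrix I c x (deriv α t x)) :=
        (chartMatrix_sub c x _ _).trans (by rw [chartMatrix_formChristoffel _ _ _ hx])
      rw [e1, e2, e3, matMetric_sub_left, matMetric_comm _ (chartMatrix I c x (deriv δ t x))]
      linarith
    · exact fun c => continuousOn_const.mul (continuousDensity_matMetric (hα.2 t htJ)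
        ((isSmoothPathOn_geodesicDefect hJ hα).mem_omega htJ) (sδ.mem_omega htJ) c)
    · exact fun c => continuousOn_const.mul ((hgc c).comp (f := fun x : M => (t, x)) (by fun_prop)
        fun _ hx => ⟨htJ, hx⟩)
  rw [intervalIntegral.integral_congr hpt, intervalIntegral.integral_add,
    intervalIntegral.integral_const_mul, intervalIntegral.integral_const_mul, hzero, mul_zero,
    add_zero]
  · exact ((hβc.mono hu).const_mul (-2)).intervalIntegrable
  · exact ((hg'c.mono hu).const_mul 2).intervalIntegrable

/-- Fundamental lemma of the calculus of variations: if the defect is nonzero at `t`, the variation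
`χ` times the defect, with `χ` a bump in time, gives a nonzero first variation. -/
theorem isGeodesicOn_iff_defect (hJ : IsOpen J) (hα : IsOmegaPlusPathOn I J α) :
    IsGeodesicOn I J α ↔ ∀ t ∈ J, geodesicDefect α t = 0 := by
  constructor
  · intro h t ht
    by_contra hne
    obtain ⟨r, hr, hrJ⟩ := Metric.nhds_basis_closedBall.mem_iff.1 (hJ.mem_nhds ht)
    let χ : ContDiffBump t := ⟨r / 4, r / 2, by positivity, by linarith⟩
    let δ : ℝ → RawForm I M n := fun s => χ s • geodesicDefect α s
    have sβ := isSmoothPathOn_geodesicDefect hJ hα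
    have hδJ : IsSmoothPathOn I J δ := isSmoothPathOn_smul hJ χ.contDiff sβ
    have hχ0 : ∀ s, s ∉ Metric.closedBall t (r / 2) → χ s = 0 := fun s hs =>
      χ.zero_of_le_dist (by simpa using (not_le.1 hs).le)
    -- The path need not be smooth outside `J`; the variation is smooth on the whole line because it
    -- is zero off the support of the bump.
    have hδ' : IsSmoothPathOn I (Metric.closedBall t (r / 2))ᶜ δ :=
      (isSmoothPathOn_const zero_mem_omega _).congr fun s hs => by
        simp only [δ]
        rw [hχ0 s hs, zero_smul_form]
    have hδ : IsSmoothPathOn I univ δ := by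
      refine (hδJ.union hJ Metric.isClosed_closedBall.isOpen_compl hδ').mono fun s _ => ?_
      by_cases hs : s ∈ Metric.closedBall t (r / 2)
      · exact Or.inl (hrJ (Metric.closedBall_subset_closedBall (by linarith) hs))
      · exact Or.inr hs
    have hend : ∀ s, |s - t| = r → δ s = 0 := fun s hs => by
      simp only [δ]
      rw [hχ0 s (by rw [Metric.mem_closedBall, Real.dist_eq, hs]; linarith), zero_smul_form]
    have hsub : Icc (t - r) (t + r) ⊆ J := by rwa [← Real.closedBall_eq_Icc]
    have hlt : t - r < t + r := by linarith
    have e0 : δ (t - r) = 0 := hend _ (by rw [sub_sub_cancel_left, abs_neg, abs_of_pos hr])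
    have e1 : δ (t + r) = 0 := hend _ (by rw [add_sub_cancel_left, abs_of_pos hr])
    have hd := hasDerivAt_energy_geodesicDefect hJ hα hδ hlt hsub e0 e1
    have h2 := hd.unique (h _ _ hlt hsub δ hδ e0 e1)
    have hval : ∀ s, formMetric I (α s) (geodesicDefect α s) (δ s) =
        χ s * formMetric I (α s) (geodesicDefect α s) (geodesicDefect α s) := fun s =>
      formMetric_smul_right _ _ _ _
    have hinj : ∀ t ∈ J, ∀ x, Function.Injective (α t x) := fun t ht => (hα.2 t ht).2
    have hβc : ContinuousOn (fun t => formMetric I (α t) (geodesicDefect α t) (δ t)) J :=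
      continuousOn_densityIntegral hJ (D := fun t c x => matMetric (chartMatrix I c x (α t x))
        (chartMatrix I c x (geodesicDefect α t x)) (chartMatrix I c x (δ t x)))
        fun c => (hα.1.isContFamilyOn hJ).continuousOn_matMetric hinj (sβ.isContFamilyOn hJ)
          (hδJ.isContFamilyOn hJ) c
    have hpos : 0 < ∫ s in (t - r)..(t + r), formMetric I (α s) (geodesicDefect α s) (δ s) := by
      refine intervalIntegral.integral_pos hlt
        (hβc.mono hsub) (fun s hs => ?_) ⟨t, ⟨by linarith, by linarith⟩, ?_⟩
      · rw [hval]
        refine mul_nonneg χ.nonneg (densityIntegral_nonneg fun c x hx => ?_)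
        exact (OmegaPlus.full (hα.2 s (hsub ⟨hs.1.le, hs.2⟩)) hx).matMetric_self_nonneg _
      · rw [hval]
        exact mul_pos (χ.pos_of_mem_ball (Metric.mem_ball_self χ.rOut_pos))
          (formMetric_self_pos (hα.2 t ht) (sβ.mem_omega ht) hne)
    linarith
  · intro h t₀ t₁ h01 hsub δ hδ h0 h1
    have hd := hasDerivAt_energy_geodesicDefect hJ hα hδ h01 hsub h0 h1
    convert hd using 1
    have hz : ∀ t ∈ uIcc t₀ t₁, formMetric I (α t) (geodesicDefect α t) (δ t) = 0 := fun t ht => by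
      rw [uIcc_of_le h01.le] at ht
      rw [h t (hsub ht)]
      exact formMetric_zero_left _ _
    rw [intervalIntegral.integral_congr hz]
    simp

theorem isGeodesicOn_iff_ode (hJ : IsOpen J) (hα : IsOmegaPlusPathOn I J α) :
    IsGeodesicOn I J α ↔
      ∀ t ∈ J, ∀ (x : M) (b : Module.Basis (Fin m) ℝ (TangentSpace I x)),
        deriv (deriv (fun s => frameMatrix I b (α s x))) t =
          geodesicRHS (frameMatrix I b (α t x)) (deriv (fun s => frameMatrix I b (α s x)) t) := by
  rw [isGeodesicOn_iff_defect hJ hα]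
  refine forall₂_congr fun t ht => ?_
  have key : ∀ (x : M) (b : Module.Basis (Fin m) ℝ (TangentSpace I x)),
      deriv (deriv (fun s => frameMatrix I b (α s x))) t =
          geodesicRHS (frameMatrix I b (α t x)) (deriv (fun s => frameMatrix I b (α s x)) t) ↔
      frameMatrix I b (deriv (deriv α) t x) =
        frameMatrix I b (formChristoffel (α t) (deriv α t) (deriv α t) x) := fun x b => by
    rw [deriv_deriv_frameMatrix hJ hα.1 ht, deriv_frameMatrix hJ hα.1 ht,
      Full.geodesicRHS_eq ((full_frameMatrix_iff b _).2 ((hα.2 t ht).2 x)),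
      frameMatrix_formChristoffel]
  simp only [key]
  rw [geodesicDefect_eq_zero_iff]
  refine ⟨fun h x b => by rw [h], fun h => funext fun x => ?_⟩
  let b := chartBasis (I := I) x x (mem_chart_source H x)
  exact frameMatrix_injective b (h x b)

end Geodesics

/-! ### The initial value problem for geodesics -/

section InitialValue

attribute [local instance] Matrix.normedAddCommGroup Matrix.normedSpace

variable {m n : ℕ} {H : Type*} [TopologicalSpace H]
  {I : ModelWithCorners ℝ (EuclideanSpace ℝ (Fin m)) H}
  {M : Type*} [TopologicalSpace M] [ChartedSpace H M]

theorem solF_frameMatrix (α ζ : RawForm I M n) {x : M}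
    (b b' : Module.Basis (Fin m) ℝ (TangentSpace I x)) :
    solF (frameMatrix I b' (α x)) (frameMatrix I b' (ζ x)) =
      solF (frameMatrix I b (α x)) (frameMatrix I b (ζ x)) := by
  rw [frameMatrix_change b b' (α x), frameMatrix_change b b' (ζ x),
    solF_mul _ _ (det_toMatrix_ne_zero b b')]

theorem Full.continuousAt_solF {a : Matrix (Fin n) (Fin m) ℝ} (ha : Full a)
    (v : Matrix (Fin n) (Fin m) ℝ) (t : ℝ) :
    ContinuousAt (fun q : Matrix (Fin n) (Fin m) ℝ × Matrix (Fin n) (Fin m) ℝ × ℝ =>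
      solF q.1 q.2.1 q.2.2) (a, v, t) :=
  (ContDiffAt.solF (k := 0) (A := fun q : Matrix (Fin n) (Fin m) ℝ ×
    Matrix (Fin n) (Fin m) ℝ × ℝ => q.1) (x := (a, v, t))
    contDiffAt_fst contDiffAt_snd.fst contDiffAt_snd.snd ha).continuousAt

variable [IsManifold I ∞ M] {J : Set ℝ}

/-- At time 0 the function `f` is 1. Positivity is an open condition in `(t, x)`, and the tube lemma
over the compact `M` gives one `ε` for all points. -/
theorem exists_solF_pos [CompactSpace M] {α ζ : RawForm I M n} (hα : α ∈ OmegaPlus I M n)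
    (hζ : ζ ∈ Omega I M n) :
    ∃ ε > (0 : ℝ), ∀ t ∈ Ioo (-ε) ε, ∀ (x : M) (b : Module.Basis (Fin m) ℝ (TangentSpace I x)),
      0 < solF (frameMatrix I b (α x)) (frameMatrix I b (ζ x)) t := by
  have hopen : IsOpen {q : ℝ × M | ∀ b : Module.Basis (Fin m) ℝ (TangentSpace I q.2),
      0 < solF (frameMatrix I b (α q.2)) (frameMatrix I b (ζ q.2)) q.1} := by
    refine isOpen_iff_mem_nhds.2 fun q hq => ?_
    have hx := mem_chart_source H q.2
    have hS : (univ : Set ℝ) ×ˢ (chartAt H q.2).source ∈ nhds q :=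
      (isOpen_univ.prod (chartAt H q.2).open_source).mem_nhds ⟨mem_univ _, hx⟩
    have cα := (isContFamilyOn_const hα.1 (univ : Set ℝ) q.2).continuousAt hS
    have cζ := (isContFamilyOn_const hζ (univ : Set ℝ) q.2).continuousAt hS
    have hc := ((OmegaPlus.full hα hx).continuousAt_solF (chartMatrix I q.2 q.2 (ζ q.2)) q.1).comp
      (f := fun r : ℝ × M => (chartMatrix I q.2 r.2 (α r.2), chartMatrix I q.2 r.2 (ζ r.2), r.1))
      (cα.prodMk (cζ.prodMk continuousAt_fst))
    have h0 : 0 < solF (chartMatrix I q.2 q.2 (α q.2)) (chartMatrix I q.2 q.2 (ζ q.2)) q.1 := by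
      simpa only [chartMatrix_eq q.2 q.2 hx] using hq (chartBasis q.2 q.2 hx)
    filter_upwards [hS, hc.eventually (lt_mem_nhds h0)] with r hr hr' b
    simp only [Function.comp_apply, chartMatrix_eq q.2 r.2 hr.2] at hr'
    -- Since `f` does not depend on the basis, continuity in the coordinate frame covers all bases
    -- at once.
    rwa [solF_frameMatrix α ζ (chartBasis q.2 r.2 hr.2) b]
  obtain ⟨V, W, hV, -, h0V, hW, hVW⟩ := generalized_tube_lemma
    (isCompact_singleton (x := (0 : ℝ))) (isCompact_univ (X := M)) hopen (by
      rintro ⟨t, x⟩ ⟨rfl, -⟩ b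
      simp [solF_zero])
  obtain ⟨ε, hε, hsub⟩ := Metric.isOpen_iff.1 hV 0 (h0V rfl)
  refine ⟨ε, hε, fun t ht x b => ?_⟩
  have ht' : t ∈ Metric.ball (0 : ℝ) ε := by
    rw [Metric.mem_ball, Real.dist_eq, sub_zero, abs_lt]
    exact ht
  have h : (t, x) ∈ {q : ℝ × M | ∀ b : Module.Basis (Fin m) ℝ (TangentSpace I q.2),
      0 < solF (frameMatrix I b (α q.2)) (frameMatrix I b (ζ q.2)) q.1} :=
    hVW ⟨hsub ht', hW (mem_univ x)⟩
  exact h b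

/-- The one-forms given at every point by the explicit solution. -/
theorem exists_explicitForm (α ζ : RawForm I M n) (t : ℝ) :
    ∃ β : RawForm I M n, ∀ x (b : Module.Basis (Fin m) ℝ (TangentSpace I x)),
      frameMatrix I b (β x) = explicitSol (frameMatrix I b (α x)) (frameMatrix I b (ζ x)) t :=
  exists_form _ fun x b b' => by
    rw [frameMatrix_change b b' (α x), frameMatrix_change b b' (ζ x),
      explicitSol_mul _ _ (det_toMatrix_ne_zero b b')]

variable [CompactSpace M] [T2Space M]

theorem isMatSolution_of_isGeodesicOn (hJ : IsOpen J) {α : ℝ → RawForm I M n}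
    (hα : IsOmegaPlusPathOn I J α) (hg : IsGeodesicOn I J α) (x : M)
    (b : Module.Basis (Fin m) ℝ (TangentSpace I x)) :
    IsMatSolution J (fun t => frameMatrix I b (α t x))
      (fun t => frameMatrix I b (deriv α t x)) := fun t ht => by
  have hf : Full (frameMatrix I b (α t x)) := (full_frameMatrix_iff b _).2 ((hα.2 t ht).2 x)
  refine ⟨hf, hα.1.hasDerivAt_frameMatrix hJ ht x b, ?_⟩
  have h := (hα.1.deriv hJ).hasDerivAt_frameMatrix hJ ht x b
  have hd := geodesicDefect_eq_zero_iff.1 ((isGeodesicOn_iff_defect hJ hα).1 hg t ht)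
  rw [hd, frameMatrix_formChristoffel, ← Full.geodesicRHS_eq hf] at h
  exact h

variable {α₀ ζ₀ : RawForm I M n} {α : ℝ → RawForm I M n}

theorem IsGeodesicFrom.solF_pos (hJ : IsOpen J) (hJc : J.OrdConnected) (h0 : (0 : ℝ) ∈ J)
    (h : IsGeodesicFrom I J α₀ ζ₀ α) {t : ℝ} (ht : t ∈ J) (x : M)
    (b : Module.Basis (Fin m) ℝ (TangentSpace I x)) :
    0 < solF (frameMatrix I b (α₀ x)) (frameMatrix I b (ζ₀ x)) t := by
  obtain ⟨hα, hg, rfl, rfl⟩ := h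
  exact (isMatSolution_of_isGeodesicOn hJ hα hg x b).solF_pos hJ hJc h0 ht

theorem IsGeodesicFrom.eq_explicitSol (hm : 1 ≤ m) (hJ : IsOpen J) (hJc : J.OrdConnected)
    (h0 : (0 : ℝ) ∈ J) (h : IsGeodesicFrom I J α₀ ζ₀ α) {t : ℝ} (ht : t ∈ J) (x : M)
    (b : Module.Basis (Fin m) ℝ (TangentSpace I x)) :
    frameMatrix I b (α t x) = explicitSol (frameMatrix I b (α₀ x)) (frameMatrix I b (ζ₀ x)) t := by
  have hf := fun s (hs : s ∈ J) => h.solF_pos hJ hJc h0 hs x b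
  obtain ⟨hα, hg, rfl, rfl⟩ := h
  have h1 := isMatSolution_of_isGeodesicOn hJ hα hg x b
  have h2 := Full.isMatSolution_explicitSol (h1 0 h0).1 hm hJ hJc h0 hf
  exact h1.unique h2 hJ hJc h0 (explicitSol_zero _ _).symm (explicitVel_zero _ _).symm t ht

/-- Being equivariant under changes of basis, the explicit matrix solution defines a form at each
time; smooth dependence on the initial data makes it a smooth path, and the pointwise equation makes
it a geodesic. -/
theorem exists_isGeodesicFrom (hm : 1 ≤ m) (hα₀ : α₀ ∈ OmegaPlus I M n)
    (hζ₀ : ζ₀ ∈ Omega I M n) (hJ : IsOpen J) (hJc : J.OrdConnected) (h0 : (0 : ℝ) ∈ J)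
    (hf : ∀ t ∈ J, ∀ (x : M) (b : Module.Basis (Fin m) ℝ (TangentSpace I x)),
      0 < solF (frameMatrix I b (α₀ x)) (frameMatrix I b (ζ₀ x)) t) :
    ∃ α, IsGeodesicFrom I J α₀ ζ₀ α := by
  choose α hα using exists_explicitForm α₀ ζ₀
  have hfull : ∀ x (b : Module.Basis (Fin m) ℝ (TangentSpace I x)),
      Full (frameMatrix I b (α₀ x)) := fun x b => (full_frameMatrix_iff b _).2 (hα₀.2 x)
  have hsol : ∀ x (b : Module.Basis (Fin m) ℝ (TangentSpace I x)), IsMatSolution J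
      (fun t => frameMatrix I b (α t x))
      (explicitVel (frameMatrix I b (α₀ x)) (frameMatrix I b (ζ₀ x))) := fun x b => by
    have h := Full.isMatSolution_explicitSol (hfull x b) hm hJ hJc h0 fun s hs => hf s hs x b
    have e : (fun t => frameMatrix I b (α t x)) =
        explicitSol (frameMatrix I b (α₀ x)) (frameMatrix I b (ζ₀ x)) := funext fun t => hα t x b
    rwa [e]
  have hs : IsSmoothPathOn I J α :=
    isSmoothPathOn_of_op hJ (isSmoothPathOn_const hα₀.1 J) (isSmoothPathOn_const hζ₀ J)
      (isSmoothPathOn_const hζ₀ J) (fun t a v _ => explicitSol a v t) (fun t _ x b => hα t x b)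
      fun t ht x b => ContDiffAt.explicitSol contDiffAt_snd.fst contDiffAt_snd.snd.fst
        contDiffAt_fst (hfull x b) fun θ hθ => hf _ (by
          -- Smoothness of `s` at time `t` needs `f > 0` on the whole segment from 0 to `t`, which
          -- lies in the interval `J`.
          have h1 : uIcc 0 t ⊆ J := hJc.uIcc_subset h0 ht
          refine h1 ?_
          rcases le_total 0 t with h | h
          · rw [uIcc_of_le h]
            exact ⟨mul_nonneg h hθ.1, mul_le_of_le_one_right h hθ.2⟩
          · rw [uIcc_of_ge h]
            exact ⟨le_mul_of_le_one_right h hθ.2, mul_nonpos_of_nonpos_of_nonneg h hθ.1⟩) x b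
  have hp : IsOmegaPlusPathOn I J α := ⟨hs, fun t ht => ⟨hs.mem_omega ht, fun x =>
    (full_frameMatrix_iff (chartBasis (I := I) x x (mem_chart_source H x)) _).1
      (hsol x _ t ht).1⟩⟩
  refine ⟨α, hp, (isGeodesicOn_iff_ode hJ hp).2 fun t ht x b => ?_, ?_, ?_⟩
  · have h1 : ∀ s ∈ J, deriv (fun s => frameMatrix I b (α s x)) s =
        explicitVel (frameMatrix I b (α₀ x)) (frameMatrix I b (ζ₀ x)) s := fun s hs =>
      (hsol x b s hs).2.1.deriv
    rw [h1 t ht]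
    have h2 : deriv (deriv fun s => frameMatrix I b (α s x)) t =
        deriv (explicitVel (frameMatrix I b (α₀ x)) (frameMatrix I b (ζ₀ x))) t := by
      refine Filter.EventuallyEq.deriv_eq (F := Fin n → Fin m → ℝ) ?_
      filter_upwards [hJ.mem_nhds ht] with s hs using h1 s hs
    rw [h2]
    exact (hsol x b t ht).2.2.deriv
  · funext x
    let b := chartBasis (I := I) x x (mem_chart_source H x)
    exact frameMatrix_injective b ((hα 0 x b).trans (explicitSol_zero _ _))
  · funext x
    let b := chartBasis (I := I) x x (mem_chart_source H x)
    refine frameMatrix_injective b ?_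
    rw [← deriv_frameMatrix hJ hs h0 x b]
    exact (hsol x b 0 h0).2.1.deriv.trans (explicitVel_zero _ _)

end InitialValue

/-! ### The curvature of the generalized Ebin metric -/

section FormCurvature

attribute [local instance] Matrix.normedAddCommGroup Matrix.normedSpace

variable {m n : ℕ} {H : Type*} [TopologicalSpace H]
  {I : ModelWithCorners ℝ (EuclideanSpace ℝ (Fin m)) H}
  {M : Type*} [TopologicalSpace M] [ChartedSpace H M] [IsManifold I ∞ M]
  {α ζ η z w : RawForm I M n}

/-- This carries the sign of the curvature at a point from one basis to every chart. -/
theorem sectional_frame_change (hα : α ∈ OmegaPlus I M n) (ζ η : RawForm I M n) {x : M}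
    (b b' : Module.Basis (Fin m) ℝ (TangentSpace I x)) :
    ∃ r > 0, sectional univ matMetric (frameMatrix I b' (α x)) (frameMatrix I b' (ζ x))
        (frameMatrix I b' (η x)) =
      r * sectional univ matMetric (frameMatrix I b (α x)) (frameMatrix I b (ζ x))
        (frameMatrix I b (η x)) := by
  refine ⟨|(b.toMatrix b').det|, abs_pos.2 (det_toMatrix_ne_zero b b'), ?_⟩
  rw [frameMatrix_change b b' (α x), frameMatrix_change b b' (ζ x), frameMatrix_change b b' (η x),
    Full.sectional_mul ((full_frameMatrix_iff b _).2 (hα.2 x)) (det_toMatrix_ne_zero b b')]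

variable [CompactSpace M] [T2Space M]

theorem christoffel_form_mem (hα : α ∈ OmegaPlus I M n) (hζ : ζ ∈ Omega I M n)
    (hη : η ∈ Omega I M n) :
    christoffel (Omega I M n) (formMetric I) α ζ η ∈ Omega I M n := by
  rw [christoffel_form_eq hα hζ hη]
  exact formChristoffel_mem hα hζ hη

theorem frameMatrix_christoffel (hα : α ∈ OmegaPlus I M n) (hζ : ζ ∈ Omega I M n)
    (hη : η ∈ Omega I M n) (x : M) (b : Module.Basis (Fin m) ℝ (TangentSpace I x)) :
    frameMatrix I b (christoffel (Omega I M n) (formMetric I) α ζ η x) =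
      christoffel univ matMetric (frameMatrix I b (α x)) (frameMatrix I b (ζ x))
        (frameMatrix I b (η x)) := by
  rw [christoffel_form_eq hα hζ hη, frameMatrix_formChristoffel,
    Full.christoffel_eq ((full_frameMatrix_iff b _).2 (hα.2 x))]

/-- For small `t` the line `α + t • z` stays injective, so the form symbol is pointwise there and
both derivatives at 0 are derivatives of the same matrix path. For larger `t` the symbol may be a
default value, which the derivative at 0 does not see. -/
theorem frameMatrix_christoffelDeriv (hα : α ∈ OmegaPlus I M n) (hz : z ∈ Omega I M n)
    (hζ : ζ ∈ Omega I M n) (hη : η ∈ Omega I M n) (x : M)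
    (b : Module.Basis (Fin m) ℝ (TangentSpace I x)) :
    frameMatrix I b (christoffelDeriv (Omega I M n) (formMetric I) α z ζ η x) =
      christoffelDeriv univ matMetric (frameMatrix I b (α x)) (frameMatrix I b (z x))
        (frameMatrix I b (ζ x)) (frameMatrix I b (η x)) := by
  obtain ⟨J, hJ, h0, hJα⟩ := isOpen_line hα hz
  have hα' : IsOmegaPlusPathOn I J fun t : ℝ => α + t • z :=
    ⟨(isSmoothPathOn_line hα.1 hz).mono (subset_univ J), hJα⟩
  have hs : IsSmoothPathOn I J fun t : ℝ =>
      christoffel (Omega I M n) (formMetric I) (α + t • z) ζ η :=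
    (isSmoothPathOn_formChristoffel hJ hα' (isSmoothPathOn_const hζ J)
      (isSmoothPathOn_const hη J)).congr fun t ht => christoffel_form_eq (hJα t ht) hζ hη
  have h1 := hs.hasDerivAt_frameMatrix hJ h0 x b
  have hf : Full (frameMatrix I b (α x)) := (full_frameMatrix_iff b _).2 (hα.2 x)
  have h2 := hf.hasDerivAt_christoffel (frameMatrix I b (z x)) (frameMatrix I b (ζ x))
    (frameMatrix I b (η x))
  have h3 : HasDerivAt (fun t : ℝ => christoffel univ matMetric
      (frameMatrix I b (α x) + t • frameMatrix I b (z x)) (frameMatrix I b (ζ x))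
      (frameMatrix I b (η x))) (frameMatrix I b
        (deriv (fun t : ℝ => christoffel (Omega I M n) (formMetric I) (α + t • z) ζ η) 0 x)) 0 := by
    refine HasDerivAt.congr_of_eventuallyEq (F := Fin n → Fin m → ℝ) h1 ?_
    filter_upwards [hJ.mem_nhds h0] with t ht
    have e : frameMatrix I b ((α + t • z) x) =
        frameMatrix I b (α x) + t • frameMatrix I b (z x) :=
      (frameMatrix_add _ _ _).trans (congrArg _ (frameMatrix_smul _ _ _))
    have h4 := frameMatrix_christoffel (hJα t ht) hζ hη x b
    rw [e] at h4
    exact h4.symm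
  rw [Full.christoffelDeriv_eq hf]
  exact HasDerivAt.unique (F := Fin n → Fin m → ℝ) h3 h2

theorem frameMatrix_riemann (hα : α ∈ OmegaPlus I M n) (hζ : ζ ∈ Omega I M n)
    (hη : η ∈ Omega I M n) (hw : w ∈ Omega I M n) (x : M)
    (b : Module.Basis (Fin m) ℝ (TangentSpace I x)) :
    frameMatrix I b (riemann (Omega I M n) (formMetric I) α ζ η w x) =
      riemann univ matMetric (frameMatrix I b (α x)) (frameMatrix I b (ζ x))
        (frameMatrix I b (η x)) (frameMatrix I b (w x)) := by
  have hneg : ∀ L : TangentSpace I x →L[ℝ] EuclideanSpace ℝ (Fin n),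
      frameMatrix I b (-L) = -frameMatrix I b L := fun L => by ext i j; simp [frameMatrix]
  have e : riemann (Omega I M n) (formMetric I) α ζ η w x =
      -christoffelDeriv (Omega I M n) (formMetric I) α ζ η w x +
        christoffelDeriv (Omega I M n) (formMetric I) α η ζ w x +
        christoffel (Omega I M n) (formMetric I) α ζ
          (christoffel (Omega I M n) (formMetric I) α η w) x -
        christoffel (Omega I M n) (formMetric I) α η
          (christoffel (Omega I M n) (formMetric I) α ζ w) x := rfl
  rw [e, frameMatrix_sub, frameMatrix_add, frameMatrix_add, hneg,
    frameMatrix_christoffelDeriv hα hζ hη hw, frameMatrix_christoffelDeriv hα hη hζ hw,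
    frameMatrix_christoffel hα hζ (christoffel_form_mem hα hη hw),
    frameMatrix_christoffel hα hη (christoffel_form_mem hα hζ hw),
    frameMatrix_christoffel hα hη hw, frameMatrix_christoffel hα hζ hw]
  rfl

/-- The curvature of the generalized Ebin metric is the integral of the pointwise curvatures. -/
theorem sectional_form_eq (hα : α ∈ OmegaPlus I M n) (hζ : ζ ∈ Omega I M n)
    (hη : η ∈ Omega I M n) :
    sectional (Omega I M n) (formMetric I) α ζ η = densityIntegral I fun c x =>
      sectional univ matMetric (chartMatrix I c x (α x)) (chartMatrix I c x (ζ x))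
        (chartMatrix I c x (η x)) := by
  rw [sectional, formMetric]
  refine densityIntegral_congr fun c x hx => ?_
  rw [sectional, chartMatrix_eq c x hx, chartMatrix_eq c x hx, chartMatrix_eq c x hx,
    frameMatrix_riemann hα hζ hη hη, chartMatrix_eq c x hx]

theorem sectional_pureTrace (hα : α ∈ OmegaPlus I M n) (hζ : ζ ∈ Omega I M n)
    (hη : η ∈ Omega I M n) (h : IsPureTrace I α ζ ∨ IsPureTrace I α η) :
    sectional (Omega I M n) (formMetric I) α ζ η = 0 := by
  rw [sectional_form_eq hα hζ hη, ← densityIntegral_zero (I := I) (M := M)]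
  refine densityIntegral_congr fun c x hx => ?_
  rcases h with ⟨l, hl⟩ | ⟨l, hl⟩
  · rw [hl, chartMatrix_smul, (OmegaPlus.full hα hx).sectional_smul_self_left]
  · rw [hl, chartMatrix_smul, (OmegaPlus.full hα hx).sectional_smul_self_right]

theorem sectional_horizontal_nonpos (hm : 1 ≤ m) (hα : α ∈ OmegaPlus I M n)
    (hζ : ζ ∈ Omega I M n) (hη : η ∈ Omega I M n) (h : IsHorizontal I α ζ)
    (h' : IsHorizontal I α η) : sectional (Omega I M n) (formMetric I) α ζ η ≤ 0 := by
  rw [sectional_form_eq hα hζ hη, ← neg_nonneg, ← neg_one_mul, ← densityIntegral_const_mul]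
  refine densityIntegral_nonneg fun c x hx => ?_
  simp only [chartMatrix_eq c x hx]
  have := Full.sectional_horizontal_nonpos ((full_frameMatrix_iff _ _).2 (hα.2 x)) hm
    (h x (chartBasis c x hx)) (h' x (chartBasis c x hx))
  linarith

theorem sectional_horizontal_neg (hm : 1 ≤ m) (hα : α ∈ OmegaPlus I M n)
    (hζ : ζ ∈ Omega I M n) (hη : η ∈ Omega I M n) (h : IsHorizontal I α ζ)
    (h' : IsHorizontal I α η) {x₀ : M} (b : Module.Basis (Fin m) ℝ (TangentSpace I x₀))
    (hi : LinearIndependent ℝ ![tracelessPart (frameMatrix I b (α x₀)) (frameMatrix I b (ζ x₀)),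
      tracelessPart (frameMatrix I b (α x₀)) (frameMatrix I b (η x₀))]) :
    sectional (Omega I M n) (formMetric I) α ζ η < 0 := by
  rw [sectional_form_eq hα hζ hη, ← neg_pos, ← neg_one_mul, ← densityIntegral_const_mul]
  refine densityIntegral_pos
    (fun c => continuousOn_const.mul (continuousDensity_sectional hα hζ hη c))
    (fun c x hx => ?_) (x₀ := x₀) fun c hx => ?_
  · simp only [chartMatrix_eq c x hx]
    have := Full.sectional_horizontal_nonpos ((full_frameMatrix_iff _ _).2 (hα.2 x)) hm
      (h x (chartBasis c x hx)) (h' x (chartBasis c x hx))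
    linarith
  · simp only [chartMatrix_eq c x₀ hx]
    have h1 := Full.sectional_horizontal_neg ((full_frameMatrix_iff b _).2 (hα.2 x₀)) hm
      (h x₀ b) (h' x₀ b) hi
    obtain ⟨r, hr, e⟩ := sectional_frame_change hα ζ η b (chartBasis c x₀ hx)
    rw [e]
    nlinarith

theorem sectional_pos_of_nonneg (hα : α ∈ OmegaPlus I M n) (hζ : ζ ∈ Omega I M n)
    (hη : η ∈ Omega I M n)
    (h : ∀ x (b : Module.Basis (Fin m) ℝ (TangentSpace I x)), 0 ≤ sectional univ matMetric
      (frameMatrix I b (α x)) (frameMatrix I b (ζ x)) (frameMatrix I b (η x)))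
    {x₀ : M} (b : Module.Basis (Fin m) ℝ (TangentSpace I x₀)) (hpos : 0 < sectional univ matMetric
      (frameMatrix I b (α x₀)) (frameMatrix I b (ζ x₀)) (frameMatrix I b (η x₀))) :
    0 < sectional (Omega I M n) (formMetric I) α ζ η := by
  rw [sectional_form_eq hα hζ hη]
  refine densityIntegral_pos (continuousDensity_sectional hα hζ hη)
    (fun c x hx => ?_) (x₀ := x₀) fun c hx => ?_
  · simp only [chartMatrix_eq c x hx]
    exact h x _
  · simp only [chartMatrix_eq c x₀ hx]
    obtain ⟨r, hr, e⟩ := sectional_frame_change hα ζ η b (chartBasis c x₀ hx)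
    rw [e]
    exact mul_pos hr hpos

/-- The curvature is quadratic in both arguments. -/
theorem sectional_form_smul (hα : α ∈ OmegaPlus I M n) (hζ : ζ ∈ Omega I M n)
    (hη : η ∈ Omega I M n) (r s : ℝ) :
    sectional (Omega I M n) (formMetric I) α (r • ζ) (s • η) =
      r ^ 2 * s ^ 2 * sectional (Omega I M n) (formMetric I) α ζ η := by
  rw [sectional_form_eq hα hζ hη, sectional_form_eq hα (Omega.const_smul hζ r)
    (Omega.const_smul hη s), ← densityIntegral_const_mul]
  refine densityIntegral_congr fun c x hx => ?_
  rw [← (OmegaPlus.full hα hx).sectional_smul, ← chartMatrix_smul, ← chartMatrix_smul]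
  rfl

/-- Orthogonal nonzero one-forms can be normalized without changing the sign of the curvature. -/
theorem exists_orthonormal (hα : α ∈ OmegaPlus I M n) (hζ : ζ ∈ Omega I M n)
    (hη : η ∈ Omega I M n) (hζ0 : ζ ≠ 0) (hη0 : η ≠ 0) (horth : formMetric I α ζ η = 0) :
    ∃ r > 0, ∃ s > 0, Orthonormal₂ (formMetric I) α (r • ζ) (s • η) ∧
      sectional (Omega I M n) (formMetric I) α (r • ζ) (s • η) =
        r ^ 2 * s ^ 2 * sectional (Omega I M n) (formMetric I) α ζ η := by
  have h1 := formMetric_self_pos hα hζ hζ0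
  have h2 := formMetric_self_pos hα hη hη0
  have key : ∀ q : ℝ, 0 < q → (√q)⁻¹ * ((√q)⁻¹ * q) = 1 := fun q hq => by
    have hs := Real.sq_sqrt hq.le
    have hs0 := (Real.sqrt_pos.2 hq).ne'
    field_simp
    rw [hs]
  refine ⟨(√(formMetric I α ζ ζ))⁻¹, by positivity, (√(formMetric I α η η))⁻¹, by positivity,
    ⟨?_, ?_, ?_⟩, sectional_form_smul hα hζ hη _ _⟩
  · rw [formMetric_smul_left, formMetric_smul_right, key _ h1]
  · rw [formMetric_smul_left, formMetric_smul_right, key _ h2]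
  · rw [formMetric_smul_left, formMetric_smul_right, horth, mul_zero, mul_zero]

end FormCurvature

/-! ### Curvature for one-dimensional manifolds. -/

section Curves

variable {H : Type*} [TopologicalSpace H]
  {I : ModelWithCorners ℝ (EuclideanSpace ℝ (Fin 1)) H}
  {M : Type*} [TopologicalSpace M] [ChartedSpace H M] [IsManifold I ∞ M]
  [CompactSpace M] [T2Space M]

theorem sectional_curve_nonneg {n : ℕ} {α ζ η : RawForm I M n} (hα : α ∈ OmegaPlus I M n)
    (hζ : ζ ∈ Omega I M n) (hη : η ∈ Omega I M n) :
    0 ≤ sectional (Omega I M n) (formMetric I) α ζ η := by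
  rw [sectional_form_eq hα hζ hη]
  exact densityIntegral_nonneg fun c x hx => (OmegaPlus.full hα hx).sectional_column_nonneg _ _

theorem sectional_plane_curve {α ζ η : RawForm I M 2} (hα : α ∈ OmegaPlus I M 2)
    (hζ : ζ ∈ Omega I M 2) (hη : η ∈ Omega I M 2) :
    sectional (Omega I M 2) (formMetric I) α ζ η = 0 := by
  rw [sectional_form_eq hα hζ hη, ← densityIntegral_zero (I := I) (M := M)]
  exact densityIntegral_congr fun c x hx => (OmegaPlus.full hα hx).sectional_column_two _ _

end Curves

/-! ### Horizontal and normal directions at a matrix -/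

section MatrixDirections

attribute [local instance] Matrix.normedAddCommGroup Matrix.normedSpace

variable {m n : ℕ} {a u v : Matrix (Fin n) (Fin m) ℝ}

/-- The horizontal part of `u` at the foot point `a`. -/
def horPart (a u : Matrix (Fin n) (Fin m) ℝ) : Matrix (Fin n) (Fin m) ℝ :=
  (1 / 2 : ℝ) • (a * pinv a * u + (u * pinv a)ᵀ * a)

theorem horPart_mul {q : Matrix (Fin m) (Fin m) ℝ} (a u : Matrix (Fin n) (Fin m) ℝ)
    (hq : q.det ≠ 0) : horPart (a * q) (u * q) = horPart a u * q := by
  rw [horPart, mul_mul_pinv_mul a a hq, mul_mul_pinv_mul a u hq, horPart, Matrix.smul_mul,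
    Matrix.add_mul]
  simp only [Matrix.mul_assoc]

theorem horPart_isSymm (a u : Matrix (Fin n) (Fin m) ℝ) :
    (horPart a u * pinv a).IsSymm := by
  have h1 : horPart a u * pinv a =
      (1 / 2 : ℝ) • (a * pinv a * (u * pinv a) + (a * pinv a * (u * pinv a))ᵀ) := by
    rw [Matrix.transpose_mul (a * pinv a), proj_transpose, horPart, Matrix.smul_mul,
      Matrix.add_mul]
    simp only [Matrix.mul_assoc]
  rw [h1, Matrix.IsSymm, Matrix.transpose_smul, Matrix.transpose_add, Matrix.transpose_transpose,
    add_comm]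

/-- For such a vector `u` the matrix `u a⁺` is `a B aᵀ`, symmetric and fixed by the projection. -/
theorem Full.horPart_eq (ha : Full a) {B : Matrix (Fin m) (Fin m) ℝ} (hB : B.IsSymm) :
    horPart a (a * B * (aᵀ * a)) = a * B * (aᵀ * a) := by
  have h1 : a * pinv a * (a * B * (aᵀ * a)) = a * B * (aᵀ * a) := by
    have h := ha.pinv_mul
    calc a * pinv a * (a * B * (aᵀ * a)) = a * (pinv a * a) * B * (aᵀ * a) := by
          simp only [Matrix.mul_assoc]
      _ = _ := by rw [h, Matrix.mul_one]
  have h2 : a * B * (aᵀ * a) * pinv a = a * B * aᵀ := by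
    have h := ha.gram_mul_inv
    calc a * B * (aᵀ * a) * pinv a = a * B * ((aᵀ * a) * (aᵀ * a)⁻¹) * aᵀ := by
          simp only [pinv, Matrix.mul_assoc]
      _ = _ := by rw [h, Matrix.mul_one]
  have h3 : (a * B * aᵀ)ᵀ = a * B * aᵀ := by
    rw [Matrix.transpose_mul, Matrix.transpose_mul, Matrix.transpose_transpose, hB.eq,
      Matrix.mul_assoc]
  rw [horPart, h1, h2, h3, Matrix.mul_assoc (a * B) aᵀ a, ← two_smul ℝ, smul_smul]
  norm_num

/-- The component of `v` orthogonal to `u` at the foot point `a`, up to a factor. -/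
def orthPart (a u v : Matrix (Fin n) (Fin m) ℝ) : Matrix (Fin n) (Fin m) ℝ :=
  (u * pinv a * (u * pinv a)ᵀ).trace • v - (u * pinv a * (v * pinv a)ᵀ).trace • u

/-- The coefficients in `orthPart` are traces without the volume factor, hence true functions rather
than densities, and the construction applies to forms. -/
theorem orthPart_mul {q : Matrix (Fin m) (Fin m) ℝ} (a u v : Matrix (Fin n) (Fin m) ℝ)
    (hq : q.det ≠ 0) : orthPart (a * q) (u * q) (v * q) = orthPart a u v * q := by
  simp only [orthPart, mul_mul_pinv_mul _ _ hq, Matrix.sub_mul, Matrix.smul_mul]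

theorem Full.matMetric_orthPart (ha : Full a) (u v : Matrix (Fin n) (Fin m) ℝ) :
    matMetric a u (orthPart a u v) = 0 := by
  rw [matMetric_comm, orthPart, matMetric_sub_left, matMetric_smul_left, matMetric_smul_left,
    matMetric_comm a v, ha.matMetric_eq, ha.matMetric_eq]
  ring

theorem tracelessPart_add_smul (a u v : Matrix (Fin n) (Fin m) ℝ) (c : ℝ) :
    tracelessPart a (v + c • u) = tracelessPart a v + c • tracelessPart a u := by
  simp only [tracelessPart, Matrix.add_mul, Matrix.smul_mul, Matrix.trace_add, Matrix.trace_smul,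
    smul_eq_mul, smul_sub, smul_smul, add_div, add_smul, mul_div_assoc]
  abel

theorem Full.gram_posDef (ha : Full a) : (aᵀ * a).PosDef := by
  have h := Matrix.posSemidef_conjTranspose_mul_self a
  rw [Matrix.conjTranspose_eq_transpose_of_trivial] at h
  rw [h.posDef_iff_isUnit, Matrix.isUnit_iff_isUnit_det]
  exact isUnit_iff_ne_zero.2 ha.ne'

/-- Two horizontal directions whose traceless parts are linearly independent. -/
theorem Full.exists_horizontal (ha : Full a) (hm : 2 ≤ m) :
    ∃ u v, horPart a u = u ∧ horPart a v = v ∧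
      LinearIndependent ℝ ![tracelessPart a u, tracelessPart a v] := by
  let i : Fin m := ⟨0, by omega⟩
  let j : Fin m := ⟨1, by omega⟩
  have hij : i ≠ j := by simp [i, j]
  let B : Matrix (Fin m) (Fin m) ℝ := Matrix.single i i 1
  let C : Matrix (Fin m) (Fin m) ℝ := Matrix.single i j 1 + Matrix.single j i 1
  have hB : B.IsSymm := by simp [B, Matrix.IsSymm]
  have hC : C.IsSymm := by simp [C, Matrix.IsSymm, add_comm]
  refine ⟨a * B * (aᵀ * a), a * C * (aᵀ * a), ha.horPart_eq hB, ha.horPart_eq hC, ?_⟩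
  rw [LinearIndependent.pair_iff]
  intro s t hst
  -- Multiplying by `pinv a` and `(aᵀ * a)⁻¹` recovers `D`, while the trace correction becomes a
  -- multiple of the inverse Gram matrix.
  have key : ∀ D : Matrix (Fin m) (Fin m) ℝ, ∃ κ : ℝ,
      pinv a * tracelessPart a (a * D * (aᵀ * a)) * (aᵀ * a)⁻¹ = D - κ • (aᵀ * a)⁻¹ := fun D => by
    refine ⟨(a * D * (aᵀ * a) * pinv a).trace / m, ?_⟩
    rw [tracelessPart, Matrix.mul_sub, Matrix.sub_mul, Matrix.mul_smul, ha.pinv_mul,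
      Matrix.smul_mul, Matrix.one_mul]
    congr 1
    calc pinv a * (a * D * (aᵀ * a)) * (aᵀ * a)⁻¹
        = (pinv a * a) * D * ((aᵀ * a) * (aᵀ * a)⁻¹) := by simp only [Matrix.mul_assoc]
      _ = D := by rw [ha.pinv_mul, ha.gram_mul_inv, Matrix.one_mul, Matrix.mul_one]
  obtain ⟨κ, hκ⟩ := key B
  obtain ⟨μ, hμ⟩ := key C
  have h1 := congrArg (fun X => pinv a * X * (aᵀ * a)⁻¹) hst
  simp only [Matrix.mul_add, Matrix.add_mul, Matrix.mul_smul, Matrix.smul_mul, hκ, hμ,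
    Matrix.mul_zero, Matrix.zero_mul] at h1
  -- The `(j, j)` entries of `B` and `C` are zero, whereas that of the inverse Gram matrix is
  -- positive. So the multiple in the relation is zero, and the entries `(i, i)` and `(i, j)` give
  -- `s = t = 0`.
  have hpos : 0 < (aᵀ * a)⁻¹ j j := ha.gram_posDef.inv.diag_pos
  have e1 := congrFun (congrFun h1 j) j
  have e2 := congrFun (congrFun h1 i) i
  have e3 := congrFun (congrFun h1 i) j
  simp [B, C, hij, hij.symm] at e1 e2 e3
  have h4 : s * κ + t * μ = 0 := by
    have : (s * κ + t * μ) * (aᵀ * a)⁻¹ j j = 0 := by linarith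
    exact (mul_eq_zero.1 this).resolve_right hpos.ne'
  constructor
  · have : s = (s * κ + t * μ) * (aᵀ * a)⁻¹ i i := by linarith
    rw [this, h4, zero_mul]
  · have : t = (s * κ + t * μ) * (aᵀ * a)⁻¹ i j := by linarith
    rw [this, h4, zero_mul]

/-- Two orthonormal vectors that are orthogonal to the columns of `a`. -/
theorem exists_orthonormal_normal (a : Matrix (Fin n) (Fin m) ℝ) (hmn : m + 2 ≤ n) :
    ∃ p q : Fin n → ℝ, p ⬝ᵥ p = 1 ∧ q ⬝ᵥ q = 1 ∧ p ⬝ᵥ q = 0 ∧ aᵀ *ᵥ p = 0 ∧ aᵀ *ᵥ q = 0 := by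
  let A : EuclideanSpace ℝ (Fin m) →ₗ[ℝ] EuclideanSpace ℝ (Fin n) := Matrix.toEuclideanLin a
  -- The column space has dimension at most `m`, so its orthogonal complement has dimension at least
  -- `n - m ≥ 2`.
  have hK : 2 ≤ Module.finrank ℝ (LinearMap.range A)ᗮ := by
    have h1 := Submodule.finrank_add_finrank_orthogonal (LinearMap.range A)
    have h2 := LinearMap.finrank_range_le A
    rw [finrank_euclideanSpace_fin] at h1 h2
    omega
  have f := stdOrthonormalBasis ℝ (LinearMap.range A)ᗮ
  let i : Fin (Module.finrank ℝ (LinearMap.range A)ᗮ) := ⟨0, by omega⟩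
  let j : Fin (Module.finrank ℝ (LinearMap.range A)ᗮ) := ⟨1, by omega⟩
  have hij : i ≠ j := by simp [i, j]
  have hdot : ∀ k l, (f k : EuclideanSpace ℝ (Fin n)).ofLp ⬝ᵥ
      (f l : EuclideanSpace ℝ (Fin n)).ofLp = if k = l then 1 else 0 := fun k l => by
    have h := (orthonormal_iff_ite.1 f.orthonormal) k l
    rw [Submodule.coe_inner, EuclideanSpace.inner_eq_star_dotProduct, star_trivial,
      dotProduct_comm] at h
    exact h
  have hker : ∀ k, aᵀ *ᵥ (f k : EuclideanSpace ℝ (Fin n)).ofLp = 0 := fun k => by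
    funext r
    have h2 := (Submodule.mem_orthogonal _ _).1 (f k).2 (A (EuclideanSpace.single r 1)) ⟨_, rfl⟩
    rw [EuclideanSpace.inner_eq_star_dotProduct, star_trivial] at h2
    have h3 : (A (EuclideanSpace.single r 1)).ofLp = fun s => a s r := by
      funext s
      simp [A]
    rw [h3, dotProduct_comm] at h2
    exact h2
  exact ⟨_, _, by simpa using hdot i i, by simpa using hdot j j, by simpa [hij] using hdot i j,
    hker i, hker j⟩

/-- Orthogonal directions spanning a plane of positive curvature. -/
theorem Full.exists_sectional_pos (ha : Full a) (hm : 1 ≤ m) (hm3 : m ≤ 3) (hmn : m + 2 ≤ n) :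
    ∃ u v, orthPart a u v = v ∧ 0 < sectional univ matMetric a u v := by
  obtain ⟨p, q, hpp, hqq, hpq, hp, hq⟩ := exists_orthonormal_normal a hmn
  have hker : ∀ r : Fin n → ℝ, aᵀ *ᵥ r = 0 → (a * pinv a) *ᵥ r = 0 := fun r hr => by
    rw [pinv, ← Matrix.mul_assoc, ← Matrix.mulVec_mulVec, hr, Matrix.mulVec_zero]
  let w : Fin n → ℝ := fun s => a s ⟨0, hm⟩
  have hw : (a * pinv a) *ᵥ w = w := by
    have h1 : a * pinv a * a = a := ha.mul_pinv_mul a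
    funext s
    exact congrFun (congrFun h1 s) ⟨0, hm⟩
  have hww : 0 < w ⬝ᵥ w := by
    have h := ha.gram_posDef.diag_pos (i := ⟨0, hm⟩)
    simpa [Matrix.mul_apply, dotProduct, w] using h
  let e : Fin n → ℝ := (√(w ⬝ᵥ w))⁻¹ • w
  have he : (a * pinv a) *ᵥ e = e := by rw [Matrix.mulVec_smul, hw]
  have hee : e ⬝ᵥ e = 1 := by
    have hs := Real.sq_sqrt hww.le
    have hs0 := (Real.sqrt_pos.2 hww).ne'
    simp only [e, smul_dotProduct, dotProduct_smul, smul_eq_mul]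
    field_simp
    rw [hs]
  have hproj : ∀ r : Fin n → ℝ, vecMulVec r e * a * pinv a = vecMulVec r e := fun r => by
    rw [Matrix.mul_assoc, Matrix.vecMulVec_mul, ← Matrix.mulVec_transpose, proj_transpose, he]
  have htr : ∀ r s : Fin n → ℝ, (vecMulVec r e * (vecMulVec s e)ᵀ).trace = r ⬝ᵥ s := fun r s => by
    rw [Matrix.transpose_vecMulVec, Matrix.vecMulVec_mul_vecMulVec, hee, one_smul,
      Matrix.trace_vecMulVec]
  refine ⟨vecMulVec p e * a, vecMulVec q e * a, ?_, ?_⟩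
  · rw [orthPart, hproj, hproj, htr, htr, hpp, hpq, one_smul, zero_smul, sub_zero]
  · rw [ha.sectional_normal he (hker p hp) (hker q hq) hee hpp hqq hpq]
    have h3 : (m : ℝ) ≤ 3 := by exact_mod_cast hm3
    exact mul_pos (by linarith) (Real.sqrt_pos.2 ha)

theorem _root_.ContDiffAt.horPart {E : Type*} [NormedAddCommGroup E] [NormedSpace ℝ E] {x : E}
    {k : WithTop ℕ∞} {A U : E → Matrix (Fin n) (Fin m) ℝ} (hA : ContDiffAt ℝ k A x)
    (hU : ContDiffAt ℝ k U x) (ha : Full (A x)) :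
    ContDiffAt ℝ k (fun y => horPart (A y) (U y)) x :=
  (((hA.matrix_mul (hA.pinv ha)).matrix_mul hU).add
    ((hU.matrix_mul (hA.pinv ha)).matrix_transpose.matrix_mul hA)).const_smul (1 / 2 : ℝ)

theorem _root_.ContDiffAt.orthPart {E : Type*} [NormedAddCommGroup E] [NormedSpace ℝ E] {x : E}
    {k : WithTop ℕ∞} {A U V : E → Matrix (Fin n) (Fin m) ℝ} (hA : ContDiffAt ℝ k A x)
    (hU : ContDiffAt ℝ k U x) (hV : ContDiffAt ℝ k V x) (ha : Full (A x)) :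
    ContDiffAt ℝ k (fun y => orthPart (A y) (U y) (V y)) x := by
  have hu := hU.matrix_mul (hA.pinv ha)
  have hv := hV.matrix_mul (hA.pinv ha)
  exact ((hu.matrix_mul hu.matrix_transpose).matrix_trace.smul hV).sub
    ((hu.matrix_mul hv.matrix_transpose).matrix_trace.smul hU)

end MatrixDirections

/-! ### One-forms with prescribed values and curvatures -/

section Horizontal

variable {m n : ℕ} {H : Type*} [TopologicalSpace H]
  {I : ModelWithCorners ℝ (EuclideanSpace ℝ (Fin m)) H}
  {M : Type*} [TopologicalSpace M] [ChartedSpace H M] {α ζ η : RawForm I M n}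

theorem IsHorizontal.add_smul (hζ : IsHorizontal I α ζ) (hη : IsHorizontal I α η) (c : ℝ) :
    IsHorizontal I α (η + c • ζ) := fun x b => by
  have e : frameMatrix I b ((η + c • ζ) x) = frameMatrix I b (η x) + c • frameMatrix I b (ζ x) :=
    (frameMatrix_add _ _ _).trans (congrArg _ (frameMatrix_smul _ _ _))
  rw [e, Matrix.add_mul, Matrix.smul_mul]
  exact (hη x b).add ((hζ x b).smul c)

theorem IsHorizontal.const_smul (hζ : IsHorizontal I α ζ) (c : ℝ) :
    IsHorizontal I α (c • ζ) := fun x b => by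
  have e : frameMatrix I b ((c • ζ) x) = c • frameMatrix I b (ζ x) := frameMatrix_smul _ _ _
  rw [e, Matrix.smul_mul]
  exact (hζ x b).smul c

theorem SmoothMatAt.smul {χ : M → ℝ} (hχ : ContMDiff I 𝓘(ℝ, ℝ) ∞ χ)
    {g : ℝ × M → Matrix (Fin n) (Fin m) ℝ} {p : ℝ × M} (hg : SmoothMatAt I g p) :
    SmoothMatAt I (fun q => χ q.2 • g q) p := by
  have h : ContMDiffAt (𝓘(ℝ, ℝ).prod I) 𝓘(ℝ, ℝ) ∞ (fun q : ℝ × M => χ q.2) p :=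
    hχ.contMDiffAt.comp p contMDiffAt_snd
  have h' := ContMDiffAt.smul (G := ℝ) (M := Fin n → Fin m → ℝ) h hg
  exact h'

end Horizontal

section Existence

attribute [local instance] Matrix.normedAddCommGroup Matrix.normedSpace

variable {m n : ℕ} {H : Type*} [TopologicalSpace H]
  {I : ModelWithCorners ℝ (EuclideanSpace ℝ (Fin m)) H}
  {M : Type*} [TopologicalSpace M] [ChartedSpace H M] [IsManifold I ∞ M]
  {α ζ η : RawForm I M n}

theorem Omega.smul {χ : M → ℝ} (hχ : ContMDiff I 𝓘(ℝ, ℝ) ∞ χ) (hζ : ζ ∈ Omega I M n) :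
    (fun x => χ x • ζ x) ∈ Omega I M n := by
  rw [mem_omega_iff, isSmoothPathOn_iff isOpen_univ] at hζ ⊢
  intro t ht c x hx
  simp only [chartMatrix_smul]
  exact (hζ t ht c x hx).smul hχ

/-- A pointwise operation that is given by the same smooth formula in all frames maps one-forms to
one-forms. -/
theorem exists_omega_op (hα : α ∈ OmegaPlus I M n) (hζ : ζ ∈ Omega I M n) (hη : η ∈ Omega I M n)
    (F : Matrix (Fin n) (Fin m) ℝ → Matrix (Fin n) (Fin m) ℝ → Matrix (Fin n) (Fin m) ℝ →
      Matrix (Fin n) (Fin m) ℝ)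
    (hF : ∀ a u v (q : Matrix (Fin m) (Fin m) ℝ), q.det ≠ 0 →
      F (a * q) (u * q) (v * q) = F a u v * q)
    (hF' : ∀ q : ℝ × Matrix (Fin n) (Fin m) ℝ × Matrix (Fin n) (Fin m) ℝ ×
      Matrix (Fin n) (Fin m) ℝ, Full q.2.1 →
      ContDiffAt ℝ ∞ (fun q : ℝ × Matrix (Fin n) (Fin m) ℝ × Matrix (Fin n) (Fin m) ℝ ×
        Matrix (Fin n) (Fin m) ℝ => F q.2.1 q.2.2.1 q.2.2.2) q) :
    ∃ β ∈ Omega I M n, ∀ x (b : Module.Basis (Fin m) ℝ (TangentSpace I x)),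
      frameMatrix I b (β x) =
        F (frameMatrix I b (α x)) (frameMatrix I b (ζ x)) (frameMatrix I b (η x)) := by
  obtain ⟨β, hβ⟩ := exists_form (I := I)
    (fun x b => F (frameMatrix I b (α x)) (frameMatrix I b (ζ x)) (frameMatrix I b (η x)))
    fun x b b' => by
      rw [frameMatrix_change b b' (α x), frameMatrix_change b b' (ζ x),
        frameMatrix_change b b' (η x), hF _ _ _ _ (det_toMatrix_ne_zero b b')]
  exact ⟨β, mem_omega_iff.2 <| isSmoothPathOn_of_op isOpen_univ (mem_omega_iff.1 hα.1)
    (mem_omega_iff.1 hζ) (mem_omega_iff.1 hη) (fun _ => F) (fun _ _ => hβ)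
    fun t _ x b => hF' _ ((full_frameMatrix_iff b _).2 (hα.2 x)), hβ⟩

variable [T2Space M]

/-- A smooth function that is `1` at `x₀` and vanishes off a given neighbourhood of `x₀`. -/
theorem exists_contMDiff_eq_one (x₀ : M) {N : Set M} (hN : N ∈ nhds x₀) :
    ∃ χ : M → ℝ, ContMDiff I 𝓘(ℝ, ℝ) ∞ χ ∧ χ x₀ = 1 ∧ tsupport χ ⊆ N := by
  obtain ⟨f, -, hf⟩ := (SmoothBumpFunction.nhds_basis_tsupport (I := I) x₀).mem_iff.1 hN
  exact ⟨f, f.contMDiff, f.eq_one, hf⟩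

/-- There is a one-form with any given value at a point. -/
theorem exists_omega_eq (x₀ : M) (A : Matrix (Fin n) (Fin m) ℝ) :
    ∃ ζ ∈ Omega I M n, chartMatrix I x₀ x₀ (ζ x₀) = A := by
  obtain ⟨χ, hχ, hχ1, hsupp⟩ := exists_contMDiff_eq_one (I := I) x₀
    ((chartAt H x₀).open_source.mem_nhds (mem_chart_source H x₀))
  let ζ : RawForm I M n := fun x => χ x • ((matrixOfCLM.symm A :
    EuclideanSpace ℝ (Fin m) →L[ℝ] EuclideanSpace ℝ (Fin n)) ∘L
      (trivializationAt (EuclideanSpace ℝ (Fin m)) (TangentSpace I : M → Type _)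
        x₀).continuousLinearMapAt ℝ x)
  have hζ : ∀ x ∈ (chartAt H x₀).source, chartMatrix I x₀ x (ζ x) = χ x • A := fun x hx => by
    simp only [ζ]
    rw [chartMatrix_smul, chartMatrix_eq_matrixOfCLM]
    congr 1
    conv_rhs => rw [← matrixOfCLM.apply_symm_apply A]
    congr 1
    ext v i
    simp only [ContinuousLinearMap.comp_apply]
    rw [Trivialization.continuousLinearMapAt_symmL _ (by simpa using hx)]
  refine ⟨ζ, ?_, by rw [hζ x₀ (mem_chart_source H x₀), hχ1, one_smul]⟩
  rw [mem_omega_iff, isSmoothPathOn_iff isOpen_univ]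
  intro t _ c x hx
  -- Near the support of `χ` the form is `χ` times a constant matrix in the chart at `x₀`, and
  -- smoothness passes to the chart at `c`; away from the support the form is locally zero.
  by_cases h : x ∈ tsupport χ
  · rw [smoothMatAt_chart_iff (fun _ => ζ) t hx (hsupp h)]
    have h1 : SmoothMatAt I (fun q : ℝ × M => χ q.2 • A) (t, x) :=
      SmoothMatAt.smul (g := fun _ => A) hχ contMDiffAt_const
    refine ContMDiffAt.congr_of_eventuallyEq h1 ?_
    filter_upwards [continuous_snd.continuousAt.preimage_mem_nhds
      ((chartAt H x₀).open_source.mem_nhds (hsupp h))] with q hq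
    rw [hζ q.2 hq]
  · have h1 : SmoothMatAt I (fun _ : ℝ × M => (0 : Matrix (Fin n) (Fin m) ℝ)) (t, x) :=
      contMDiffAt_const
    refine ContMDiffAt.congr_of_eventuallyEq h1 ?_
    filter_upwards [continuous_snd.continuousAt.preimage_mem_nhds
      ((isClosed_tsupport χ).isOpen_compl.mem_nhds h)] with q hq
    have h2 : χ q.2 = 0 := image_eq_zero_of_notMem_tsupport hq
    simp only [ζ]
    rw [chartMatrix_smul, h2, zero_smul]

/-- There is a horizontal one-form with any given horizontal value at a point. -/
theorem exists_isHorizontal_eq (hα : α ∈ OmegaPlus I M n) (x₀ : M)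
    {u : Matrix (Fin n) (Fin m) ℝ} (hu : horPart (chartMatrix I x₀ x₀ (α x₀)) u = u) :
    ∃ ζ ∈ Omega I M n, IsHorizontal I α ζ ∧ chartMatrix I x₀ x₀ (ζ x₀) = u := by
  obtain ⟨ζ, hζ, hζu⟩ := exists_omega_eq (I := I) x₀ u
  obtain ⟨β, hβ, hβ'⟩ := exists_omega_op hα hζ hζ (fun a u _ => horPart a u)
    (fun a u _ q hq => horPart_mul a u hq)
    fun q hq => ContDiffAt.horPart contDiffAt_snd.fst contDiffAt_snd.snd.fst hq
  refine ⟨β, hβ, fun x b => ?_, ?_⟩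
  · rw [hβ']
    exact horPart_isSymm _ _
  · rw [chartMatrix_eq x₀ x₀ (mem_chart_source H x₀)] at hu hζu ⊢
    rw [hβ', hζu, hu]

variable [CompactSpace M]

theorem ne_zero_of_sectional_left (hα : α ∈ OmegaPlus I M n) (hζ : ζ ∈ Omega I M n)
    (hη : η ∈ Omega I M n) (h : sectional (Omega I M n) (formMetric I) α ζ η ≠ 0) : ζ ≠ 0 := by
  rintro rfl
  have h1 := sectional_form_smul hα hζ hη 0 1
  rw [zero_smul_form, one_smul] at h1
  exact h (by rw [h1]; ring)

theorem ne_zero_of_sectional_right (hα : α ∈ OmegaPlus I M n) (hζ : ζ ∈ Omega I M n)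
    (hη : η ∈ Omega I M n) (h : sectional (Omega I M n) (formMetric I) α ζ η ≠ 0) : η ≠ 0 := by
  rintro rfl
  have h1 := sectional_form_smul hα hζ hη 1 0
  rw [zero_smul_form, one_smul] at h1
  exact h (by rw [h1]; ring)

/-- There is a horizontal plane of negative curvature. -/
theorem exists_sectional_horizontal_neg [Nonempty M] (hm : 2 ≤ m) (hα : α ∈ OmegaPlus I M n) :
    ∃ ζ ∈ Omega I M n, ∃ η ∈ Omega I M n, IsHorizontal I α ζ ∧ IsHorizontal I α η ∧
      Orthonormal₂ (formMetric I) α ζ η ∧ sectional (Omega I M n) (formMetric I) α ζ η < 0 := by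
  obtain ⟨x₀⟩ := ‹Nonempty M›
  have hx₀ := mem_chart_source H x₀
  obtain ⟨u, v, hu, hv, huv⟩ := (OmegaPlus.full hα hx₀).exists_horizontal hm
  obtain ⟨ζ, hζ, hζh, hζu⟩ := exists_isHorizontal_eq hα x₀ hu
  obtain ⟨η, hη, hηh, hηv⟩ := exists_isHorizontal_eq hα x₀ hv
  have hζ0 : ζ ≠ 0 := fun h => by
    have h1 : u = 0 := by
      rw [← hζu, h]
      exact frameMatrix_zero _
    have h2 := huv.ne_zero 0
    simp [h1, tracelessPart] at h2
  -- Gram–Schmidt with a constant coefficient: `η + c • ζ` remains smooth and horizontal, and adding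
  -- a multiple of `u` to `v` keeps the traceless parts independent.
  let c := -(formMetric I α ζ η / formMetric I α ζ ζ)
  have hη' : η + c • ζ ∈ Omega I M n := Omega.add hη (Omega.const_smul hζ c)
  have hηh' := hζh.add_smul hηh c
  have hli : LinearIndependent ℝ ![tracelessPart (chartMatrix I x₀ x₀ (α x₀))
      (chartMatrix I x₀ x₀ (ζ x₀)), tracelessPart (chartMatrix I x₀ x₀ (α x₀))
      (chartMatrix I x₀ x₀ ((η + c • ζ) x₀))] := by
    have e : chartMatrix I x₀ x₀ ((η + c • ζ) x₀) = v + c • u := by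
      rw [← hζu, ← hηv]
      exact (frameMatrix_add _ _ _).trans (congrArg _ (frameMatrix_smul _ _ _))
    rw [e, hζu, tracelessPart_add_smul]
    rw [LinearIndependent.pair_iff] at huv ⊢
    intro s t hst
    obtain ⟨h1, h2⟩ := huv (s + t * c) t (by rw [← hst]; module)
    rw [h2, zero_mul, add_zero] at h1
    exact ⟨h1, h2⟩
  have horth : formMetric I α ζ (η + c • ζ) = 0 := by
    rw [formMetric_comm, formMetric_add_left hα hη (Omega.const_smul hζ c) hζ,
      formMetric_smul_left, formMetric_comm α η ζ]
    have := (formMetric_self_pos hα hζ hζ0).ne'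
    simp only [c]
    field_simp
    ring
  have hK : sectional (Omega I M n) (formMetric I) α ζ (η + c • ζ) < 0 := by
    simp only [chartMatrix_eq x₀ x₀ hx₀] at hli
    exact sectional_horizontal_neg (by omega) hα hζ hη' hζh hηh' _ hli
  have hη0 := ne_zero_of_sectional_right hα hζ hη' hK.ne
  obtain ⟨r, hr, s, hs, ho, hrs⟩ := exists_orthonormal hα hζ hη' hζ0 hη0 horth
  refine ⟨_, Omega.const_smul hζ r, _, Omega.const_smul hη' s, hζh.const_smul r,
    hηh'.const_smul s, ho, ?_⟩
  rw [hrs]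
  exact mul_neg_of_pos_of_neg (by positivity) hK

/-- If the curvature is positive at a point, then it is positive after a cutoff. -/
theorem exists_sectional_smul_pos (hα : α ∈ OmegaPlus I M n) (hζ : ζ ∈ Omega I M n)
    (hη : η ∈ Omega I M n) (x₀ : M) (hpos : 0 < sectional univ matMetric
      (chartMatrix I x₀ x₀ (α x₀)) (chartMatrix I x₀ x₀ (ζ x₀)) (chartMatrix I x₀ x₀ (η x₀))) :
    ∃ χ : M → ℝ, ContMDiff I 𝓘(ℝ, ℝ) ∞ χ ∧
      0 < sectional (Omega I M n) (formMetric I) α (fun x => χ x • ζ x) η := by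
  have hx₀ := mem_chart_source H x₀
  have hN : {x | x ∈ (chartAt H x₀).source ∧ 0 < sectional univ matMetric
      (chartMatrix I x₀ x (α x)) (chartMatrix I x₀ x (ζ x)) (chartMatrix I x₀ x (η x))} ∈
      nhds x₀ := by
    have hs := (chartAt H x₀).open_source.mem_nhds hx₀
    have hc := (continuousDensity_sectional hα hζ hη x₀).continuousAt hs
    exact Filter.inter_mem hs (hc.eventually (lt_mem_nhds hpos))
  obtain ⟨χ, hχ, hχ1, hsupp⟩ := exists_contMDiff_eq_one (I := I) x₀ hN
  -- The pointwise curvature is quadratic in `ζ` and contains no derivatives in `x`, so the cutoff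
  -- only multiplies it by `χ²`. It is nonnegative everywhere because the support lies where the
  -- curvature was positive.
  have hsec : ∀ x (b : Module.Basis (Fin m) ℝ (TangentSpace I x)), sectional univ matMetric
      (frameMatrix I b (α x)) (frameMatrix I b (χ x • ζ x)) (frameMatrix I b (η x)) =
      χ x ^ 2 * sectional univ matMetric (frameMatrix I b (α x)) (frameMatrix I b (ζ x))
        (frameMatrix I b (η x)) := fun x b => by
    have h1 := ((full_frameMatrix_iff b _).2 (hα.2 x)).sectional_smul (χ x) 1
      (frameMatrix I b (ζ x)) (frameMatrix I b (η x))
    rwa [one_smul, one_pow, mul_one, ← frameMatrix_smul] at h1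
  refine ⟨χ, hχ, sectional_pos_of_nonneg hα (Omega.smul hχ hζ) hη (fun x b => ?_)
    (chartBasis x₀ x₀ hx₀) ?_⟩
  · rw [hsec]
    by_cases hx : x ∈ tsupport χ
    · obtain ⟨hx1, hx2⟩ := hsupp hx
      simp only [chartMatrix_eq x₀ x hx1] at hx2
      obtain ⟨r, hr, e⟩ := sectional_frame_change hα ζ η (chartBasis x₀ x hx1) b
      rw [e]
      exact mul_nonneg (sq_nonneg _) (mul_pos hr hx2).le
    · rw [image_eq_zero_of_notMem_tsupport hx, zero_pow two_ne_zero, zero_mul]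
  · simp only [chartMatrix_eq x₀ x₀ hx₀] at hpos
    rwa [hsec, hχ1, one_pow, one_mul]

/-- There is a plane of positive curvature if the codimension is at least two. -/
theorem exists_sectional_pos [Nonempty M] (hm : 1 ≤ m) (hm3 : m ≤ 3) (hmn : m + 2 ≤ n)
    (hα : α ∈ OmegaPlus I M n) :
    ∃ ζ ∈ Omega I M n, ∃ η ∈ Omega I M n, Orthonormal₂ (formMetric I) α ζ η ∧
      0 < sectional (Omega I M n) (formMetric I) α ζ η := by
  obtain ⟨x₀⟩ := ‹Nonempty M›
  have hx₀ := mem_chart_source H x₀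
  obtain ⟨u, v, huv, hpos⟩ := (OmegaPlus.full hα hx₀).exists_sectional_pos hm hm3 hmn
  obtain ⟨ζ, hζ, hζu⟩ := exists_omega_eq (I := I) x₀ u
  obtain ⟨η', hη', hηv⟩ := exists_omega_eq (I := I) x₀ v
  -- The second form is made orthogonal to `ζ` at every point. A cutoff of `ζ` preserves this
  -- pointwise orthogonality, and the value at `x₀` is still `v` because `orthPart` fixes it.
  obtain ⟨η, hη, hηF⟩ := exists_omega_op hα hζ hη' orthPart
    (fun a u v q hq => orthPart_mul a u v hq)
    fun q hq => ContDiffAt.orthPart contDiffAt_snd.fst contDiffAt_snd.snd.fst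
      contDiffAt_snd.snd.snd hq
  have hηF' : ∀ c x, x ∈ (chartAt H c).source → chartMatrix I c x (η x) =
      orthPart (chartMatrix I c x (α x)) (chartMatrix I c x (ζ x)) (chartMatrix I c x (η' x)) :=
    fun c x hx => by simp only [chartMatrix_eq c x hx, hηF]
  obtain ⟨χ, hχ, hK⟩ := exists_sectional_smul_pos hα hζ hη x₀
    (by rwa [hηF' _ _ hx₀, hζu, hηv, huv])
  have hζ' := Omega.smul hχ hζ
  have horth : formMetric I α (fun x => χ x • ζ x) η = 0 := by
    rw [formMetric, ← densityIntegral_zero (I := I) (M := M)]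
    refine densityIntegral_congr fun c x hx => ?_
    rw [chartMatrix_smul, matMetric_smul_left, hηF' c x hx,
      (OmegaPlus.full hα hx).matMetric_orthPart, mul_zero]
  have hζ0 := ne_zero_of_sectional_left hα hζ' hη hK.ne'
  have hη0 := ne_zero_of_sectional_right hα hζ' hη hK.ne'
  obtain ⟨r, hr, s, hs, ho, hrs⟩ := exists_orthonormal hα hζ' hη hζ0 hη0 horth
  refine ⟨_, Omega.const_smul hζ' r, _, Omega.const_smul hη s, ho, ?_⟩
  rw [hrs]
  exact mul_pos (by positivity) hK

end Existence

end GenEbin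

end

theorem mainTheorem11 {m n : ℕ} (hm : 1 ≤ m) (hmn : m ≤ n)
    {H : Type*} [TopologicalSpace H] (I : ModelWithCorners ℝ (EuclideanSpace ℝ (Fin m)) H)
    {M : Type*} [TopologicalSpace M] [ChartedSpace H M] [IsManifold I ∞ M]
    [CompactSpace M] [T2Space M] [Nonempty M] :
    -- the Levi-Civita connection of the matrix metric is well defined
    (∀ a : Matrix (Fin n) (Fin m) ℝ, a.rank = m → ∀ u v : Matrix (Fin n) (Fin m) ℝ,
      (∃! c, GenEbin.IsChristoffelAt univ GenEbin.matMetric a u v c) ∧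
      ∀ z : Matrix (Fin n) (Fin m) ℝ, DifferentiableAt ℝ
        (fun t : ℝ => GenEbin.christoffel univ GenEbin.matMetric (a + t • z) u v) 0) ∧
    -- the Levi-Civita connection of the generalized Ebin metric exists, is smooth and pointwise
    (∀ α ∈ GenEbin.OmegaPlus I M n, ∀ ζ ∈ GenEbin.Omega I M n, ∀ η ∈ GenEbin.Omega I M n,
      GenEbin.DensityIntegrable I (fun c x => GenEbin.matMetric (GenEbin.chartMatrix I c x (α x))
        (GenEbin.chartMatrix I c x (ζ x)) (GenEbin.chartMatrix I c x (η x))) ∧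
      (∃! c, GenEbin.IsChristoffelAt (GenEbin.Omega I M n) (GenEbin.formMetric I) α ζ η c) ∧
      ∀ (x : M) (b : Module.Basis (Fin m) ℝ (TangentSpace I x)),
        GenEbin.frameMatrix I b
            (GenEbin.christoffel (GenEbin.Omega I M n) (GenEbin.formMetric I) α ζ η x) =
          GenEbin.christoffel univ GenEbin.matMetric (GenEbin.frameMatrix I b (α x))
            (GenEbin.frameMatrix I b (ζ x)) (GenEbin.frameMatrix I b (η x))) ∧
    (∀ (J : Set ℝ) (α ζ η : ℝ → GenEbin.RawForm I M n), IsOpen J →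
      GenEbin.IsOmegaPlusPathOn I J α → GenEbin.IsSmoothPathOn I J ζ →
      GenEbin.IsSmoothPathOn I J η →
      GenEbin.IsSmoothPathOn I J (fun t =>
        GenEbin.christoffel (GenEbin.Omega I M n) (GenEbin.formMetric I) (α t) (ζ t) (η t))) ∧
    -- the geodesic equation is the matrix ODE at every point
    (∀ (J : Set ℝ) (α : ℝ → GenEbin.RawForm I M n), IsOpen J →
      GenEbin.IsOmegaPlusPathOn I J α →
      (GenEbin.IsGeodesicOn I J α ↔
        ∀ t ∈ J, ∀ (x : M) (b : Module.Basis (Fin m) ℝ (TangentSpace I x)),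
          deriv (deriv (fun s => GenEbin.frameMatrix I b (α s x))) t =
            GenEbin.geodesicRHS (GenEbin.frameMatrix I b (α t x))
              (deriv (fun s => GenEbin.frameMatrix I b (α s x)) t)) ∧
      (GenEbin.IsGeodesicOn I J α ↔
        ∀ t ∈ J, deriv (deriv α) t =
          GenEbin.christoffel (GenEbin.Omega I M n) (GenEbin.formMetric I)
            (α t) (deriv α t) (deriv α t))) ∧
    -- explicit solution of the initial value problem
    (∀ α₀ ∈ GenEbin.OmegaPlus I M n, ∀ ζ₀ ∈ GenEbin.Omega I M n,
      (∃ ε > (0 : ℝ), ∀ t ∈ Ioo (-ε) ε,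
        ∀ (x : M) (b : Module.Basis (Fin m) ℝ (TangentSpace I x)),
          0 < GenEbin.solF (GenEbin.frameMatrix I b (α₀ x)) (GenEbin.frameMatrix I b (ζ₀ x)) t) ∧
      ∀ J : Set ℝ, IsOpen J → J.OrdConnected → (0 : ℝ) ∈ J →
        ((∃ α, GenEbin.IsGeodesicFrom I J α₀ ζ₀ α) ↔
          ∀ t ∈ J, ∀ (x : M) (b : Module.Basis (Fin m) ℝ (TangentSpace I x)),
            0 < GenEbin.solF (GenEbin.frameMatrix I b (α₀ x))
              (GenEbin.frameMatrix I b (ζ₀ x)) t) ∧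
        ∀ α, GenEbin.IsGeodesicFrom I J α₀ ζ₀ α →
          ∀ t ∈ J, ∀ (x : M) (b : Module.Basis (Fin m) ℝ (TangentSpace I x)),
            GenEbin.frameMatrix I b (α t x) =
              GenEbin.explicitSol (GenEbin.frameMatrix I b (α₀ x))
                (GenEbin.frameMatrix I b (ζ₀ x)) t) ∧
    -- the sectional curvature
    (∀ α ∈ GenEbin.OmegaPlus I M n,
      -- it is the integral of the pointwise curvatures
      (∀ ζ ∈ GenEbin.Omega I M n, ∀ η ∈ GenEbin.Omega I M n,
        GenEbin.DensityIntegrable I (fun c x => GenEbin.sectional univ GenEbin.matMetric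
          (GenEbin.chartMatrix I c x (α x)) (GenEbin.chartMatrix I c x (ζ x))
          (GenEbin.chartMatrix I c x (η x))) ∧
        GenEbin.sectional (GenEbin.Omega I M n) (GenEbin.formMetric I) α ζ η =
          GenEbin.densityIntegral I (fun c x => GenEbin.sectional univ GenEbin.matMetric
            (GenEbin.chartMatrix I c x (α x)) (GenEbin.chartMatrix I c x (ζ x))
            (GenEbin.chartMatrix I c x (η x)))) ∧
      -- (1) pure trace directions
      (∀ ζ ∈ GenEbin.Omega I M n, ∀ η ∈ GenEbin.Omega I M n,
        GenEbin.IsPureTrace I α ζ ∨ GenEbin.IsPureTrace I α η →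
        GenEbin.sectional (GenEbin.Omega I M n) (GenEbin.formMetric I) α ζ η = 0) ∧
      -- (2) horizontal directions
      (2 ≤ m →
        (∀ ζ ∈ GenEbin.Omega I M n, ∀ η ∈ GenEbin.Omega I M n,
          GenEbin.IsHorizontal I α ζ → GenEbin.IsHorizontal I α η →
          GenEbin.sectional (GenEbin.Omega I M n) (GenEbin.formMetric I) α ζ η ≤ 0 ∧
          ((∃ (x : M) (b : Module.Basis (Fin m) ℝ (TangentSpace I x)),
            LinearIndependent ℝ
              ![GenEbin.tracelessPart (GenEbin.frameMatrix I b (α x))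
                  (GenEbin.frameMatrix I b (ζ x)),
                GenEbin.tracelessPart (GenEbin.frameMatrix I b (α x))
                  (GenEbin.frameMatrix I b (η x))]) →
            GenEbin.sectional (GenEbin.Omega I M n) (GenEbin.formMetric I) α ζ η < 0)) ∧
        ∃ ζ ∈ GenEbin.Omega I M n, ∃ η ∈ GenEbin.Omega I M n,
          GenEbin.IsHorizontal I α ζ ∧ GenEbin.IsHorizontal I α η ∧
          GenEbin.Orthonormal₂ (GenEbin.formMetric I) α ζ η ∧
          GenEbin.sectional (GenEbin.Omega I M n) (GenEbin.formMetric I) α ζ η < 0) ∧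
      -- (3) the one-dimensional case
      (m = 1 → ∀ ζ ∈ GenEbin.Omega I M n, ∀ η ∈ GenEbin.Omega I M n,
        0 ≤ GenEbin.sectional (GenEbin.Omega I M n) (GenEbin.formMetric I) α ζ η ∧
        (n = 2 → GenEbin.sectional (GenEbin.Omega I M n) (GenEbin.formMetric I) α ζ η = 0)) ∧
      -- (4) both signs occur
      (m = 2 ∨ m = 3 → m + 2 ≤ n →
        (∃ ζ ∈ GenEbin.Omega I M n, ∃ η ∈ GenEbin.Omega I M n,
          GenEbin.Orthonormal₂ (GenEbin.formMetric I) α ζ η ∧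
          0 < GenEbin.sectional (GenEbin.Omega I M n) (GenEbin.formMetric I) α ζ η) ∧
        ∃ ζ ∈ GenEbin.Omega I M n, ∃ η ∈ GenEbin.Omega I M n,
          GenEbin.Orthonormal₂ (GenEbin.formMetric I) α ζ η ∧
          GenEbin.sectional (GenEbin.Omega I M n) (GenEbin.formMetric I) α ζ η < 0)) := by
  refine ⟨fun a ha u v => ?_, fun α hα ζ hζ η hη => ⟨?_, ?_, ?_⟩,
    fun J α ζ η hJ hα hζ hη => ?_, fun J α hJ hα => ⟨GenEbin.isGeodesicOn_iff_ode hJ hα, ?_⟩,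
    fun α hα ζ hζ => ⟨GenEbin.exists_solF_pos hα hζ, fun J hJ hJc h0 => ⟨⟨?_, ?_⟩, ?_⟩⟩,
    fun α hα => ⟨fun ζ hζ η hη => ⟨?_, ?_⟩, ?_, fun hm2 => ⟨?_, ?_⟩, ?_, ?_⟩⟩
  · have ha' := GenEbin.full_iff_rank.2 ha
    exact ⟨⟨_, ha'.isChristoffelAt u v, fun c hc =>
      ha'.isChristoffelAt_unique hc (ha'.isChristoffelAt u v)⟩,
      fun z => HasDerivAt.differentiableAt (F := Fin n → Fin m → ℝ)
        (ha'.hasDerivAt_christoffel z u v)⟩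
  · exact (GenEbin.continuousDensity_matMetric hα hζ hη).densityIntegrable
  · exact ⟨_, GenEbin.isChristoffelAt_form hα hζ hη, fun c hc =>
      GenEbin.isChristoffelAt_form_unique hα hc (GenEbin.isChristoffelAt_form hα hζ hη)⟩
  · exact GenEbin.frameMatrix_christoffel hα hζ hη
  · exact (GenEbin.isSmoothPathOn_formChristoffel hJ hα hζ hη).congr fun t ht =>
      GenEbin.christoffel_form_eq (hα.2 t ht) (hζ.mem_omega ht) (hη.mem_omega ht)
  · rw [GenEbin.isGeodesicOn_iff_defect hJ hα]
    refine forall₂_congr fun t ht => ?_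
    have hv := (hα.1.deriv hJ).mem_omega ht
    rw [GenEbin.geodesicDefect_eq_zero_iff, GenEbin.christoffel_form_eq (hα.2 t ht) hv hv]
  · rintro ⟨γ, hγ⟩ t ht x b
    exact hγ.solF_pos hJ hJc h0 ht x b
  · exact GenEbin.exists_isGeodesicFrom hm hα hζ hJ hJc h0
  · exact fun γ hγ t ht x b => hγ.eq_explicitSol hm hJ hJc h0 ht x b
  · exact (GenEbin.continuousDensity_sectional hα hζ hη).densityIntegrable
  · exact GenEbin.sectional_form_eq hα hζ hη
  · exact fun ζ hζ η hη h => GenEbin.sectional_pureTrace hα hζ hη h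
  · exact fun ζ hζ η hη h h' => ⟨GenEbin.sectional_horizontal_nonpos hm hα hζ hη h h',
      fun ⟨_, b, hi⟩ => GenEbin.sectional_horizontal_neg hm hα hζ hη h h' b hi⟩
  · exact GenEbin.exists_sectional_horizontal_neg hm2 hα
  · rintro rfl ζ hζ η hη
    refine ⟨GenEbin.sectional_curve_nonneg hα hζ hη, ?_⟩
    rintro rfl
    exact GenEbin.sectional_plane_curve hα hζ hη
  · intro hm23 hmn2
    obtain ⟨ζ, hζ, η, hη, -, -, h⟩ :=
      GenEbin.exists_sectional_horizontal_neg (m := m) (by omega) hα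
    exact ⟨GenEbin.exists_sectional_pos hm (by omega) hmn2 hα, ζ, hζ, η, hη, h⟩
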